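/- Let $p\ge 1$ be an integer, $q\in\mathbb{C}$ a primitive $p$-th root of unity, $R=\mathbb{C}[z,z^{-1}]$, and $\sigma$ the $\mathbb{C}$-algebra automorphism of $R$ with $\sigma(z)=q^{-1}z$. For $t\in R$ regular let $A(t)$ be the generalized Weyl algebra obtained from $R$ by adjoining $X,Y$ with the relations $Xr=\sigma(r)X$, $Yr=\sigma^{-1}(r)Y$ ($r\in R$), $YX=t$, $XY=\sigma(t)$. Let $\mathfrak m_k=(z-q^k)=\sigma^k(\mathfrak m_0)$, let $\omega=\{\mathfrak m_0,\dots,\mathfrak m_{p-1}\}$ be the $\sigma$-orbit of $\mathfrak m_0=(z-1)$, and let $\mathsf M\subset R$ be the multiplicative monoid generated by the elements $z-q^k$, $0\le k\le p-1$. Let $A(t)\text{-wmod}_\omega$ be the category of $A(t)$-modules $V$ with $V=\bigoplus_{\mathfrak m\in\operatorname{MaxSpec}R}V_{\mathfrak m}$, where $V_{\mathfrak m}=\{v\in V\mid \mathfrak m v=0\}$, such that every $V_{\mathfrak m}$ is finite dimensional over $R/\mathfrak m$ and $V_{\mathfrak m}=0$ for $\mathfrak m\notin\omega$. Put $$\mathscr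 A(\omega,\mathsf M)=\bigoplus_{t\in\mathsf M}\mathbb C\otimes_{\mathbb Z}K_0(A(t)\text{-wmod}_\omega),$$ with the multiplication $[V][V']=[V\otimes_R V']$, where for $V$ over $A(t)$ and $V'$ over $A(t')$ the algebra $A(tt')$ acts on $V\otimes_RV'$ by $r(v\otimes v')=rv\otimes v'$, $X(v\otimes v')=Xv\otimes Xv'$, $Y(v\otimes v')=Yv\otimes Yv'$. This is a commutative $\mathbb C$-algebra. Define the following elements of $\mathscr A(\omega,\mathsf M)$; indices $i,j,k,\ell$ are taken in $\mathbb Z/p=\{0,\dots,p-1\}$, and $e_k$ denotes a vector of weight $\mathfrak m_k$. * For $\xi\in\mathbb C^\times$, $u_\xi$ is the class of the $A(1)$-module with basis $e_1,\dots,e_p$, $Xe_k=e_{k+1}$ and $Ye_{k+1}=e_k$ for $1\le k<p$, $Xe_p=\xi e_1$, $Ye_1=\xi^{-1}e_p$. * $y_i$ (respectively $y_i^*$) is the class of the $A(t)$-module, $t=z-q^i$, with basis $e_k$, $k\in\mathbb Z/p$, in which $Xe_k=t(q^k)e_{k+1}$ and $Ye_{k+1}=e_k$ for $k\ne i$, and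 $Xe_i=e_{i+1}$, $Ye_{i+1}=0$ (respectively $Xe_i=0$, $Ye_{i+1}=e_i$). * $x_i$ is the class of the $A(t)$-module, $t=z-q^i$, with basis $e_{i+1},\dots,e_{i+p}$, $Xe_k=t(q^k)e_{k+1}$ and $Ye_{k+1}=e_k$ for $i<k<i+p$, $Xe_{i+p}=0$, $Ye_{i+1}=0$. * For $i\ne j$, with $0<d<p$ and $d\equiv j-i \pmod p$, $x_{ij}$ is the class of the $A(t)$-module, $t=(z-q^i)(z-q^j)$, with basis $e_{i+1},\dots,e_{i+d}$, $Xe_k=t(q^k)e_{k+1}$ and $Ye_{k+1}=e_k$ for $i<k<i+d$, $Xe_{i+d}=0$, $Ye_{i+1}=0$. We use the cyclic order $0<1<\dots<p-1<0$ on $\mathbb Z/p$: with $d(a,b)\in\{0,\dots,p-1\}$, $d(a,b)\equiv b-a\pmod p$, the relation $a\le b\le c$ means $d(a,b)\le d(a,c)$, the relation $a\le b<c$ means $d(a,b)<d(a,c)$, and $a<b\le c$, $a<b<c$ mean the same together with $a\ne b$. A longer chain of inequalities means that all its consecutive subchains of length three hold. Whenever $x_{ab}$ occurs, $a\neq b$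 is understood. **Theorem.** The algebra $\mathscr A(\omega,\mathsf M)$ is isomorphic, through the map that sends each generator to the element of the same name, to the commutative $\mathbb C$-algebra with generators $u_\xi$ ($\xi\in\mathbb C^\times$), $x_i,y_i,y_i^*$ ($i\in\mathbb Z/p$), $x_{ij}$ ($i\neq j$), subject to the relations (i) $u_1=1$; (ii) $u_\xi u_{\xi'}=u_{\xi\xi'}$; (iii) $u_\xi x_i=x_i$; (iv) $u_\xi x_{ij}=x_{ij}$; (v) $y_iy_j^*=x_ix_j=x_iy_j=x_iy_j^*=x_{ij}+x_{ji}$ if $i\ne j$; (vi) $y_iy_i^*=x_iy_i=x_iy_i^*=x_i^2$; (vii) $x_{ij}x_k=x_{ik}x_j+x_{kj}x_i$ if $i<k<j$; (viii) $x_{ij}x_{k\ell}=0$ if $i<j\le k<\ell\le i$; (ix) $x_{ij}x_{k\ell}=x_{kj}x_ix_\ell$ if $i\le k<j\le\ell\le i$; (x) $x_{ij}x_{k\ell}=x_{k\ell}x_ix_j$ if $i\le k<\ell\le j\le i$; (xi) $x_{ij}x_{k\ell}=x_{i\ell}x_kx_j+x_{kj}x_ix_\ell$ if $i<\ell<k<j\le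 i$; (xii) $x_{ij}y_k=x_{ij}y_k^*=x_{ij}x_k$ for all $i\neq j$ and all $k$. Moreover, the following elements, which are pairwise distinct, form a basis of $\mathscr A(\omega,\mathsf M)$ over $\mathbb C$: (1) $x_{ij}\prod_{k}x_k^{a_k}$ with $i\ne j$, $a_k\ge 0$, and $a_k=0$ unless $j\le k\le i$; (2) $x_i^a$ with $a>0$; (3) $u_\xi$ with $\xi\in\mathbb C^\times$; (4) $u_\xi\prod_ky_k^{a_k}$ with $\xi\in\mathbb C^\times$, $a_k\ge0$ not all zero; (5) $u_\xi\prod_k(y_k^*)^{a_k}$ with $\xi\in\mathbb C^\times$, $a_k\ge0$ not all zero. -/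

import Mathlib

open scoped TensorProduct DirectSum

set_option linter.unusedSectionVars false

universe u

noncomputable section

/-! ### Generalized Weyl algebras -/

/-- Generators of a generalized Weyl algebra over `R`: the elements of `R`, and `X`, `Y`. -/
inductive GWAGen (R : Type u) : Type u
  | coeff (r : R)
  | X
  | Y

namespace GWA

variable {R : Type u} [CommRing R]

/-- The defining relations of the generalized Weyl algebra `A(R, σ, t)`. The first three make the
inclusion of `R` a ring homomorphism. -/
inductive Rel (σ : R ≃+* R) (t : R) :
    FreeAlgebra ℤ (GWAGen R) → FreeAlgebra ℤ (GWAGen R) → Prop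
  | one : Rel σ t (FreeAlgebra.ι ℤ (.coeff 1)) 1
  | add (r s : R) : Rel σ t (FreeAlgebra.ι ℤ (.coeff (r + s)))
      (FreeAlgebra.ι ℤ (.coeff r) + FreeAlgebra.ι ℤ (.coeff s))
  | mul (r s : R) : Rel σ t (FreeAlgebra.ι ℤ (.coeff (r * s)))
      (FreeAlgebra.ι ℤ (.coeff r) * FreeAlgebra.ι ℤ (.coeff s))
  | X_coeff (r : R) : Rel σ t (FreeAlgebra.ι ℤ .X * FreeAlgebra.ι ℤ (.coeff r))
      (FreeAlgebra.ι ℤ (.coeff (σ r)) * FreeAlgebra.ι ℤ .X)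
  | Y_coeff (r : R) : Rel σ t (FreeAlgebra.ι ℤ .Y * FreeAlgebra.ι ℤ (.coeff r))
      (FreeAlgebra.ι ℤ (.coeff (σ.symm r)) * FreeAlgebra.ι ℤ .Y)
  | YX : Rel σ t (FreeAlgebra.ι ℤ .Y * FreeAlgebra.ι ℤ .X) (FreeAlgebra.ι ℤ (.coeff t))
  | XY : Rel σ t (FreeAlgebra.ι ℤ .X * FreeAlgebra.ι ℤ .Y) (FreeAlgebra.ι ℤ (.coeff (σ t)))

end GWA

/-- The generalized Weyl algebra `A(R, σ, t)` of rank one: the ring obtained from `R` by adjoining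
`X`, `Y` with `X r = σ(r) X`, `Y r = σ⁻¹(r) Y`, `Y X = t`, `X Y = σ(t)`. -/
def GWA {R : Type u} [CommRing R] (σ : R ≃+* R) (t : R) : Type u := RingQuot (GWA.Rel σ t)

namespace GWA

variable {R : Type u} [CommRing R] (σ : R ≃+* R) (t : R)

instance : Ring (GWA σ t) := inferInstanceAs (Ring (RingQuot (GWA.Rel σ t)))

/-- The quotient map from the free ring. -/
def mk : FreeAlgebra ℤ (GWAGen R) →+* GWA σ t := RingQuot.mkRingHom (GWA.Rel σ t)

/-- The canonical map `R → A(R, σ, t)`. -/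
def ofR : R →+* GWA σ t where
  toFun r := mk σ t (FreeAlgebra.ι ℤ (.coeff r))
  map_one' := (RingQuot.mkRingHom_rel (Rel.one (σ := σ) (t := t))).trans (map_one (mk σ t))
  map_mul' r s := (RingQuot.mkRingHom_rel (Rel.mul (σ := σ) (t := t) r s)).trans
    (map_mul (mk σ t) _ _)
  map_add' r s := (RingQuot.mkRingHom_rel (Rel.add (σ := σ) (t := t) r s)).trans
    (map_add (mk σ t) _ _)
  map_zero' := by
    have h := (RingQuot.mkRingHom_rel (Rel.add (σ := σ) (t := t) 0 0)).trans
      (map_add (mk σ t) _ _)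
    rw [add_zero] at h
    exact left_eq_add.mp h

/-- The generator `X`. -/
def X : GWA σ t := mk σ t (FreeAlgebra.ι ℤ .X)

/-- The generator `Y`. -/
def Y : GWA σ t := mk σ t (FreeAlgebra.ι ℤ .Y)

theorem X_mul_ofR (r : R) : X σ t * ofR σ t r = ofR σ t (σ r) * X σ t :=
  (map_mul (mk σ t) _ _).symm.trans
    ((RingQuot.mkRingHom_rel (Rel.X_coeff (σ := σ) (t := t) r)).trans (map_mul (mk σ t) _ _))

theorem Y_mul_ofR (r : R) : Y σ t * ofR σ t r = ofR σ t (σ.symm r) * Y σ t :=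
  (map_mul (mk σ t) _ _).symm.trans
    ((RingQuot.mkRingHom_rel (Rel.Y_coeff (σ := σ) (t := t) r)).trans (map_mul (mk σ t) _ _))

theorem Y_mul_X : Y σ t * X σ t = ofR σ t t :=
  (map_mul (mk σ t) _ _).symm.trans (RingQuot.mkRingHom_rel (Rel.YX (σ := σ) (t := t)))

theorem X_mul_Y : X σ t * Y σ t = ofR σ t (σ t) :=
  (map_mul (mk σ t) _ _).symm.trans (RingQuot.mkRingHom_rel (Rel.XY (σ := σ) (t := t)))

variable {σ t}

/-- The universal property of `A(R, σ, t)`. -/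
def lift {S : Type*} [Ring S] (φ : R →+* S) (x y : S) (hx : ∀ r, x * φ r = φ (σ r) * x)
    (hy : ∀ r, y * φ r = φ (σ.symm r) * y) (hyx : y * x = φ t) (hxy : x * y = φ (σ t)) :
    GWA σ t →+* S :=
  RingQuot.lift ⟨(FreeAlgebra.lift ℤ (A := S) (fun g : GWAGen R =>
      match g with
      | .coeff r => φ r
      | .X => x
      | .Y => y)).toRingHom, by
    intro a b h
    cases h <;> simp [hx, hy, hyx, hxy]⟩

section lift

variable {S : Type*} [Ring S] (φ : R →+* S) (x y : S) (hx : ∀ r, x * φ r = φ (σ r) * x)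
    (hy : ∀ r, y * φ r = φ (σ.symm r) * y) (hyx : y * x = φ t) (hxy : x * y = φ (σ t))

theorem lift_ofR (r : R) : lift φ x y hx hy hyx hxy (ofR σ t r) = φ r :=
  (RingQuot.lift_mkRingHom_apply _ _ _).trans (by simp)

theorem lift_X : lift φ x y hx hy hyx hxy (X σ t) = x :=
  (RingQuot.lift_mkRingHom_apply _ _ _).trans (by simp)

theorem lift_Y : lift φ x y hx hy hyx hxy (Y σ t) = y :=
  (RingQuot.lift_mkRingHom_apply _ _ _).trans (by simp)

end lift

theorem induction_on {P : GWA σ t → Prop} (a : GWA σ t) (hR : ∀ r, P (ofR σ t r))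
    (hX : P (X σ t)) (hY : P (Y σ t)) (hmul : ∀ a b, P a → P b → P (a * b))
    (hadd : ∀ a b, P a → P b → P (a + b)) : P a := by
  obtain ⟨b, rfl⟩ := RingQuot.mkRingHom_surjective (GWA.Rel σ t) a
  change P (mk σ t b)
  induction b using FreeAlgebra.induction with
  | grade0 n =>
    have : mk σ t (algebraMap ℤ _ n) = ofR σ t n := by simp
    rw [this]; exact hR _
  | grade1 x =>
    cases x with
    | coeff r => exact hR r
    | X => exact hX
    | Y => exact hY
  | mul a b ha hb => rw [map_mul]; exact hmul _ _ ha hb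
  | add a b ha hb => rw [map_add]; exact hadd _ _ ha hb

end GWA

/-! ### Weight modules -/

section Weight

variable (R : Type u) [CommRing R] (V : Type*) [AddCommGroup V] [Module R V]

/-- The weight space `V_𝔪 = {v | 𝔪 v = 0}`. -/
abbrev weightSpace (m : MaximalSpectrum R) : Submodule R V :=
  Submodule.torsionBySet R V (m.asIdeal : Set R)

open Classical in
/-- `V` is the direct sum of its weight spaces, these are finite dimensional over the residue
fields, and the support of `V` is contained in `ω`. -/
structure IsWeightModule (ω : Set (MaximalSpectrum R)) : Prop where
  isInternal : DirectSum.IsInternal (fun m : MaximalSpectrum R => weightSpace R V m)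
  finite : ∀ m : MaximalSpectrum R, Module.Finite (R ⧸ m.asIdeal) (weightSpace R V m)
  support_subset : {m : MaximalSpectrum R | weightSpace R V m ≠ ⊥} ⊆ ω

variable {R V}

theorem maximalSpectrum_sup_eq_top {m n : MaximalSpectrum R} (h : m ≠ n) :
    m.asIdeal ⊔ n.asIdeal = ⊤ :=
  m.isMaximal.coprime_of_ne n.isMaximal fun h' => h (MaximalSpectrum.ext h')

theorem iSupIndep_weightSpace : iSupIndep (fun m : MaximalSpectrum R => weightSpace R V m) := by
  rw [iSupIndep_iff_supIndep]
  intro s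
  exact Submodule.supIndep_torsionBySet_ideal fun m _ n _ h => maximalSpectrum_sup_eq_top h

theorem IsWeightModule.of_iSup [Module.Finite R V] (ω : Set (MaximalSpectrum R))
    (h : ⨆ m ∈ ω, weightSpace R V m = ⊤) : IsWeightModule R V ω := by
  classical
  have h' : ⨆ m, weightSpace R V m = ⊤ :=
    top_le_iff.mp (h ▸ iSup₂_le fun m _ => le_iSup (fun m => weightSpace R V m) m)
  refine ⟨DirectSum.isInternal_submodule_of_iSupIndep_of_iSup_eq_top iSupIndep_weightSpace h',
    fun m => ?_, fun m hm => ?_⟩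
  · have hc : IsCompl (⨆ (n) (_ : n ≠ m), weightSpace R V n) (weightSpace R V m) := by
      refine ⟨(iSupIndep_weightSpace m).symm, codisjoint_iff.mpr (top_le_iff.mp ?_)⟩
      rw [← h']
      refine iSup_le fun n => ?_
      by_cases hn : n = m
      · subst hn; exact le_sup_right
      · exact le_sup_of_le_left (le_iSup₂ (f := fun n (_ : n ≠ m) => weightSpace R V n) n hn)
    have : Module.Finite R (weightSpace R V m) :=
      Module.Finite.equiv (Submodule.quotientEquivOfIsCompl _ _ hc)
    exact Module.Finite.of_restrictScalars_finite R _ _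
  · by_contra hmω
    refine hm ((iSupIndep_weightSpace (R := R) (V := V) m).eq_bot_of_le ?_)
    refine le_trans le_top (h ▸ iSup₂_le fun n hn => ?_)
    exact le_iSup₂ (f := fun n (_ : n ≠ m) => weightSpace R V n) n (fun e => hmω (e ▸ hn))

theorem IsWeightModule.iSup_eq_top {ω : Set (MaximalSpectrum R)} (h : IsWeightModule R V ω) :
    ⨆ m ∈ ω, weightSpace R V m = ⊤ := by
  classical
  have h' := DirectSum.IsInternal.submodule_iSup_eq_top h.isInternal
  rw [← top_le_iff, ← h']
  refine iSup_le fun m => ?_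
  by_cases hm : weightSpace R V m = ⊥
  · rw [hm]; exact bot_le
  · exact le_iSup₂ (f := fun n (_ : n ∈ ω) => weightSpace R V n) m (h.support_subset hm)

theorem IsWeightModule.moduleFinite {ω : Set (MaximalSpectrum R)} (hω : ω.Finite)
    (h : IsWeightModule R V ω) : Module.Finite R V := by
  have := hω.to_subtype
  refine ⟨?_⟩
  rw [← h.iSup_eq_top, iSup_subtype']
  refine Submodule.fg_iSup _ fun m => ?_
  have := h.finite m
  have : Module.Finite R (weightSpace R V m) := Module.Finite.trans (R ⧸ m.1.asIdeal) _
  exact Module.Finite.iff_fg.mp this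

theorem IsWeightModule.isSemisimpleModule {ω : Set (MaximalSpectrum R)}
    (h : IsWeightModule R V ω) : IsSemisimpleModule R V := by
  refine isSemisimpleModule_of_isSemisimpleModule_submodule (s := ω) (fun m _ => ?_) h.iSup_eq_top
  let _ : Field (R ⧸ m.asIdeal) := Ideal.Quotient.field m.asIdeal
  have hs : IsSemisimpleModule (R ⧸ m.asIdeal) (weightSpace R V m) := inferInstance
  exact (Module.isTorsionBySet_iff_torsionBySet_eq_top _ |>.mpr
    (Submodule.torsionBySet_torsionBySet_eq_top _)).isSemisimpleModule_iff.mp hs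

end Weight

/-- The orbit of a maximal ideal under the action of `σ`. -/
def maxOrbit {R : Type u} [CommRing R] (σ : R ≃+* R) (m₀ : MaximalSpectrum R) :
    Set (MaximalSpectrum R) :=
  {m | ∃ k : ℤ, m.asIdeal = m₀.asIdeal.map ((σ ^ k : RingAut R) : R →+* R)}

/-- A finite orbit of `σ` on the maximal spectrum of `R`, with a chosen base point. -/
structure FiniteOrbit {R : Type u} [CommRing R] (σ : R ≃+* R) where
  base : MaximalSpectrum R
  finite : (maxOrbit σ base).Finite

namespace FiniteOrbit

variable {R : Type u} [CommRing R] {σ : R ≃+* R}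

/-- The set of maximal ideals in the orbit. -/
def carrier (ω : FiniteOrbit σ) : Set (MaximalSpectrum R) := maxOrbit σ ω.base

theorem carrier_finite (ω : FiniteOrbit σ) : ω.carrier.Finite := ω.finite

/-- The intersection of the maximal ideals in the orbit. -/
def ideal (ω : FiniteOrbit σ) : Ideal R := ⨅ m ∈ ω.carrier, m.asIdeal

theorem exists_comap_zpow (ω : FiniteOrbit σ) {m : MaximalSpectrum R} (hm : m ∈ ω.carrier)
    (j : ℤ) : ∃ n ∈ ω.carrier, n.asIdeal = m.asIdeal.comap ((σ ^ j : RingAut R) : R →+* R) := by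
  obtain ⟨k, hk⟩ := hm
  have hmax : (m.asIdeal.comap ((σ ^ j : RingAut R) : R →+* R)).IsMaximal :=
    have := m.isMaximal
    Ideal.comap_isMaximal_of_surjective _ (σ ^ j : RingAut R).surjective
  refine ⟨⟨_, hmax⟩, ⟨k - j, ?_⟩, rfl⟩
  have key : ∀ (τ : RingAut R) (I : Ideal R), I.map (τ : R →+* R) =
      I.comap ((τ⁻¹ : RingAut R) : R →+* R) := fun τ I => Ideal.map_comap_of_equiv (f := τ)
  change m.asIdeal.comap ((σ ^ j : RingAut R) : R →+* R) = _
  rw [hk, key, key, Ideal.comap_comap]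
  congr 1
  ext r
  change (σ ^ k : RingAut R)⁻¹ ((σ ^ j : RingAut R) r) = (σ ^ (k - j) : RingAut R)⁻¹ r
  rw [← RingAut.mul_apply]
  congr 1
  group

theorem apply_mem_ideal (ω : FiniteOrbit σ) {r : R} (hr : r ∈ ω.ideal) : σ r ∈ ω.ideal := by
  simp only [ideal, Submodule.mem_iInf] at hr ⊢
  intro m hm
  obtain ⟨n, hn, hnm⟩ := ω.exists_comap_zpow hm 1
  have := hr n hn
  rw [hnm, Ideal.mem_comap, zpow_one] at this
  exact this

theorem symm_apply_mem_ideal (ω : FiniteOrbit σ) {r : R} (hr : r ∈ ω.ideal) :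
    σ.symm r ∈ ω.ideal := by
  simp only [ideal, Submodule.mem_iInf] at hr ⊢
  intro m hm
  obtain ⟨n, hn, hnm⟩ := ω.exists_comap_zpow hm (-1)
  have := hr n hn
  rw [hnm, Ideal.mem_comap, zpow_neg_one] at this
  exact this

end FiniteOrbit

/-- The objects of the category `A(t)-wmod_ω`: weight modules over `A(t) = A(R, σ, t)` with finite
dimensional weight spaces and support in the finite orbit `ω`. -/
structure WMod {R : Type u} [CommRing R] {σ : R ≃+* R} (ω : FiniteOrbit σ) (t : R) where
  carrier : Type u
  [addCommGroup : AddCommGroup carrier]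
  [module : Module (GWA σ t) carrier]
  isWeight : @IsWeightModule R _ carrier _ (Module.compHom carrier (GWA.ofR σ t)) ω.carrier

section GWAModules

variable {R : Type u} [CommRing R] {σ : R ≃+* R}

/-- Operators `X`, `Y` on an `R`-module that define an action of `A(R, σ, t)`. -/
structure GWAAction (σ : R ≃+* R) (t : R) (V : Type*) [AddCommGroup V] [Module R V] where
  X : V →ₛₗ[(σ : R →+* R)] V
  Y : V →ₛₗ[(σ.symm : R →+* R)] V
  YX : ∀ v, Y (X v) = t • v
  XY : ∀ v, X (Y v) = σ t • v

namespace GWAAction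

variable {t : R} {V : Type*} [AddCommGroup V] [Module R V] (D : GWAAction σ t V)

/-- The action of `A(R, σ, t)` as a ring homomorphism. -/
def toEnd : GWA σ t →+* AddMonoid.End V :=
  GWA.lift (Module.toAddMonoidEnd R V) D.X.toAddMonoidHom D.Y.toAddMonoidHom
    (fun r => AddMonoidHom.ext fun v => D.X.map_smulₛₗ r v)
    (fun r => AddMonoidHom.ext fun v => D.Y.map_smulₛₗ r v)
    (AddMonoidHom.ext D.YX) (AddMonoidHom.ext D.XY)

/-- The `A(R, σ, t)`-module structure defined by `D`. -/
abbrev module : Module (GWA σ t) V := Module.compHom V D.toEnd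

theorem toEnd_ofR (r : R) (v : V) : D.toEnd (GWA.ofR σ t r) v = r • v := by
  exact DFunLike.congr_fun (GWA.lift_ofR (S := AddMonoid.End V) _ _ _ _ _ _ _ r) v

theorem toEnd_X (v : V) : D.toEnd (GWA.X σ t) v = D.X v := by
  exact DFunLike.congr_fun (GWA.lift_X (S := AddMonoid.End V) _ _ _ _ _ _ _) v

theorem toEnd_Y (v : V) : D.toEnd (GWA.Y σ t) v = D.Y v := by
  exact DFunLike.congr_fun (GWA.lift_Y (S := AddMonoid.End V) _ _ _ _ _ _ _) v

theorem compHom_eq {V : Type*} [AddCommGroup V] [i : Module R V] (D : GWAAction σ t V) :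
    @Module.compHom (GWA σ t) R V _ _ D.module _ (GWA.ofR σ t) = i := by
  refine Module.ext' _ _ fun r v => ?_
  exact D.toEnd_ofR r v

end GWAAction

/-- The object of `A(t)-wmod_ω` defined by a finite `R`-module spanned by its weight spaces for
the weights in `ω`, and by operators `X`, `Y`. -/
def WMod.ofAction (ω : FiniteOrbit σ) {t : R} (V : Type u) [AddCommGroup V] [Module R V]
    (D : GWAAction σ t V) (hfin : Module.Finite R V)
    (hsup : ⨆ m ∈ ω.carrier, weightSpace R V m = ⊤) : WMod ω t :=
  letI := D.module
  { carrier := V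
    isWeight := by
      rw [D.compHom_eq]
      exact IsWeightModule.of_iSup _ hsup }

namespace WMod

variable {ω : FiniteOrbit σ} {t t' : R}

instance (V : WMod ω t) : AddCommGroup V.carrier := V.addCommGroup

instance (V : WMod ω t) : Module (GWA σ t) V.carrier := V.module

instance (V : WMod ω t) : Module R V.carrier := Module.compHom V.carrier (GWA.ofR σ t)

theorem smul_def (V : WMod ω t) (r : R) (v : V.carrier) : r • v = GWA.ofR σ t r • v := rfl

theorem isWeightModule (V : WMod ω t) : IsWeightModule R V.carrier ω.carrier := V.isWeight

/-- The operators `X` and `Y` of an object. -/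
def action (V : WMod ω t) : GWAAction σ t V.carrier where
  X :=
    { toFun := fun v => GWA.X σ t • v
      map_add' := fun v w => smul_add _ v w
      map_smul' := fun r v => by
        simp only [smul_def, ← mul_smul]
        rw [GWA.X_mul_ofR]; rfl }
  Y :=
    { toFun := fun v => GWA.Y σ t • v
      map_add' := fun v w => smul_add _ v w
      map_smul' := fun r v => by
        simp only [smul_def, ← mul_smul]
        rw [GWA.Y_mul_ofR]; rfl }
  YX v := by
    change GWA.Y σ t • GWA.X σ t • v = _
    rw [← mul_smul, GWA.Y_mul_X, smul_def]
  XY v := by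
    change GWA.X σ t • GWA.Y σ t • v = _
    rw [← mul_smul, GWA.X_mul_Y, smul_def]

theorem action_X (V : WMod ω t) (v : V.carrier) : V.action.X v = GWA.X σ t • v := rfl

theorem action_Y (V : WMod ω t) (v : V.carrier) : V.action.Y v = GWA.Y σ t • v := rfl

/-- An additive map that commutes with `R`, `X`, `Y` is `A(t)`-linear. -/
def mkHom {V W : WMod ω t} (f : V.carrier →+ W.carrier) (hR : ∀ (r : R) v, f (r • v) = r • f v)
    (hX : ∀ v, f (V.action.X v) = W.action.X (f v))
    (hY : ∀ v, f (V.action.Y v) = W.action.Y (f v)) : V.carrier →ₗ[GWA σ t] W.carrier :=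
  { f with
    map_smul' := fun a => by
      refine GWA.induction_on (P := fun a => ∀ v, f (a • v) = a • f v) a hR hX hY ?_ ?_
      · intro a b ha hb v
        rw [mul_smul, mul_smul, ha, hb]
      · intro a b ha hb v
        rw [add_smul, add_smul, map_add, ha, hb] }

/-- The operators `X ⊗ X` and `Y ⊗ Y` on the tensor product over `R`. -/
def tensorAction (V : WMod ω t) (W : WMod ω t') :
    GWAAction σ (t * t') (V.carrier ⊗[R] W.carrier) where
  X := TensorProduct.map V.action.X W.action.X
  Y := TensorProduct.map V.action.Y W.action.Y
  YX x := by
    induction x with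
    | zero => simp
    | tmul v w => 
      rw [TensorProduct.map_tmul, TensorProduct.map_tmul, GWAAction.YX, GWAAction.YX,
        TensorProduct.smul_tmul_smul]
    | add x y hx hy => simp only [map_add, smul_add, hx, hy]
  XY x := by
    induction x with
    | zero => simp
    | tmul v w => 
      rw [TensorProduct.map_tmul, TensorProduct.map_tmul, GWAAction.XY, GWAAction.XY,
        TensorProduct.smul_tmul_smul, map_mul]
    | add x y hx hy => simp only [map_add, smul_add, hx, hy]

theorem iSup_weightSpace_tensor (V : WMod ω t) (W : WMod ω t') :
    ⨆ m ∈ ω.carrier, weightSpace R (V.carrier ⊗[R] W.carrier) m = ⊤ := by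
  rw [eq_top_iff, ← TensorProduct.span_tmul_eq_top R V.carrier W.carrier, Submodule.span_le]
  rintro _ ⟨v, w, rfl⟩
  have hv : v ∈ ⨆ m ∈ ω.carrier, weightSpace R V.carrier m := by
    rw [V.isWeightModule.iSup_eq_top]; trivial
  have hw : w ∈ ⨆ m ∈ ω.carrier, weightSpace R W.carrier m := by
    rw [W.isWeightModule.iSup_eq_top]; trivial
  rw [iSup_subtype'] at hv hw
  change v ⊗ₜ[R] w ∈ ⨆ m ∈ ω.carrier, weightSpace R (V.carrier ⊗[R] W.carrier) m
  induction hv using Submodule.iSup_induction' with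
  | zero => simp
  | add x y _ _ hx hy => rw [TensorProduct.add_tmul]; exact add_mem hx hy
  | mem m v hv =>
    induction hw using Submodule.iSup_induction' with
    | zero => simp
    | add x y _ _ hx hy => rw [TensorProduct.tmul_add]; exact add_mem hx hy
    | mem n w hw =>
      refine Submodule.mem_iSup_of_mem m.1 (Submodule.mem_iSup_of_mem m.2 ?_)
      rw [Submodule.mem_torsionBySet_iff] at hv ⊢
      intro a
      rw [TensorProduct.smul_tmul', hv a, TensorProduct.zero_tmul]

/-- The tensor product `V ⊗_R W` of a weight module over `A(t)` and one over `A(t')`, as a module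
over `A(tt')` on which `X` acts by `X ⊗ X` and `Y` by `Y ⊗ Y`. -/
def tensor (V : WMod ω t) (W : WMod ω t') : WMod ω (t * t') :=
  ofAction ω (V.carrier ⊗[R] W.carrier) (tensorAction V W)
    (by
      have := V.isWeightModule.moduleFinite ω.carrier_finite
      have := W.isWeightModule.moduleFinite ω.carrier_finite
      infer_instance)
    (iSup_weightSpace_tensor V W)

/-- The operators on `R ⧸ ⋂ 𝔪`, `𝔪 ∈ ω`, induced by `σ` and `σ⁻¹`. -/
def unitAction (ω : FiniteOrbit σ) : GWAAction σ 1 (R ⧸ ω.ideal) where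
  X := ω.ideal.mapQ ω.ideal (σ : R →+* R).toSemilinearMap (fun r hr => ω.apply_mem_ideal hr)
  Y := ω.ideal.mapQ ω.ideal (σ.symm : R →+* R).toSemilinearMap
    (fun r hr => ω.symm_apply_mem_ideal hr)
  YX v := by
    obtain ⟨r, rfl⟩ := Submodule.Quotient.mk_surjective _ v
    erw [Submodule.mapQ_apply]
    simp
  XY v := by
    obtain ⟨r, rfl⟩ := Submodule.Quotient.mk_surjective _ v
    erw [Submodule.mapQ_apply]
    simp

/-- The object `⨁_{𝔪 ∈ ω} R/𝔪 = R ⧸ ⋂_{𝔪 ∈ ω} 𝔪` of `A(1)-wmod_ω`, with `X` and `Y` acting as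
`σ` and `σ⁻¹`. -/
def unit (ω : FiniteOrbit σ) : WMod ω (1 : R) :=
  ofAction ω (R ⧸ ω.ideal) (unitAction ω) inferInstance (by
    have h := Submodule.iSup_torsionBySet_ideal_eq_torsionBySet_iInf (M := R ⧸ ω.ideal)
      (p := fun m : MaximalSpectrum R => m.asIdeal) (S := ω.carrier_finite.toFinset)
      (fun m _ n _ h => maximalSpectrum_sup_eq_top h)
    simp only [Set.Finite.mem_toFinset] at h
    refine h.trans (eq_top_iff.mpr fun v _ => ?_)
    obtain ⟨r, rfl⟩ := Submodule.Quotient.mk_surjective _ v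
    rw [Submodule.mem_torsionBySet_iff]
    rintro ⟨a, ha⟩
    rw [← Submodule.Quotient.mk_smul, Submodule.Quotient.mk_eq_zero]
    exact Ideal.mul_mem_right _ _ ha)

end WMod

end GWAModules

/-! ### Grothendieck groups and the Grothendieck ring -/

section Grothendieck

variable {R : Type u} [CommRing R] {σ : R ≃+* R}

/-- The relations `[B] = [A] + [C]` of the Grothendieck group, one for every short exact sequence
`0 → A → B → C → 0` in `A(t)-wmod_ω`. -/
def sesRelations (ω : FiniteOrbit σ) (t : R) : Set (FreeAbelianGroup (WMod ω t)) :=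
  {x | ∃ (A B C : WMod ω t) (f : A.carrier →ₗ[GWA σ t] B.carrier)
    (g : B.carrier →ₗ[GWA σ t] C.carrier),
    Function.Injective f ∧ Function.Exact f g ∧ Function.Surjective g ∧
      x = FreeAbelianGroup.of B - (FreeAbelianGroup.of A + FreeAbelianGroup.of C)}

/-- The Grothendieck group `K₀(A(t)-wmod_ω)`. -/
def K0 (ω : FiniteOrbit σ) (t : R) : Type (u + 1) :=
  FreeAbelianGroup (WMod ω t) ⧸ AddSubgroup.closure (sesRelations ω t)

namespace K0

variable {ω : FiniteOrbit σ} {t t' : R}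

instance : AddCommGroup (K0 ω t) :=
  inferInstanceAs (AddCommGroup (FreeAbelianGroup (WMod ω t) ⧸
    AddSubgroup.closure (sesRelations ω t)))

/-- The class of an object. -/
def mk (V : WMod ω t) : K0 ω t := QuotientAddGroup.mk (FreeAbelianGroup.of V)

theorem mk_eq_add {A B C : WMod ω t} (f : A.carrier →ₗ[GWA σ t] B.carrier)
    (g : B.carrier →ₗ[GWA σ t] C.carrier) (hf : Function.Injective f) (hfg : Function.Exact f g)
    (hg : Function.Surjective g) : mk B = mk A + mk C := by
  rw [← sub_eq_zero]
  exact (QuotientAddGroup.eq_zero_iff _).mpr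
    (AddSubgroup.subset_closure ⟨A, B, C, f, g, hf, hfg, hg, rfl⟩)

/-- The universal property of the Grothendieck group. -/
def lift {G : Type*} [AddCommGroup G] (φ : WMod ω t → G)
    (h : ∀ (A B C : WMod ω t) (f : A.carrier →ₗ[GWA σ t] B.carrier)
      (g : B.carrier →ₗ[GWA σ t] C.carrier), Function.Injective f → Function.Exact f g →
      Function.Surjective g → φ B = φ A + φ C) : K0 ω t →+ G :=
  QuotientAddGroup.lift _ (FreeAbelianGroup.lift φ) (by
    rw [AddSubgroup.closure_le]
    rintro _ ⟨A, B, C, f, g, hf, hfg, hg, rfl⟩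
    simp [h A B C f g hf hfg hg])

theorem lift_mk {G : Type*} [AddCommGroup G] (φ : WMod ω t → G)
    (h : ∀ (A B C : WMod ω t) (f : A.carrier →ₗ[GWA σ t] B.carrier)
      (g : B.carrier →ₗ[GWA σ t] C.carrier), Function.Injective f → Function.Exact f g →
      Function.Surjective g → φ B = φ A + φ C) (V : WMod ω t) : lift φ h (mk V) = φ V :=
  FreeAbelianGroup.lift_apply_of _ _

theorem hom_ext {G : Type*} [AddCommGroup G] {f g : K0 ω t →+ G}
    (h : ∀ V, f (mk V) = g (mk V)) : f = g :=
  QuotientAddGroup.addMonoidHom_ext _ (FreeAbelianGroup.lift_ext _ _ h)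

/-- The zero object. -/
def zeroObj (ω : FiniteOrbit σ) (t : R) : WMod ω t :=
  WMod.ofAction ω PUnit.{u + 1} ⟨0, 0, fun _ => rfl, fun _ => rfl⟩ inferInstance
    (Subsingleton.elim _ _)

instance : Subsingleton (zeroObj ω t).carrier := inferInstanceAs (Subsingleton PUnit)

theorem mk_zeroObj : mk (zeroObj ω t) = 0 := by
  have h := mk_eq_add (A := zeroObj ω t) (B := zeroObj ω t) (C := zeroObj ω t) 0 0
    (fun _ _ _ => Subsingleton.elim _ _) (fun x => by simp [Subsingleton.elim x 0])
    (fun x => ⟨0, Subsingleton.elim _ _⟩)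
  exact left_eq_add.mp h

theorem mk_eq_of_equiv {V W : WMod ω t} (e : V.carrier ≃+ W.carrier)
    (hR : ∀ (r : R) v, e (r • v) = r • e v)
    (hX : ∀ v, e (V.action.X v) = W.action.X (e v))
    (hY : ∀ v, e (V.action.Y v) = W.action.Y (e v)) : mk V = mk W := by
  have h := mk_eq_add (A := V) (B := W) (C := zeroObj ω t)
    (WMod.mkHom e.toAddMonoidHom hR hX hY) 0 e.injective
    (fun x => ⟨fun _ => ⟨e.symm x, e.apply_symm_apply x⟩, fun _ => rfl⟩)
    (fun x => ⟨0, Subsingleton.elim _ _⟩)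
  rw [h, mk_zeroObj, add_zero]

end K0

namespace WMod

variable {ω : FiniteOrbit σ} {t t' : R}

/-- Morphisms are `R`-linear. -/
def homR {V W : WMod ω t} (f : V.carrier →ₗ[GWA σ t] W.carrier) : V.carrier →ₗ[R] W.carrier where
  toFun := f
  map_add' := map_add f
  map_smul' r v := map_smul f (GWA.ofR σ t r) v

theorem tensor_smul (V : WMod ω t) (W : WMod ω t') (r : R) (x : V.carrier ⊗[R] W.carrier) :
    ((r • (show (tensor V W).carrier from x) : (tensor V W).carrier)) = r • x :=
  GWAAction.toEnd_ofR _ r x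

theorem tensor_X (V : WMod ω t) (W : WMod ω t') (x : V.carrier ⊗[R] W.carrier) :
    (tensor V W).action.X x = TensorProduct.map V.action.X W.action.X x :=
  GWAAction.toEnd_X _ x

theorem tensor_Y (V : WMod ω t) (W : WMod ω t') (x : V.carrier ⊗[R] W.carrier) :
    (tensor V W).action.Y x = TensorProduct.map V.action.Y W.action.Y x :=
  GWAAction.toEnd_Y _ x

theorem map_map_X {V V' : WMod ω t} {W W' : WMod ω t'} (f : V.carrier →ₗ[GWA σ t] V'.carrier)
    (g : W.carrier →ₗ[GWA σ t'] W'.carrier) (x : V.carrier ⊗[R] W.carrier) :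
    TensorProduct.map (homR f) (homR g) (TensorProduct.map V.action.X W.action.X x) =
      TensorProduct.map V'.action.X W'.action.X (TensorProduct.map (homR f) (homR g) x) := by
  induction x with
  | zero => simp only [map_zero]
  | add x y hx hy => simp only [map_add, hx, hy]
  | tmul v w =>
    exact congrArg₂ (TensorProduct.tmul R) (map_smul f (GWA.X σ t) v) (map_smul g (GWA.X σ t') w)

theorem map_map_Y {V V' : WMod ω t} {W W' : WMod ω t'} (f : V.carrier →ₗ[GWA σ t] V'.carrier)
    (g : W.carrier →ₗ[GWA σ t'] W'.carrier) (x : V.carrier ⊗[R] W.carrier) :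
    TensorProduct.map (homR f) (homR g) (TensorProduct.map V.action.Y W.action.Y x) =
      TensorProduct.map V'.action.Y W'.action.Y (TensorProduct.map (homR f) (homR g) x) := by
  induction x with
  | zero => simp only [map_zero]
  | add x y hx hy => simp only [map_add, hx, hy]
  | tmul v w =>
    exact congrArg₂ (TensorProduct.tmul R) (map_smul f (GWA.Y σ t) v) (map_smul g (GWA.Y σ t') w)

/-- The tensor product of two morphisms. -/
def tensorHom {V V' : WMod ω t} {W W' : WMod ω t'} (f : V.carrier →ₗ[GWA σ t] V'.carrier)
    (g : W.carrier →ₗ[GWA σ t'] W'.carrier) :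
    (tensor V W).carrier →ₗ[GWA σ (t * t')] (tensor V' W').carrier :=
  mkHom (V := tensor V W) (W := tensor V' W')
    (TensorProduct.map (homR f) (homR g)).toAddMonoidHom
    (fun r (x : V.carrier ⊗[R] W.carrier) =>
      (congrArg (TensorProduct.map (homR f) (homR g)) (tensor_smul V W r x)).trans
        ((map_smul (TensorProduct.map (homR f) (homR g)) r x).trans
          (tensor_smul V' W' r (TensorProduct.map (homR f) (homR g) x)).symm))
    (fun x => (congrArg (TensorProduct.map (homR f) (homR g)) (tensor_X V W x)).trans
      ((map_map_X f g x).trans (tensor_X V' W' _).symm))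
    (fun x => (congrArg (TensorProduct.map (homR f) (homR g)) (tensor_Y V W x)).trans
      ((map_map_Y f g x).trans (tensor_Y V' W' _).symm))

/-- The identity map, as an `R`-linear map. -/
def tensorEquiv (V : WMod ω t) (W : WMod ω t') :
    (tensor V W).carrier ≃ₗ[R] V.carrier ⊗[R] W.carrier :=
  { AddEquiv.refl (V.carrier ⊗[R] W.carrier) with map_smul' := tensor_smul V W }

/-- The associativity isomorphism. -/
def assocEquiv {t'' : R} (V : WMod ω t) (W : WMod ω t') (U : WMod ω t'') :
    (tensor V W).carrier ⊗[R] U.carrier ≃ₗ[R] V.carrier ⊗[R] (tensor W U).carrier :=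
  (TensorProduct.congr (tensorEquiv V W) (LinearEquiv.refl R U.carrier)).trans
    ((TensorProduct.assoc R V.carrier W.carrier U.carrier).trans
      (TensorProduct.congr (LinearEquiv.refl R V.carrier) (tensorEquiv W U).symm))

section assoc

variable {t'' : R} (V : WMod ω t) (W : WMod ω t') (U : WMod ω t'')

theorem assoc_induction {P : (tensor V W).carrier ⊗[R] U.carrier → Prop} (h0 : P 0)
    (hadd : ∀ x y, P x → P y → P (x + y))
    (h : ∀ v w u, P (((tensorEquiv V W).symm (v ⊗ₜ[R] w)) ⊗ₜ[R] u)) (x) : P x := by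
  induction x with
  | zero => exact h0
  | add x y hx hy => exact hadd x y hx hy
  | tmul a u =>
    obtain ⟨b, rfl⟩ := (tensorEquiv V W).symm.surjective a
    induction b with
    | zero => rw [map_zero, TensorProduct.zero_tmul]; exact h0
    | add x y hx hy => rw [map_add, TensorProduct.add_tmul]; exact hadd _ _ hx hy
    | tmul v w => exact h v w u

theorem assocEquiv_smul (r : R) (x : ((tensor V W).tensor U).carrier) :
    (assocEquiv V W U).toAddEquiv (r • x) =
      (r • (show (V.tensor (W.tensor U)).carrier from (assocEquiv V W U).toAddEquiv x) :
        (V.tensor (W.tensor U)).carrier) :=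
  (congrArg (assocEquiv V W U) (tensor_smul (V.tensor W) U r x)).trans
    ((LinearEquiv.map_smul (assocEquiv V W U) r x).trans
      (tensor_smul V (W.tensor U) r (assocEquiv V W U x)).symm)

theorem assocEquiv_X (x : ((tensor V W).tensor U).carrier) :
    (assocEquiv V W U).toAddEquiv (((tensor V W).tensor U).action.X x) =
      (V.tensor (W.tensor U)).action.X ((assocEquiv V W U).toAddEquiv x) := by
  refine (congrArg (assocEquiv V W U) (tensor_X (V.tensor W) U x)).trans
    (Eq.trans ?_ (tensor_X V (W.tensor U) (assocEquiv V W U x)).symm)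
  refine assoc_induction V W U (P := fun x => assocEquiv V W U (TensorProduct.map
    (V.tensor W).action.X U.action.X x) = TensorProduct.map V.action.X (W.tensor U).action.X
      (assocEquiv V W U x)) ?_ ?_ ?_ x
  · simp only [map_zero]
  · intro x y hx hy
    simp only [map_add, hx, hy]
  · intro v w u
    have h1 := tensor_X V W (v ⊗ₜ[R] w)
    have h2 := tensor_X W U (w ⊗ₜ[R] u)
    rw [TensorProduct.map_tmul] at h1 h2 ⊢
    exact (congrArg (fun a => assocEquiv V W U (a ⊗ₜ[R] U.action.X u)) h1).trans
      (congrArg (fun a => V.action.X v ⊗ₜ[R] a) h2).symm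

theorem assocEquiv_Y (x : ((tensor V W).tensor U).carrier) :
    (assocEquiv V W U).toAddEquiv (((tensor V W).tensor U).action.Y x) =
      (V.tensor (W.tensor U)).action.Y ((assocEquiv V W U).toAddEquiv x) := by
  refine (congrArg (assocEquiv V W U) (tensor_Y (V.tensor W) U x)).trans
    (Eq.trans ?_ (tensor_Y V (W.tensor U) (assocEquiv V W U x)).symm)
  refine assoc_induction V W U (P := fun x => assocEquiv V W U (TensorProduct.map
    (V.tensor W).action.Y U.action.Y x) = TensorProduct.map V.action.Y (W.tensor U).action.Y
      (assocEquiv V W U x)) ?_ ?_ ?_ x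
  · simp only [map_zero]
  · intro x y hx hy
    simp only [map_add, hx, hy]
  · intro v w u
    have h1 := tensor_Y V W (v ⊗ₜ[R] w)
    have h2 := tensor_Y W U (w ⊗ₜ[R] u)
    rw [TensorProduct.map_tmul] at h1 h2 ⊢
    exact (congrArg (fun a => assocEquiv V W U (a ⊗ₜ[R] U.action.Y u)) h1).trans
      (congrArg (fun a => V.action.Y v ⊗ₜ[R] a) h2).symm

end assoc

section unit

variable (V : WMod ω t)

theorem smul_eq_zero_of_mem_ideal {r : R} (hr : r ∈ ω.ideal) (v : V.carrier) : r • v = 0 := by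
  have hv : v ∈ ⨆ m ∈ ω.carrier, weightSpace R V.carrier m := by
    rw [V.isWeightModule.iSup_eq_top]; trivial
  rw [iSup_subtype'] at hv
  induction hv using Submodule.iSup_induction' with
  | zero => simp
  | add x y _ _ hx hy => rw [smul_add, hx, hy, add_zero]
  | mem m v hv =>
    rw [Submodule.mem_torsionBySet_iff] at hv
    simp only [FiniteOrbit.ideal, Submodule.mem_iInf] at hr
    exact hv ⟨r, hr m.1 m.2⟩

/-- The identity map, as an `R`-linear map. -/
def unitCarrierEquiv (ω : FiniteOrbit σ) : (unit ω).carrier ≃ₗ[R] R ⧸ ω.ideal :=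
  { AddEquiv.refl (R ⧸ ω.ideal) with map_smul' := fun r x => (unitAction ω).toEnd_ofR r x }

/-- The scalar multiplication of `R ⧸ ⋂ 𝔪` on a weight module. -/
def quotientSMul : (R ⧸ ω.ideal) →ₗ[R] V.carrier →ₗ[R] V.carrier :=
  Submodule.liftQ ω.ideal (LinearMap.lsmul R V.carrier)
    (fun _ hr => LinearMap.ext fun v => V.smul_eq_zero_of_mem_ideal hr v)

theorem quotientSMul_mk (r : R) (v : V.carrier) :
    V.quotientSMul (Submodule.Quotient.mk r) v = r • v := rfl

/-- The isomorphism `(R ⧸ ⋂ 𝔪) ⊗ V ≃ V`. -/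
def unitEquiv : (unit ω).carrier ⊗[R] V.carrier ≃ₗ[R] V.carrier :=
  LinearEquiv.ofLinearMap
    (TensorProduct.lift (V.quotientSMul.comp (unitCarrierEquiv ω).toLinearMap))
    (TensorProduct.mk R _ _ ((unitCarrierEquiv ω).symm (Submodule.Quotient.mk 1)))
    (LinearMap.ext fun v => by
      change V.quotientSMul (Submodule.Quotient.mk 1) v = v
      rw [quotientSMul_mk, one_smul])
    (TensorProduct.ext' fun a v => by
      obtain ⟨b, rfl⟩ := (unitCarrierEquiv ω).symm.surjective a
      obtain ⟨r, rfl⟩ := Submodule.Quotient.mk_surjective _ b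
      change ((unitCarrierEquiv ω).symm (Submodule.Quotient.mk 1)) ⊗ₜ[R] (r • v) =
        ((unitCarrierEquiv ω).symm (Submodule.Quotient.mk r)) ⊗ₜ[R] v
      rw [← TensorProduct.smul_tmul, ← map_smul, ← Submodule.Quotient.mk_smul, smul_eq_mul,
        mul_one])

theorem unitEquiv_tmul (r : R) (v : V.carrier) :
    V.unitEquiv (((unitCarrierEquiv ω).symm (Submodule.Quotient.mk r)) ⊗ₜ[R] v) = r • v := rfl

theorem unitEquiv_smul (r : R) (x : ((unit ω).tensor V).carrier) :
    V.unitEquiv.toAddEquiv (r • x) = r • V.unitEquiv.toAddEquiv x :=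
  (congrArg V.unitEquiv (tensor_smul (unit ω) V r x)).trans
    (LinearEquiv.map_smul V.unitEquiv r x)

theorem unit_X (r : R) :
    (unit ω).action.X ((unitCarrierEquiv ω).symm (Submodule.Quotient.mk r)) =
      (unitCarrierEquiv ω).symm (Submodule.Quotient.mk (σ r)) :=
  (unitAction ω).toEnd_X (Submodule.Quotient.mk r)

theorem unit_Y (r : R) :
    (unit ω).action.Y ((unitCarrierEquiv ω).symm (Submodule.Quotient.mk r)) =
      (unitCarrierEquiv ω).symm (Submodule.Quotient.mk (σ.symm r)) :=
  (unitAction ω).toEnd_Y (Submodule.Quotient.mk r)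

theorem unitEquiv_X (x : ((unit ω).tensor V).carrier) :
    V.unitEquiv.toAddEquiv (((unit ω).tensor V).action.X x) =
      V.action.X (V.unitEquiv.toAddEquiv x) := by
  refine (congrArg V.unitEquiv (tensor_X (unit ω) V x)).trans ?_
  change (unit ω).carrier ⊗[R] V.carrier at x
  change V.unitEquiv (TensorProduct.map (unit ω).action.X V.action.X x) =
    V.action.X (V.unitEquiv x)
  induction x with
  | zero => simp only [map_zero]
  | add x y hx hy => simp only [map_add, hx, hy]
  | tmul a v =>
    obtain ⟨b, rfl⟩ := (unitCarrierEquiv ω).symm.surjective a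
    obtain ⟨r, rfl⟩ := Submodule.Quotient.mk_surjective _ b
    rw [TensorProduct.map_tmul, unit_X, unitEquiv_tmul, unitEquiv_tmul, map_smulₛₗ]
    rfl

theorem unitEquiv_Y (x : ((unit ω).tensor V).carrier) :
    V.unitEquiv.toAddEquiv (((unit ω).tensor V).action.Y x) =
      V.action.Y (V.unitEquiv.toAddEquiv x) := by
  refine (congrArg V.unitEquiv (tensor_Y (unit ω) V x)).trans ?_
  change (unit ω).carrier ⊗[R] V.carrier at x
  change V.unitEquiv (TensorProduct.map (unit ω).action.Y V.action.Y x) =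
    V.action.Y (V.unitEquiv x)
  induction x with
  | zero => simp only [map_zero]
  | add x y hx hy => simp only [map_add, hx, hy]
  | tmul a v =>
    obtain ⟨b, rfl⟩ := (unitCarrierEquiv ω).symm.surjective a
    obtain ⟨r, rfl⟩ := Submodule.Quotient.mk_surjective _ b
    rw [TensorProduct.map_tmul, unit_Y, unitEquiv_tmul, unitEquiv_tmul, map_smulₛₗ]
    rfl

end unit

end WMod

namespace K0

variable {ω : FiniteOrbit σ} {t t' : R}

theorem mk_tensor_left {A B C : WMod ω t} (W : WMod ω t') (f : A.carrier →ₗ[GWA σ t] B.carrier)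
    (g : B.carrier →ₗ[GWA σ t] C.carrier) (hf : Function.Injective f) (hfg : Function.Exact f g)
    (hg : Function.Surjective g) :
    mk (B.tensor W) = mk (A.tensor W) + mk (C.tensor W) := by
  refine mk_eq_add (WMod.tensorHom f LinearMap.id) (WMod.tensorHom g LinearMap.id) ?_ ?_ ?_
  · have := B.isWeightModule.isSemisimpleModule
    obtain ⟨h, hh⟩ := IsSemisimpleModule.extension_property (WMod.homR f) hf LinearMap.id
    have h1 : (h.rTensor W.carrier) ∘ₗ ((WMod.homR f).rTensor W.carrier) = LinearMap.id := by
      rw [← LinearMap.rTensor_comp, hh, LinearMap.rTensor_id]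
    exact Function.LeftInverse.injective (g := h.rTensor W.carrier) (fun x =>
      LinearMap.congr_fun h1 x)
  · exact rTensor_exact W.carrier (f := WMod.homR f) (g := WMod.homR g) hfg hg
  · exact LinearMap.rTensor_surjective W.carrier (g := WMod.homR g) hg

theorem mk_tensor_right (V : WMod ω t) {A B C : WMod ω t'}
    (f : A.carrier →ₗ[GWA σ t'] B.carrier)
    (g : B.carrier →ₗ[GWA σ t'] C.carrier) (hf : Function.Injective f) (hfg : Function.Exact f g)
    (hg : Function.Surjective g) :
    mk (V.tensor B) = mk (V.tensor A) + mk (V.tensor C) := by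
  refine mk_eq_add (WMod.tensorHom LinearMap.id f) (WMod.tensorHom LinearMap.id g) ?_ ?_ ?_
  · have := B.isWeightModule.isSemisimpleModule
    obtain ⟨h, hh⟩ := IsSemisimpleModule.extension_property (WMod.homR f) hf LinearMap.id
    have h1 : (h.lTensor V.carrier) ∘ₗ ((WMod.homR f).lTensor V.carrier) = LinearMap.id := by
      rw [← LinearMap.lTensor_comp, hh, LinearMap.lTensor_id]
    exact Function.LeftInverse.injective (g := h.lTensor V.carrier) (fun x =>
      LinearMap.congr_fun h1 x)
  · exact lTensor_exact V.carrier (f := WMod.homR f) (g := WMod.homR g) hfg hg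
  · exact LinearMap.lTensor_surjective V.carrier (g := WMod.homR g) hg

/-- The biadditive map `[V], [W] ↦ [V ⊗_R W]`. -/
def tensorHom (ω : FiniteOrbit σ) (t t' : R) : K0 ω t →+ K0 ω t' →+ K0 ω (t * t') :=
  lift (fun V => lift (fun W => mk (V.tensor W))
      fun _ _ _ f g hf hfg hg => mk_tensor_right V f g hf hfg hg)
    fun A B C f g hf hfg hg => hom_ext fun W => by
      simp only [AddMonoidHom.add_apply, lift_mk]
      exact mk_tensor_left W f g hf hfg hg

theorem tensorHom_mk (V : WMod ω t) (W : WMod ω t') :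
    tensorHom ω t t' (mk V) (mk W) = mk (V.tensor W) := by
  simp only [tensorHom, lift_mk]

end K0

/-- The Grothendieck ring `𝒜(ω, M) = ⨁_{t ∈ M} ℂ ⊗ K₀(A(t)-wmod_ω)` of the tower of generalized
Weyl algebras `A(t)`, `t ∈ M`. -/
def GrothendieckRing (ω : FiniteOrbit σ) (M : Submonoid R) : Type (u + 1) :=
  ⨁ t : M, ℂ ⊗[ℤ] K0 ω (t : R)

namespace GrothendieckRing

variable {ω : FiniteOrbit σ} {M : Submonoid R}

instance : AddCommGroup (GrothendieckRing ω M) :=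
  inferInstanceAs (AddCommGroup (⨁ t : M, ℂ ⊗[ℤ] K0 ω (t : R)))

instance : Module ℂ (GrothendieckRing ω M) :=
  inferInstanceAs (Module ℂ (⨁ t : M, ℂ ⊗[ℤ] K0 ω (t : R)))

open Classical in
/-- The inclusion of the component of degree `t`. -/
def incl (ω : FiniteOrbit σ) {M : Submonoid R} {t : R} (ht : t ∈ M) :
    ℂ ⊗[ℤ] K0 ω t →ₗ[ℂ] GrothendieckRing ω M :=
  DirectSum.lof ℂ M (fun t : M => ℂ ⊗[ℤ] K0 ω (t : R)) ⟨t, ht⟩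

/-- The class `[V]` of a weight module `V` over `A(t)`. -/
def cls {t : R} (ht : t ∈ M) (V : WMod ω t) : GrothendieckRing ω M := incl ω ht (1 ⊗ₜ K0.mk V)

theorem hom_ext {N : Type*} [AddCommGroup N] [Module ℂ N] {f g : GrothendieckRing ω M →ₗ[ℂ] N}
    (h : ∀ (t : R) (ht : t ∈ M) (V : WMod ω t), f (cls ht V) = g (cls ht V)) : f = g := by
  classical
  refine DirectSum.linearMap_ext ℂ fun ⟨t, ht⟩ => ?_
  refine TensorProduct.AlgebraTensorModule.curry_injective (LinearMap.ext_ring ?_)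
  have := K0.hom_ext (ω := ω) (t := t)
    (f := ((f ∘ₗ incl ω ht).toAddMonoidHom.comp
      (TensorProduct.mk ℤ ℂ (K0 ω t) 1).toAddMonoidHom))
    (g := ((g ∘ₗ incl ω ht).toAddMonoidHom.comp
      (TensorProduct.mk ℤ ℂ (K0 ω t) 1).toAddMonoidHom)) (h t ht)
  ext x
  exact DFunLike.congr_fun this x

open Classical in
/-- A linear map defined by its restrictions to the components. -/
def lift {N : Type*} [AddCommGroup N] [Module ℂ N]
    (f : ∀ t : R, t ∈ M → (ℂ ⊗[ℤ] K0 ω t →ₗ[ℂ] N)) : GrothendieckRing ω M →ₗ[ℂ] N :=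
  DirectSum.toModule ℂ M N fun t => f t.1 t.2

theorem lift_incl {N : Type*} [AddCommGroup N] [Module ℂ N]
    (f : ∀ t : R, t ∈ M → (ℂ ⊗[ℤ] K0 ω t →ₗ[ℂ] N)) {t : R} (ht : t ∈ M) (x : ℂ ⊗[ℤ] K0 ω t) :
    lift f (incl ω ht x) = f t ht x := by
  classical
  exact DirectSum.toModule_lof ℂ (M := fun t : M => ℂ ⊗[ℤ] K0 ω (t : R)) (⟨t, ht⟩ : M) x

/-- The multiplication `ℂ ⊗ K₀(A(t)-wmod_ω) × ℂ ⊗ K₀(A(t')-wmod_ω) → ℂ ⊗ K₀(A(tt')-wmod_ω)`. -/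
def mulComponent (ω : FiniteOrbit σ) (t t' : R) :
    ℂ ⊗[ℤ] K0 ω t →ₗ[ℂ] ℂ ⊗[ℤ] K0 ω t' →ₗ[ℂ] ℂ ⊗[ℤ] K0 ω (t * t') :=
  LinearMap.liftBaseChange ℂ
    { toFun := fun a => (K0.tensorHom ω t t' a).toIntLinearMap.baseChange ℂ
      map_add' := fun a b => by
        rw [map_add, ← LinearMap.baseChange_add]; rfl
      map_smul' := fun n a => by
        rw [map_zsmul, RingHom.id_apply, ← LinearMap.baseChange_smul]; rfl }

theorem mulComponent_tmul (t t' : R) (a : K0 ω t) (b : K0 ω t') :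
    mulComponent ω t t' (1 ⊗ₜ a) (1 ⊗ₜ b) = 1 ⊗ₜ K0.tensorHom ω t t' a b := by
  simp [mulComponent]

/-- The bilinear multiplication of the Grothendieck ring. -/
def mulHom (ω : FiniteOrbit σ) (M : Submonoid R) :
    GrothendieckRing ω M →ₗ[ℂ] GrothendieckRing ω M →ₗ[ℂ] GrothendieckRing ω M :=
  lift fun t ht => (lift fun t' ht' =>
    ((mulComponent ω t t').compr₂ (incl ω (mul_mem ht ht'))).flip).flip

theorem mulHom_cls {t t' : R} (ht : t ∈ M) (ht' : t' ∈ M) (V : WMod ω t) (W : WMod ω t') :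
    mulHom ω M (cls ht V) (cls ht' W) = cls (mul_mem ht ht') (V.tensor W) := by
  unfold mulHom cls
  rw [lift_incl, LinearMap.flip_apply, lift_incl, LinearMap.flip_apply, LinearMap.compr₂_apply,
    mulComponent_tmul, K0.tensorHom_mk]

theorem cls_congr {t s : R} (ht : t ∈ M) (hs : s ∈ M) (h : t = s) {V : WMod ω t} {W : WMod ω s}
    (e : V.carrier ≃+ W.carrier) (hR : ∀ (r : R) v, e (r • v) = r • e v)
    (hX : ∀ v, e (V.action.X v) = W.action.X (e v))
    (hY : ∀ v, e (V.action.Y v) = W.action.Y (e v)) : cls ht V = cls hs W := by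
  subst h
  rw [cls, cls, K0.mk_eq_of_equiv e hR hX hY]

theorem mulHom_comm (a b : GrothendieckRing ω M) : mulHom ω M a b = mulHom ω M b a := by
  suffices h : mulHom ω M = (mulHom ω M).flip from congrArg (fun f => f a b) h
  refine hom_ext fun t ht V => hom_ext fun t' ht' W => ?_
  rw [LinearMap.flip_apply, mulHom_cls, mulHom_cls]
  have hmap : ∀ x : V.carrier ⊗[R] W.carrier,
      TensorProduct.comm R _ _ (TensorProduct.map V.action.X W.action.X x) =
        TensorProduct.map W.action.X V.action.X (TensorProduct.comm R _ _ x) ∧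
      TensorProduct.comm R _ _ (TensorProduct.map V.action.Y W.action.Y x) =
        TensorProduct.map W.action.Y V.action.Y (TensorProduct.comm R _ _ x) := fun x => by
    induction x with
    | zero => simp only [map_zero, and_self]
    | add x y hx hy => simp only [map_add, hx, hy, and_self]
    | tmul v w => exact ⟨rfl, rfl⟩
  exact cls_congr _ _ (mul_comm t t') (V := V.tensor W) (W := W.tensor V)
    (TensorProduct.comm R V.carrier W.carrier).toAddEquiv
    (fun r (x : V.carrier ⊗[R] W.carrier) =>
      (congrArg (TensorProduct.comm R V.carrier W.carrier) (WMod.tensor_smul V W r x)).trans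
        ((map_smul (TensorProduct.comm R V.carrier W.carrier) r x).trans
          (WMod.tensor_smul W V r (TensorProduct.comm R V.carrier W.carrier x)).symm))
    (fun x => (congrArg (TensorProduct.comm R _ _) (WMod.tensor_X V W x)).trans
      ((hmap x).1.trans (WMod.tensor_X W V _).symm))
    (fun x => (congrArg (TensorProduct.comm R _ _) (WMod.tensor_Y V W x)).trans
      ((hmap x).2.trans (WMod.tensor_Y W V _).symm))

/-- The identity element `[⨁_{𝔪 ∈ ω} R/𝔪]`, in degree `1`. -/
def one (ω : FiniteOrbit σ) (M : Submonoid R) : GrothendieckRing ω M := cls (one_mem M) (WMod.unit ω)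

theorem mulHom_assoc (a b c : GrothendieckRing ω M) :
    mulHom ω M (mulHom ω M a b) c = mulHom ω M a (mulHom ω M b c) := by
  suffices h : (mulHom ω M).compr₂ (mulHom ω M) =
      ((LinearMap.llcomp ℂ _ _ _).flip.comp (mulHom ω M)).flip.comp (mulHom ω M) from
    congrArg (fun f => f a b c) h
  refine hom_ext fun t ht V => hom_ext fun t' ht' W => hom_ext fun t'' ht'' U => ?_
  change mulHom ω M (mulHom ω M (cls ht V) (cls ht' W)) (cls ht'' U) =
    mulHom ω M (cls ht V) (mulHom ω M (cls ht' W) (cls ht'' U))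
  rw [mulHom_cls, mulHom_cls, mulHom_cls, mulHom_cls]
  exact cls_congr _ _ (mul_assoc t t' t'') (WMod.assocEquiv V W U).toAddEquiv
    (WMod.assocEquiv_smul V W U) (WMod.assocEquiv_X V W U) (WMod.assocEquiv_Y V W U)

theorem one_mulHom (a : GrothendieckRing ω M) : mulHom ω M (one ω M) a = a := by
  suffices h : mulHom ω M (one ω M) = LinearMap.id from congrArg (fun f => f a) h
  refine hom_ext fun t ht V => ?_
  rw [one, mulHom_cls, LinearMap.id_apply]
  exact cls_congr _ _ (one_mul t) (WMod.unitEquiv V).toAddEquiv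
    (WMod.unitEquiv_smul V) (WMod.unitEquiv_X V) (WMod.unitEquiv_Y V)

instance : CommRing (GrothendieckRing ω M) :=
  { (inferInstance : AddCommGroup (GrothendieckRing ω M)) with
    mul := fun a b => mulHom ω M a b
    one := one ω M
    left_distrib := fun a b c => map_add (mulHom ω M a) b c
    right_distrib := fun a b c => LinearMap.map_add₂ (mulHom ω M) a b c
    zero_mul := fun a => LinearMap.map_zero₂ (mulHom ω M) a
    mul_zero := fun a => map_zero (mulHom ω M a)
    mul_assoc := mulHom_assoc
    one_mul := one_mulHom
    mul_one := fun a => (mulHom_comm a _).trans (one_mulHom a)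
    mul_comm := mulHom_comm }

theorem mul_def (a b : GrothendieckRing ω M) : a * b = mulHom ω M a b := rfl

instance : Algebra ℂ (GrothendieckRing ω M) :=
  Algebra.ofModule (fun c a b => LinearMap.map_smul₂ (mulHom ω M) c a b)
    (fun c a b => map_smul (mulHom ω M a) c b)

end GrothendieckRing

end Grothendieck

/-! ### The tower over `ℂ[z, z⁻¹]` with `σ(z) = q⁻¹ z` -/

section Laurent

open LaurentPolynomial

/-- `z` as a unit of `ℂ[z, z⁻¹]`. -/
def zUnit : (LaurentPolynomial ℂ)ˣ :=
  ⟨T 1, T (-1), by rw [← T_add]; simp, by rw [← T_add]; simp⟩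

theorem val_zUnit_zpow (n : ℤ) : ((zUnit ^ n : (LaurentPolynomial ℂ)ˣ) : LaurentPolynomial ℂ) =
    T n := by
  induction n using Int.induction_on with
  | zero => simp
  | succ n ih => rw [zpow_add_one, Units.val_mul, ih, T_add]; rfl
  | pred n ih => rw [zpow_sub_one, Units.val_mul, ih, T_sub]; rfl

theorem laurent_hom_ext {S : Type*} [Semiring S] {f g : LaurentPolynomial ℂ →+* S}
    (hC : ∀ a, f (C a) = g (C a)) (hT : ∀ n, f (T n) = g (T n)) (x : LaurentPolynomial ℂ) :
    f x = g x := by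
  induction x using LaurentPolynomial.induction_on' with
  | add x y hx hy => rw [map_add, map_add, hx, hy]
  | C_mul_T n a => rw [map_mul, map_mul, hC, hT]

/-- Evaluation `f ↦ f(c)` at a nonzero complex number `c`. -/
def evalAt (c : ℂˣ) : LaurentPolynomial ℂ →+* ℂ := LaurentPolynomial.eval₂ (RingHom.id ℂ) c

theorem evalAt_C (c : ℂˣ) (a : ℂ) : evalAt c (C a) = a := by
  unfold evalAt; rw [eval₂_C]; rfl

theorem evalAt_T (c : ℂˣ) (n : ℤ) : evalAt c (T n) = ((c ^ n : ℂˣ) : ℂ) := by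
  unfold evalAt; rw [eval₂_T]

/-- The substitution `z ↦ c z`. -/
def scaleHom (c : ℂˣ) : LaurentPolynomial ℂ →+* LaurentPolynomial ℂ :=
  LaurentPolynomial.eval₂ C (Units.map (C : ℂ →+* LaurentPolynomial ℂ).toMonoidHom c * zUnit)

theorem scaleHom_C (c : ℂˣ) (a : ℂ) : scaleHom c (C a) = C a := by
  unfold scaleHom; rw [eval₂_C]

theorem scaleHom_T (c : ℂˣ) (n : ℤ) : scaleHom c (T n) = C ((c ^ n : ℂˣ) : ℂ) * T n := by
  unfold scaleHom
  rw [eval₂_T, mul_zpow, Units.val_mul, val_zUnit_zpow, ← map_zpow]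
  rfl

theorem scaleHom_scaleHom (c d : ℂˣ) (f : LaurentPolynomial ℂ) :
    scaleHom c (scaleHom d f) = scaleHom (c * d) f := by
  refine laurent_hom_ext (f := (scaleHom c).comp (scaleHom d)) (fun a => ?_) (fun n => ?_) f
  · simp only [RingHom.comp_apply, scaleHom_C]
  · simp only [RingHom.comp_apply, scaleHom_T, map_mul, scaleHom_C, mul_zpow, Units.val_mul]
    ring

theorem scaleHom_one (f : LaurentPolynomial ℂ) : scaleHom 1 f = f := by
  refine laurent_hom_ext (f := scaleHom 1) (g := RingHom.id _) (fun a => ?_) (fun n => ?_) f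
  · simp only [scaleHom_C, RingHom.id_apply]
  · simp [scaleHom_T]

theorem evalAt_scaleHom (c d : ℂˣ) (f : LaurentPolynomial ℂ) :
    evalAt c (scaleHom d f) = evalAt (d * c) f := by
  refine laurent_hom_ext (f := (evalAt c).comp (scaleHom d)) (fun a => ?_) (fun n => ?_) f
  · simp only [RingHom.comp_apply, scaleHom_C, evalAt_C]
  · simp only [RingHom.comp_apply, scaleHom_T, map_mul, evalAt_C, evalAt_T, mul_zpow,
      Units.val_mul]

/-- The automorphism `σ` of `ℂ[z, z⁻¹]` with `σ(z) = q⁻¹ z`. -/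
def qShift (q : ℂˣ) : LaurentPolynomial ℂ ≃+* LaurentPolynomial ℂ :=
  RingEquiv.ofRingHom (scaleHom q⁻¹) (scaleHom q)
    (RingHom.ext fun f => by
      simp only [RingHom.comp_apply, scaleHom_scaleHom, RingHom.id_apply, inv_mul_cancel,
        scaleHom_one])
    (RingHom.ext fun f => by
      simp only [RingHom.comp_apply, scaleHom_scaleHom, RingHom.id_apply, mul_inv_cancel,
        scaleHom_one])

theorem qShift_apply (q : ℂˣ) (f : LaurentPolynomial ℂ) : qShift q f = scaleHom q⁻¹ f := rfl

theorem qShift_symm_apply (q : ℂˣ) (f : LaurentPolynomial ℂ) :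
    (qShift q).symm f = scaleHom q f := rfl

theorem qShift_zpow_apply (q : ℂˣ) (k : ℤ) (f : LaurentPolynomial ℂ) :
    (qShift q ^ k : RingAut (LaurentPolynomial ℂ)) f = scaleHom (q ^ (-k)) f := by
  induction k using Int.induction_on generalizing f with
  | zero => simp [scaleHom_one]
  | succ n ih =>
    rw [zpow_add_one, RingAut.mul_apply, ih, qShift_apply, scaleHom_scaleHom]
    congr 2
    group
  | pred n ih =>
    rw [zpow_sub_one, RingAut.mul_apply, ih]
    change scaleHom _ ((qShift q).symm f) = _
    rw [qShift_symm_apply, scaleHom_scaleHom]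
    congr 2
    group

/-- The element `z - c`. -/
def linearFactor (c : ℂˣ) : LaurentPolynomial ℂ := T 1 - C (c : ℂ)

theorem evalAt_linearFactor (c d : ℂˣ) : evalAt c (linearFactor d) = (c : ℂ) - d := by
  simp [linearFactor, evalAt_C, evalAt_T]

theorem ker_evalAt (c : ℂˣ) : RingHom.ker (evalAt c) = Ideal.span {linearFactor c} := by
  refine le_antisymm (fun f hf => ?_) ?_
  · set I := Ideal.span {linearFactor c}
    have hu : Units.map (Ideal.Quotient.mk I).toMonoidHom zUnit =
        Units.map ((Ideal.Quotient.mk I).comp C).toMonoidHom c := by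
      refine Units.ext ?_
      change Ideal.Quotient.mk I (T 1) = Ideal.Quotient.mk I (C (c : ℂ))
      rw [Ideal.Quotient.eq]
      exact Ideal.subset_span rfl
    have h : ∀ f, Ideal.Quotient.mk I f = Ideal.Quotient.mk I (C (evalAt c f)) := by
      refine laurent_hom_ext (g := ((Ideal.Quotient.mk I).comp C).comp (evalAt c)) ?_ ?_
      · intro a
        simp [evalAt_C]
      · intro n
        have := congrArg (fun u : (LaurentPolynomial ℂ ⧸ I)ˣ =>
          ((u ^ n : (LaurentPolynomial ℂ ⧸ I)ˣ) : LaurentPolynomial ℂ ⧸ I)) hu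
        simp only [← map_zpow] at this
        rw [RingHom.comp_apply, evalAt_T, ← val_zUnit_zpow]
        exact this
    have h2 := h f
    rw [RingHom.mem_ker] at hf
    rw [hf, map_zero, map_zero, Ideal.Quotient.eq_zero_iff_mem] at h2
    exact h2
  · rw [Ideal.span_le, Set.singleton_subset_iff]
    change evalAt c (linearFactor c) = 0
    rw [evalAt_linearFactor, sub_self]

/-- The maximal ideal `(z - c)`. -/
def pointIdeal (c : ℂˣ) : MaximalSpectrum (LaurentPolynomial ℂ) where
  asIdeal := Ideal.span {linearFactor c}
  isMaximal := by
    rw [← ker_evalAt]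
    exact RingHom.ker_isMaximal_of_surjective _ fun a => ⟨C a, evalAt_C c a⟩

theorem map_pointIdeal (q : ℂˣ) (k : ℤ) (c : ℂˣ) : (pointIdeal c).asIdeal.map
    ((qShift q ^ k : RingAut (LaurentPolynomial ℂ)) : LaurentPolynomial ℂ →+* _) =
      (pointIdeal (q ^ k * c)).asIdeal := by
  have key : ∀ (τ : RingAut (LaurentPolynomial ℂ)) (I : Ideal (LaurentPolynomial ℂ)),
      I.map (τ : LaurentPolynomial ℂ →+* LaurentPolynomial ℂ) =
        I.comap ((τ⁻¹ : RingAut (LaurentPolynomial ℂ)) : LaurentPolynomial ℂ →+* _) :=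
    fun τ I => Ideal.map_comap_of_equiv (f := τ)
  change (Ideal.span {linearFactor c}).map _ = Ideal.span {linearFactor (q ^ k * c)}
  rw [← ker_evalAt, ← ker_evalAt, key]
  ext f
  rw [Ideal.mem_comap, RingHom.mem_ker, RingHom.mem_ker]
  change evalAt c ((qShift q ^ k : RingAut (LaurentPolynomial ℂ))⁻¹ f) = 0 ↔ _
  rw [← zpow_neg, qShift_zpow_apply, evalAt_scaleHom, neg_neg]

variable {p : ℕ} [NeZero p] {q : ℂˣ}

/-- The orbit `ω = {(z - q^k)}` of `𝔪₀ = (z - 1)`. -/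
def unitOrbit (hq : IsPrimitiveRoot q p) : FiniteOrbit (qShift q) where
  base := pointIdeal 1
  finite := by
    refine (Set.finite_range fun k : Fin p => pointIdeal (q ^ (k : ℕ))).subset ?_
    rintro m ⟨k, hk⟩
    have hp : (0 : ℤ) < p := by exact_mod_cast NeZero.pos p
    refine ⟨⟨(k % p).toNat, by
      have := Int.emod_lt_of_pos k hp
      have := Int.emod_nonneg k hp.ne'
      omega⟩, MaximalSpectrum.ext ?_⟩
    have h : q ^ (k % p).toNat = q ^ k := by
      rw [← zpow_natCast, Int.toNat_of_nonneg (Int.emod_nonneg k hp.ne')]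
      conv_rhs => rw [← Int.emod_add_mul_ediv k p, zpow_add, zpow_mul, zpow_natCast,
        hq.pow_eq_one, one_zpow, mul_one]
    rw [hk, map_pointIdeal, mul_one]
    exact congrArg (fun c => (pointIdeal c).asIdeal) h

/-- The power `q^k` for a residue class `k` modulo `p`. -/
def qpow (q : ℂˣ) (k : ZMod p) : ℂˣ := q ^ k.val

theorem qpow_add_one (hq : IsPrimitiveRoot q p) (k : ZMod p) : qpow q (k + 1) = q * qpow q k := by
  unfold qpow
  rw [← pow_succ']
  refine (pow_inj_mod.mpr ?_)
  rw [← hq.eq_orderOf]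
  have h := (ZMod.natCast_eq_natCast_iff' (k + 1).val (k.val + 1) p).mp (by simp)
  exact h

theorem qpow_injective (hq : IsPrimitiveRoot q p) :
    Function.Injective (fun k : ZMod p => qpow q k) := fun k l h =>
  ZMod.val_injective p (hq.pow_inj (ZMod.val_lt k) (ZMod.val_lt l) h)

theorem pointIdeal_mem (hq : IsPrimitiveRoot q p) (k : ZMod p) :
    pointIdeal (qpow q k) ∈ (unitOrbit hq).carrier := by
  refine ⟨(k.val : ℤ), ?_⟩
  change _ = (pointIdeal 1).asIdeal.map _
  rw [map_pointIdeal, mul_one, zpow_natCast]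
  rfl

/-- The monoid `M` generated by the elements `z - q^k`. -/
def breakMonoid (p : ℕ) [NeZero p] (q : ℂˣ) : Submonoid (LaurentPolynomial ℂ) :=
  Submonoid.closure (Set.range fun k : ZMod p => linearFactor (qpow q k))

theorem linearFactor_mem (k : ZMod p) : linearFactor (qpow q k) ∈ breakMonoid p q :=
  Submonoid.subset_closure ⟨k, rfl⟩

/-- The `ℂ[z, z⁻¹]`-module `⨁_i (R/𝔪_{κ(i)}) e_i` with `𝔪_k = (z - q^k)`: the vector with
coordinates `v i` is `∑ v i e_i`, and `f e_i = f(q^{κ(i)}) e_i`. -/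
def DiagModule (_q : ℂˣ) {ι : Type} (_κ : ι → ZMod p) : Type := ι → ℂ

namespace DiagModule

variable {ι : Type} (κ : ι → ZMod p)

instance : AddCommGroup (DiagModule q κ) := inferInstanceAs (AddCommGroup (ι → ℂ))

instance : Module (LaurentPolynomial ℂ) (DiagModule q κ) where
  smul f v := fun i => evalAt (qpow q (κ i)) f * v i
  one_smul v := funext fun i => by
    change evalAt _ 1 * v i = v i
    rw [map_one, one_mul]
  mul_smul f g v := funext fun i => by
    change evalAt _ (f * g) * v i = evalAt _ f * (evalAt _ g * v i)
    rw [map_mul, mul_assoc]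
  smul_zero f := funext fun i => mul_zero _
  smul_add f v w := funext fun i => mul_add _ _ _
  add_smul f g v := funext fun i => by
    change evalAt _ (f + g) * v i = evalAt _ f * v i + evalAt _ g * v i
    rw [map_add, add_mul]
  zero_smul v := funext fun i => by
    change evalAt _ 0 * v i = 0
    rw [map_zero, zero_mul]

variable {κ}

theorem smul_apply (f : LaurentPolynomial ℂ) (v : DiagModule q κ) (i : ι) :
    (f • v) i = evalAt (qpow q (κ i)) f * v i := rfl

theorem add_apply (v w : DiagModule q κ) (i : ι) : (v + w) i = v i + w i := rfl

variable [Fintype ι] [DecidableEq ι]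

/-- The basis vector `e_i`. -/
def e (i : ι) : DiagModule q κ := Pi.single (M := fun _ => ℂ) i 1

theorem eq_sum (v : DiagModule q κ) :
    v = ∑ i, (C (v i) : LaurentPolynomial ℂ) • (e i : DiagModule q κ) := by
  refine funext fun j => ?_
  have h : (∑ i, (C (v i) : LaurentPolynomial ℂ) • (e i : DiagModule q κ)) j =
      ∑ i, ((C (v i) : LaurentPolynomial ℂ) • (e i : DiagModule q κ)) j :=
    Finset.sum_apply (M := fun _ : ι => ℂ) j _ _
  rw [h, Finset.sum_eq_single j]
  · rw [smul_apply, evalAt_C, e, Pi.single_eq_same, mul_one]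
  · intro i _ hi
    rw [smul_apply, e, Pi.single_eq_of_ne hi.symm, mul_zero]
  · exact fun hj => absurd (Finset.mem_univ j) hj

theorem span_e : Submodule.span (LaurentPolynomial ℂ) (Set.range (e : ι → DiagModule q κ)) = ⊤ :=
  eq_top_iff.mpr fun v _ => by
    rw [eq_sum v]
    exact Submodule.sum_mem _ fun i _ => Submodule.smul_mem _ _ (Submodule.subset_span ⟨i, rfl⟩)

theorem finite : Module.Finite (LaurentPolynomial ℂ) (DiagModule q κ) :=
  ⟨⟨(Set.finite_range (e : ι → DiagModule q κ)).toFinset, by simpa using span_e⟩⟩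

theorem iSup_weightSpace (hq : IsPrimitiveRoot q p) : ⨆ m ∈ (unitOrbit hq).carrier,
    weightSpace (LaurentPolynomial ℂ) (DiagModule q κ) m = ⊤ := by
  rw [eq_top_iff, ← span_e, Submodule.span_le]
  rintro _ ⟨i, rfl⟩
  refine Submodule.mem_iSup_of_mem (pointIdeal (qpow q (κ i)))
    (Submodule.mem_iSup_of_mem (pointIdeal_mem hq _) ?_)
  rw [Submodule.mem_torsionBySet_iff]
  rintro ⟨f, hf⟩
  change f ∈ Ideal.span _ at hf
  rw [← ker_evalAt, RingHom.mem_ker] at hf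
  refine funext fun j => ?_
  rw [smul_apply]
  by_cases h : j = i
  · subst h; rw [hf, zero_mul]; rfl
  · rw [e, Pi.single_eq_of_ne h, mul_zero]; rfl

end DiagModule

/-- The letters `1`, `x`, `y`, `0`. -/
inductive Letter
  | one
  | x
  | y
  | zero
  deriving DecidableEq

namespace Letter

/-- The coefficient of `X e_k` for the letter `w_k`, where `s` is the scalar by which `t` acts on
`e_k`. -/
def xCoeff (s : ℂ) : Letter → ℂ
  | one => s
  | x => 1
  | y => 0
  | zero => 0

/-- The coefficient of `Y e_{k+1}` for the letter `w_k`. -/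
def yCoeff : Letter → ℂ
  | one => 1
  | x => 0
  | y => 1
  | zero => 0

theorem yCoeff_mul_xCoeff {s : ℂ} {w : Letter} (h : w = one ↔ s ≠ 0) :
    w.yCoeff * w.xCoeff s = s := by
  cases w <;> simp [yCoeff, xCoeff] at h ⊢ <;> exact h.symm

end Letter

/-- The factor `ξ` (the `1 × 1` matrix `F`) at the step from `e_p` to `e_1`. -/
def wrap (ξ : ℂˣ) (k : ZMod p) : ℂˣ := if k = 0 then ξ else 1

theorem evalAt_qpow_succ (hq : IsPrimitiveRoot q p) {k l : ZMod p} (h : l = k + 1)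
    (f : LaurentPolynomial ℂ) : evalAt (qpow q l) (qShift q f) = evalAt (qpow q k) f := by
  rw [h, qShift_apply, evalAt_scaleHom, qpow_add_one hq, inv_mul_cancel_left]

theorem evalAt_qpow_pred (hq : IsPrimitiveRoot q p) {k l : ZMod p} (h : l = k + 1)
    (f : LaurentPolynomial ℂ) : evalAt (qpow q k) ((qShift q).symm f) = evalAt (qpow q l) f := by
  rw [h, qShift_symm_apply, evalAt_scaleHom, qpow_add_one hq]

/-- The action on the module `V^t(ω, w, x - ξ)`, with basis `e_k`, `k ∈ ℤ/p`. -/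
def circleAction (hq : IsPrimitiveRoot q p) (t : LaurentPolynomial ℂ) (w : ZMod p → Letter)
    (hw : ∀ k, w k = .one ↔ evalAt (qpow q k) t ≠ 0) (ξ : ℂˣ) :
    GWAAction (qShift q) t (DiagModule q (fun k : ZMod p => k)) where
  X :=
    { toFun := fun v k =>
        (w (k - 1)).xCoeff (evalAt (qpow q (k - 1)) t) * (wrap ξ (k - 1) : ℂˣ) * v (k - 1)
      map_add' := fun v v' => funext fun k => mul_add _ _ _
      map_smul' := fun f v => funext fun k => by
        have h : evalAt (qpow q k) (qShift q f) = evalAt (qpow q (k - 1)) f :=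
          evalAt_qpow_succ hq (sub_add_cancel k 1).symm f
        change _ * _ * (evalAt _ f * v (k - 1)) = evalAt (qpow q k) (qShift q f) * (_ * _ * _)
        rw [h]
        ring }
  Y :=
    { toFun := fun v k => (w k).yCoeff * ((wrap ξ k)⁻¹ : ℂˣ) * v (k + 1)
      map_add' := fun v v' => funext fun k => mul_add _ _ _
      map_smul' := fun f v => funext fun k => by
        have h : evalAt (qpow q k) ((qShift q).symm f) = evalAt (qpow q (k + 1)) f :=
          evalAt_qpow_pred hq rfl f
        change _ * _ * (evalAt _ f * v (k + 1)) =
          evalAt (qpow q k) ((qShift q).symm f) * (_ * _ * _)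
        rw [h]
        ring }
  YX v := funext fun k => by
    change (w k).yCoeff * ((wrap ξ k)⁻¹ : ℂˣ) * ((w (k + 1 - 1)).xCoeff
      (evalAt (qpow q (k + 1 - 1)) t) * (wrap ξ (k + 1 - 1) : ℂˣ) * v (k + 1 - 1)) =
        evalAt (qpow q k) t * v k
    rw [add_sub_cancel_right]
    conv_rhs => rw [← Letter.yCoeff_mul_xCoeff (hw k)]
    have := (wrap ξ k).inv_mul
    linear_combination ((w k).yCoeff * (w k).xCoeff (evalAt (qpow q k) t) * v k) * this
  XY v := funext fun k => by
    have h : evalAt (qpow q k) (qShift q t) = evalAt (qpow q (k - 1)) t :=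
      evalAt_qpow_succ hq (sub_add_cancel k 1).symm t
    change (w (k - 1)).xCoeff (evalAt (qpow q (k - 1)) t) * (wrap ξ (k - 1) : ℂˣ) *
      ((w (k - 1)).yCoeff * ((wrap ξ (k - 1))⁻¹ : ℂˣ) * v (k - 1 + 1)) =
        evalAt (qpow q k) (qShift q t) * v k
    rw [sub_add_cancel, h]
    conv_rhs => rw [← Letter.yCoeff_mul_xCoeff (hw (k - 1))]
    have := (wrap ξ (k - 1)).inv_mul
    linear_combination
      ((w (k - 1)).yCoeff * (w (k - 1)).xCoeff (evalAt (qpow q (k - 1)) t) * v k) * this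

/-- The weight module `V^t(ω, w, x - ξ)` of the word `w = w_1 ⋯ w_p`, positions being taken
modulo `p`. It has a basis `e_1, …, e_p` of vectors of weights `(z - q), …, (z - q^p)`, with
`X e_k = t(q^k) e_{k+1}`, `e_{k+1}`, `0`, `0` and `Y e_{k+1} = e_k`, `0`, `e_k`, `0` for
`w_k = 1`, `x`, `y`, `0` if `1 ≤ k < p`; for `k = p` the vector `e_{k+1}` is replaced by
`ξ e_1`. The letter `1` stands at the positions `k` where `(z - q^k)` is not a break, i.e.
`t ∉ (z - q^k)`. -/
def circleModule (hq : IsPrimitiveRoot q p) (t : LaurentPolynomial ℂ) (w : ZMod p → Letter)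
    (hw : ∀ k, w k = .one ↔ evalAt (qpow q k) t ≠ 0) (ξ : ℂˣ) : WMod (unitOrbit hq) t :=
  WMod.ofAction (unitOrbit hq) (DiagModule q (fun k : ZMod p => k)) (circleAction hq t w hw ξ)
    DiagModule.finite (DiagModule.iSup_weightSpace hq)

/-- The weights of the basis `e_{i+1}, …, e_{i+ℓ+1}`. -/
def intervalWeight (i : ZMod p) (ℓ : ℕ) (m : Fin (ℓ + 1)) : ZMod p := i + 1 + (m : ℕ)

theorem intervalWeight_succ (i : ZMod p) {ℓ : ℕ} (m : Fin ℓ) :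
    intervalWeight i ℓ m.succ = intervalWeight i ℓ m.castSucc + 1 := by
  simp [intervalWeight, add_assoc]

/-- The action on the module `V^t(ω, i, 1^ℓ)`: the coordinates of a vector `v` are those at
`e_{i+1}, …, e_{i+ℓ+1}`, indexed from `0` to `ℓ`. -/
def intervalAction (hq : IsPrimitiveRoot q p) (t : LaurentPolynomial ℂ) (i : ZMod p) (ℓ : ℕ)
    (hi : evalAt (qpow q i) t = 0) (hj : evalAt (qpow q (i + 1 + (ℓ : ZMod p))) t = 0) :
    GWAAction (qShift q) t (DiagModule q (intervalWeight i ℓ)) where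
  X :=
    { toFun := fun v => Fin.cons (α := fun _ => ℂ) 0 fun m : Fin ℓ =>
        evalAt (qpow q (intervalWeight i ℓ m.castSucc)) t * v m.castSucc
      map_add' := fun v v' => funext fun m => by
        refine Fin.cases ?_ (fun m => ?_) m
        · exact (add_zero (0 : ℂ)).symm
        · exact mul_add _ _ _
      map_smul' := fun f v => funext fun m => by
        refine Fin.cases ?_ (fun m => ?_) m
        · exact (mul_zero _).symm
        · change _ * (evalAt _ f * v m.castSucc) = evalAt _ (qShift q f) * (_ * _)
          rw [evalAt_qpow_succ hq (intervalWeight_succ i m)]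
          ring }
  Y :=
    { toFun := fun v => Fin.snoc (α := fun _ => ℂ) (fun m : Fin ℓ => v m.succ) 0
      map_add' := fun v v' => funext fun m => by
        change Fin.snoc (α := fun _ => ℂ) (fun m : Fin ℓ => v m.succ + v' m.succ) 0 m =
          Fin.snoc (α := fun _ => ℂ) (fun m : Fin ℓ => v m.succ) 0 m +
            Fin.snoc (α := fun _ => ℂ) (fun m : Fin ℓ => v' m.succ) 0 m
        refine Fin.lastCases ?_ (fun m => ?_) m
        · simp only [Fin.snoc_last, add_zero]
        · simp only [Fin.snoc_castSucc]
      map_smul' := fun f v => funext fun m => by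
        change Fin.snoc (α := fun _ => ℂ)
            (fun m : Fin ℓ => evalAt (qpow q (intervalWeight i ℓ m.succ)) f * v m.succ) 0 m =
          evalAt (qpow q (intervalWeight i ℓ m)) ((qShift q).symm f) *
            Fin.snoc (α := fun _ => ℂ) (fun m : Fin ℓ => v m.succ) 0 m
        refine Fin.lastCases ?_ (fun m => ?_) m
        · simp only [Fin.snoc_last, mul_zero]
        · simp only [Fin.snoc_castSucc]
          rw [evalAt_qpow_pred hq (intervalWeight_succ i m)] }
  YX v := funext fun m => by
    change Fin.snoc (α := fun _ => ℂ) (fun m : Fin ℓ =>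
        evalAt (qpow q (intervalWeight i ℓ m.castSucc)) t * v m.castSucc) 0 m =
      evalAt (qpow q (intervalWeight i ℓ m)) t * v m
    refine Fin.lastCases ?_ (fun m => ?_) m
    · have h : evalAt (qpow q (intervalWeight i ℓ (Fin.last ℓ))) t = 0 := hj
      rw [h, zero_mul, Fin.snoc_last]
    · rw [Fin.snoc_castSucc]
  XY v := funext fun m => by
    refine Fin.cases ?_ (fun m => ?_) m
    · change (0 : ℂ) = evalAt _ (qShift q t) * _
      rw [evalAt_qpow_succ hq (k := i) (by simp [intervalWeight]), hi, zero_mul]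
    · change evalAt _ t * Fin.snoc (α := fun _ => ℂ) (fun m : Fin ℓ => v m.succ) (0 : ℂ)
        m.castSucc = evalAt _ (qShift q t) * v m.succ
      rw [Fin.snoc_castSucc, evalAt_qpow_succ hq (intervalWeight_succ i m)]

/-- The weight module `V^t(ω, i, 1^ℓ)`, where `(z - q^i)` and `(z - q^{i+ℓ+1})` are breaks and the
`(z - q^k)` with `i < k < i+ℓ+1` are not. It has a basis `e_{i+1}, …, e_{i+ℓ+1}` of vectors of
weights `(z - q^{i+1}), …, (z - q^{i+ℓ+1})`, with `X e_k = t(q^k) e_{k+1}` and `Y e_{k+1} = e_k`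
for `i < k ≤ i+ℓ`, and `X e_{i+ℓ+1} = 0`, `Y e_{i+1} = 0`. -/
def intervalModule (hq : IsPrimitiveRoot q p) (t : LaurentPolynomial ℂ) (i : ZMod p) (ℓ : ℕ)
    (hi : evalAt (qpow q i) t = 0) (hj : evalAt (qpow q (i + 1 + (ℓ : ZMod p))) t = 0)
    (_hk : ∀ m < ℓ, evalAt (qpow q (i + 1 + (m : ZMod p))) t ≠ 0) : WMod (unitOrbit hq) t :=
  WMod.ofAction (unitOrbit hq) (DiagModule q (intervalWeight i ℓ)) (intervalAction hq t i ℓ hi hj)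
    DiagModule.finite (DiagModule.iSup_weightSpace hq)

theorem evalAt_linearFactor_eq_zero (hq : IsPrimitiveRoot q p) {k i : ZMod p} :
    evalAt (qpow q k) (linearFactor (qpow q i)) = 0 ↔ k = i := by
  rw [evalAt_linearFactor, sub_eq_zero, Units.val_inj]
  exact (qpow_injective hq).eq_iff

theorem singleBreak_word (hq : IsPrimitiveRoot q p) (i : ZMod p) {a : Letter} (ha : a ≠ .one)
    (k : ZMod p) : (if k = i then a else Letter.one) = .one ↔
      evalAt (qpow q k) (linearFactor (qpow q i)) ≠ 0 := by
  rw [ne_eq, evalAt_linearFactor_eq_zero hq]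
  by_cases h : k = i <;> simp [h, ha]

theorem add_natCast_succ_ne {i : ZMod p} {m n : ℕ} (hm : m < n) (hn : n < p) :
    i + 1 + (m : ZMod p) ≠ i + 1 + (n : ZMod p) := fun h => by
  have h' := (ZMod.natCast_eq_natCast_iff' m n p).mp (add_left_cancel h)
  rw [Nat.mod_eq_of_lt (hm.trans hn), Nat.mod_eq_of_lt hn] at h'
  omega

theorem add_one_add_pred (i : ZMod p) : i + 1 + ((p - 1 : ℕ) : ZMod p) = i := by
  have h : ((p - 1 : ℕ) : ZMod p) + 1 = 0 := by
    have : ((p - 1 + 1 : ℕ) : ZMod p) = 0 := by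
      rw [Nat.sub_add_cancel (NeZero.pos p), ZMod.natCast_self]
    exact_mod_cast this
  linear_combination h

theorem add_one_add_dist {i j : ZMod p} (h : i ≠ j) :
    i + 1 + (((j - i).val - 1 : ℕ) : ZMod p) = j := by
  have hpos : 0 < (j - i).val :=
    Nat.pos_of_ne_zero fun h0 => h (sub_eq_zero.mp ((ZMod.val_eq_zero _).mp h0)).symm
  have h1 : ((((j - i).val - 1 : ℕ) + 1 : ℕ) : ZMod p) = j - i := by
    rw [Nat.sub_add_cancel hpos, ZMod.natCast_zmod_val]
  push_cast at h1
  linear_combination h1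

/-- `u_ξ = [V^1(ω, 1^p, x - ξ)]`. -/
def clsU (hq : IsPrimitiveRoot q p) (ξ : ℂˣ) :
    GrothendieckRing (unitOrbit hq) (breakMonoid p q) :=
  GrothendieckRing.cls (one_mem _) (circleModule hq 1 (fun _ => .one) (fun k => by simp) ξ)

/-- `x_i = [V^{z - q^i}(ω, i, 1^{p-1})]`. -/
def clsX (hq : IsPrimitiveRoot q p) (i : ZMod p) :
    GrothendieckRing (unitOrbit hq) (breakMonoid p q) :=
  GrothendieckRing.cls (linearFactor_mem i)
    (intervalModule hq (linearFactor (qpow q i)) i (p - 1)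
      ((evalAt_linearFactor_eq_zero hq).mpr rfl)
      ((evalAt_linearFactor_eq_zero hq).mpr (add_one_add_pred i))
      (fun m hm h => by
        have h1 := (evalAt_linearFactor_eq_zero hq).mp h
        have h2 := add_natCast_succ_ne (i := i) hm (Nat.sub_lt (NeZero.pos p) one_pos)
        exact h2 (h1.trans (add_one_add_pred i).symm)))

/-- `x_{ij} = [V^{(z - q^i)(z - q^j)}(ω, i, 1^{d - 1})]`, where `0 < d < p` and `d ≡ j - i`
modulo `p`. -/
def clsXX (hq : IsPrimitiveRoot q p) (i j : ZMod p) (hij : i ≠ j) :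
    GrothendieckRing (unitOrbit hq) (breakMonoid p q) :=
  GrothendieckRing.cls (mul_mem (linearFactor_mem i) (linearFactor_mem j))
    (intervalModule hq (linearFactor (qpow q i) * linearFactor (qpow q j)) i ((j - i).val - 1)
      (by rw [map_mul, (evalAt_linearFactor_eq_zero hq).mpr rfl, zero_mul])
      (by rw [map_mul, (evalAt_linearFactor_eq_zero hq).mpr (add_one_add_dist hij), mul_zero])
      (fun m hm => by
        have hlt := ZMod.val_lt (j - i)
        rw [map_mul]
        refine mul_ne_zero (fun h => ?_) (fun h => ?_)
        · have h1 := (evalAt_linearFactor_eq_zero hq).mp h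
          have h2 := add_natCast_succ_ne (i := i) (m := m) (n := p - 1) (by omega) (by omega)
          exact h2 (h1.trans (add_one_add_pred i).symm)
        · have h1 := (evalAt_linearFactor_eq_zero hq).mp h
          have h2 := add_natCast_succ_ne (i := i) hm (by omega)
          exact h2 (h1.trans (add_one_add_dist hij).symm)))

/-- `y_i = [V^{z - q^i}(ω, 1^{i-1} x 1^{p-i}, x - 1)]`: the letter `x` stands at the position
`i` modulo `p`. -/
def clsY (hq : IsPrimitiveRoot q p) (i : ZMod p) :
    GrothendieckRing (unitOrbit hq) (breakMonoid p q) :=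
  GrothendieckRing.cls (linearFactor_mem i)
    (circleModule hq (linearFactor (qpow q i)) (fun k => if k = i then .x else .one)
      (singleBreak_word hq i (by decide)) 1)

/-- `y_i^* = [V^{z - q^i}(ω, 1^{i-1} y 1^{p-i}, x - 1)]`. -/
def clsYStar (hq : IsPrimitiveRoot q p) (i : ZMod p) :
    GrothendieckRing (unitOrbit hq) (breakMonoid p q) :=
  GrothendieckRing.cls (linearFactor_mem i)
    (circleModule hq (linearFactor (qpow q i)) (fun k => if k = i then .y else .one)
      (singleBreak_word hq i (by decide)) 1)

end Laurent

/-! ### The presented algebra and the normal forms -/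

/-- The generators `u_ξ`, `x_i`, `y_i`, `y_i^*`, `x_{ij}`. -/
inductive Gen (p : ℕ) : Type
  | u (ξ : ℂˣ)
  | x (i : ZMod p)
  | y (i : ZMod p)
  | yStar (i : ZMod p)
  | xx (i j : ZMod p) (h : i ≠ j)

section Presentation

variable {p : ℕ}

/-- The number `0 ≤ d < p` of steps from `a` to `b` in the cyclic order `0 < 1 < ⋯ < p-1 < 0`. -/
def cycDist (a b : ZMod p) : ℕ := (b - a).val

/-- `a < b < c` in the cyclic order. -/
def CycLtLt (a b c : ZMod p) : Prop := 0 < cycDist a b ∧ cycDist a b < cycDist a c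

/-- `a < b ≤ c` in the cyclic order. -/
def CycLtLe (a b c : ZMod p) : Prop := 0 < cycDist a b ∧ cycDist a b ≤ cycDist a c

/-- `a ≤ b < c` in the cyclic order. -/
def CycLeLt (a b c : ZMod p) : Prop := cycDist a b < cycDist a c

/-- `a ≤ b ≤ c` in the cyclic order. -/
def CycLeLe (a b c : ZMod p) : Prop := cycDist a b ≤ cycDist a c

/-- The variable `u_ξ`. -/
abbrev gU (ξ : ℂˣ) : MvPolynomial (Gen p) ℂ := MvPolynomial.X (.u ξ)

/-- The variable `x_i`. -/
abbrev gX (i : ZMod p) : MvPolynomial (Gen p) ℂ := MvPolynomial.X (.x i)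

/-- The variable `y_i`. -/
abbrev gY (i : ZMod p) : MvPolynomial (Gen p) ℂ := MvPolynomial.X (.y i)

/-- The variable `y_i^*`. -/
abbrev gYStar (i : ZMod p) : MvPolynomial (Gen p) ℂ :=
  MvPolynomial.X (.yStar i)

/-- The variable `x_{ij}`. -/
abbrev gXX (i j : ZMod p) (h : i ≠ j) : MvPolynomial (Gen p) ℂ :=
  MvPolynomial.X (.xx i j h)

/-- The defining relations. A chain of inequalities in the cyclic order means that all its
consecutive subchains of length three hold. -/
inductive GrothendieckRel : MvPolynomial (Gen p) ℂ → MvPolynomial (Gen p) ℂ → Prop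
  | u_one : GrothendieckRel (gU 1) 1
  | u_mul (ξ ξ' : ℂˣ) : GrothendieckRel (gU ξ * gU ξ') (gU (ξ * ξ'))
  | u_x (ξ : ℂˣ) (i : ZMod p) : GrothendieckRel (gU ξ * gX i) (gX i)
  | u_xx (ξ : ℂˣ) (i j : ZMod p) (h : i ≠ j) : GrothendieckRel (gU ξ * gXX i j h) (gXX i j h)
  | y_yStar (i j : ZMod p) (h : i ≠ j) :
      GrothendieckRel (gY i * gYStar j) (gXX i j h + gXX j i h.symm)
  | x_x (i j : ZMod p) (h : i ≠ j) : GrothendieckRel (gX i * gX j) (gXX i j h + gXX j i h.symm)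
  | x_y (i j : ZMod p) (h : i ≠ j) : GrothendieckRel (gX i * gY j) (gXX i j h + gXX j i h.symm)
  | x_yStar (i j : ZMod p) (h : i ≠ j) :
      GrothendieckRel (gX i * gYStar j) (gXX i j h + gXX j i h.symm)
  | y_yStar_self (i : ZMod p) : GrothendieckRel (gY i * gYStar i) (gX i ^ 2)
  | x_y_self (i : ZMod p) : GrothendieckRel (gX i * gY i) (gX i ^ 2)
  | x_yStar_self (i : ZMod p) : GrothendieckRel (gX i * gYStar i) (gX i ^ 2)
  | xx_x (i j k : ZMod p) (hij : i ≠ j) (hik : i ≠ k) (hkj : k ≠ j) (h : CycLtLt i k j) :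
      GrothendieckRel (gXX i j hij * gX k) (gXX i k hik * gX j + gXX k j hkj * gX i)
  | xx_xx_disjoint (i j k l : ZMod p) (hij : i ≠ j) (hkl : k ≠ l)
      (h : CycLtLe i j k ∧ CycLeLt j k l ∧ CycLtLe k l i) :
      GrothendieckRel (gXX i j hij * gXX k l hkl) 0
  | xx_xx_overlap (i j k l : ZMod p) (hij : i ≠ j) (hkl : k ≠ l) (hkj : k ≠ j)
      (h : CycLeLt i k j ∧ CycLtLe k j l ∧ CycLeLe j l i) :
      GrothendieckRel (gXX i j hij * gXX k l hkl) (gXX k j hkj * gX i * gX l)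
  | xx_xx_nested (i j k l : ZMod p) (hij : i ≠ j) (hkl : k ≠ l)
      (h : CycLeLt i k l ∧ CycLtLe k l j ∧ CycLeLe l j i) :
      GrothendieckRel (gXX i j hij * gXX k l hkl) (gXX k l hkl * gX i * gX j)
  | xx_xx_twice (i j k l : ZMod p) (hij : i ≠ j) (hkl : k ≠ l) (hil : i ≠ l) (hkj : k ≠ j)
      (h : CycLtLt i l k ∧ CycLtLt l k j ∧ CycLtLe k j i) :
      GrothendieckRel (gXX i j hij * gXX k l hkl)
        (gXX i l hil * gX k * gX j + gXX k j hkj * gX i * gX l)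
  | xx_y (i j k : ZMod p) (h : i ≠ j) : GrothendieckRel (gXX i j h * gY k) (gXX i j h * gX k)
  | xx_yStar (i j k : ZMod p) (h : i ≠ j) :
      GrothendieckRel (gXX i j h * gYStar k) (gXX i j h * gX k)

/-- The ideal generated by the relations. -/
def relationIdeal (p : ℕ) : Ideal (MvPolynomial (Gen p) ℂ) :=
  Ideal.span {f | ∃ a b, GrothendieckRel a b ∧ f = a - b}

/-- The commutative `ℂ`-algebra with the given generators and relations. -/
abbrev PresentedAlgebra (p : ℕ) : Type := MvPolynomial (Gen p) ℂ ⧸ relationIdeal p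

/-- The indices of the normal form monomials; the exponents are functions on `ℤ/p`. -/
inductive NormalForm (p : ℕ) : Type
  | xx (i j : ZMod p) (h : i ≠ j) (a : ZMod p → ℕ) (ha : ∀ k, a k ≠ 0 → CycLeLe j k i)
  | xPow (i : ZMod p) (a : ℕ) (ha : 0 < a)
  | u (ξ : ℂˣ)
  | uy (ξ : ℂˣ) (a : ZMod p → ℕ) (ha : a ≠ 0)
  | uyStar (ξ : ℂˣ) (a : ZMod p → ℕ) (ha : a ≠ 0)

/-- The element of the Grothendieck ring denoted by a generator. -/
def genClass [NeZero p] {q : ℂˣ} (hq : IsPrimitiveRoot q p) :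
    Gen p → GrothendieckRing (unitOrbit hq) (breakMonoid p q)
  | .u ξ => clsU hq ξ
  | .x i => clsX hq i
  | .y i => clsY hq i
  | .yStar i => clsYStar hq i
  | .xx i j h => clsXX hq i j h

/-- The normal form monomials in the Grothendieck ring. -/
def normalFormElement [NeZero p] {q : ℂˣ} (hq : IsPrimitiveRoot q p) :
    NormalForm p → GrothendieckRing (unitOrbit hq) (breakMonoid p q)
  | .xx i j h a _ => clsXX hq i j h * ∏ k, clsX hq k ^ a k
  | .xPow i a _ => clsX hq i ^ a
  | .u ξ => clsU hq ξ
  | .uy ξ a _ => clsU hq ξ * ∏ k, clsY hq k ^ a k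
  | .uyStar ξ a _ => clsU hq ξ * ∏ k, clsYStar hq k ^ a k

end Presentation

end

/-! The Grothendieck groups are spanned by classes of very explicit modules, and there are enough
numerical invariants to tell these classes apart. The invariants ("characters") of `V` are the
dimensions of the weight spaces and the traces of `X^(pn)` and `Y^(pn)`, `n ≥ 1`, on the weight
space of `𝔪₀`. They are additive on exact sequences. They are also multiplicative, because the
weight space of `V ⊗_R W` at `𝔪` is the tensor product over `ℂ` of the weight spaces of `V` and `W`
at `𝔪`. Recording the degree `t` as well, every character becomes an algebra homomorphism `charHom`
from the Grothendieck ring to the monoid algebra of the degrees.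

Spanning (`WMod.exists_basic_sub`, `span_range_basicClass`): look at weight vectors at a break, i.e.
at a zero of `t` on the orbit, that are killed by `X`. If one of them is killed by a power of `Y`,
it generates an interval module for a suitable choice of the vector. If such vectors exist but no
power of `Y` kills them, an eigenvector of `Y^p` gives a circle around which `Y` runs. If there are
none, `X` is injective on weight spaces and an eigenvector of `X^p` gives a circle around which `X`
runs. So every nonzero module contains one of these basic modules, and induction on the dimension
finishes the argument.

Independence (`eq_zero_of_sum_single`): within one degree, circles are distinguished by the nonzero
monodromies of `X` or `Y`, by a Vandermonde argument, and intervals between consecutive breaks have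
disjoint supports, so dimensions separate them. The basic modules and the normal form monomials are
indexed by the same set and have the same characters (`charHom_basicClass`,
`charHom_normalFormElement`).

It follows that the characters together are injective on the Grothendieck ring (`eq_of_charHom_eq`),
so that equality there is a matter of numbers. The monomials equal the classes of the basic modules,
hence form a basis, and the relations reduce to identities between indicator functions of arcs on
`ℤ/p`. Neither the simplicity of the basic modules nor an explicit decomposition of a tensor product
is needed.

For the presentation, the relations alone suffice to rewrite every polynomial in the generators as a
combination of normal forms (`SatisfiesRel.span_normalMonomial`). The canonical map thus takes a
spanning family of the presented algebra to a basis, and is bijective. -/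

noncomputable section

open LaurentPolynomial

/-! ### Weight vectors over the orbit of roots of unity -/

section WeightIdempotents

variable {p : ℕ} [NeZero p] {q : ℂˣ}

/-- The Lagrange interpolation element of `ℂ[z, z⁻¹]` with value `1` at `q^k` and value `0` at the
other powers of `q`. -/
def weightIdem (q : ℂˣ) (k : ZMod p) : LaurentPolynomial ℂ :=
  ∏ l ∈ Finset.univ.erase k,
    (C (((qpow q k : ℂˣ) : ℂ) - (qpow q l : ℂˣ))⁻¹ * linearFactor (qpow q l))

theorem evalAt_weightIdem (hq : IsPrimitiveRoot q p) (k l : ZMod p) :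
    evalAt (qpow q l) (weightIdem q k) = if l = k then 1 else 0 := by
  rw [weightIdem, map_prod]
  split_ifs with h
  · subst h
    refine Finset.prod_eq_one fun m hm => ?_
    rw [map_mul, evalAt_C, evalAt_linearFactor]
    refine inv_mul_cancel₀ (sub_ne_zero.mpr fun h => ?_)
    exact (Finset.mem_erase.mp hm).1 (qpow_injective hq (Units.ext h)).symm
  · refine Finset.prod_eq_zero (Finset.mem_erase.mpr ⟨h, Finset.mem_univ l⟩) ?_
    rw [map_mul, evalAt_linearFactor, sub_self, mul_zero]

/-- The maximal ideals of the orbit are `(z - q^k)` with `k` an integer; reducing `k` modulo `p`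
leaves only the conditions at the `p` points `q^k`. -/
theorem mem_unitOrbit_ideal (hq : IsPrimitiveRoot q p) {f : LaurentPolynomial ℂ}
    (hf : ∀ k : ZMod p, evalAt (qpow q k) f = 0) : f ∈ (unitOrbit hq).ideal := by
  simp only [FiniteOrbit.ideal, Submodule.mem_iInf]
  rintro m ⟨k, hk⟩
  change m.asIdeal = (pointIdeal 1).asIdeal.map _ at hk
  rw [hk, map_pointIdeal, mul_one]
  have h : q ^ k = qpow q (k : ZMod p) := by
    have hp : (0 : ℤ) < p := by exact_mod_cast NeZero.pos p
    rw [qpow, ← zpow_natCast, ZMod.val_intCast]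
    conv_lhs => rw [← Int.emod_add_mul_ediv k p, zpow_add, zpow_mul, zpow_natCast,
      hq.pow_eq_one, one_zpow, mul_one]
  rw [h]
  change f ∈ Ideal.span _
  rw [← ker_evalAt, RingHom.mem_ker]
  exact hf k

/-- A module on which the functions vanishing on the orbit act by zero is the sum of its weight
spaces. -/
theorem iSup_weightSpace_eq_top (hq : IsPrimitiveRoot q p) {V : Type*} [AddCommGroup V]
    [Module (LaurentPolynomial ℂ) V]
    (h : ∀ f : LaurentPolynomial ℂ, (∀ k : ZMod p, evalAt (qpow q k) f = 0) → ∀ v : V, f • v = 0) :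
    ⨆ m ∈ (unitOrbit hq).carrier, weightSpace (LaurentPolynomial ℂ) V m = ⊤ := by
  refine eq_top_iff.mpr fun v _ => ?_
  -- The interpolation elements form a partition of unity on the orbit: `1 - ∑ weightIdem` vanishes
  -- at every `q^k`.
  have hv : v = ∑ k : ZMod p, weightIdem q k • v := by
    rw [← Finset.sum_smul, ← sub_eq_zero]
    have := h (1 - ∑ k : ZMod p, weightIdem q k) (fun l => by
      simp [map_sum, evalAt_weightIdem hq]) v
    rwa [sub_smul, one_smul] at this
  rw [hv]
  refine Submodule.sum_mem _ fun k _ => ?_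
  refine Submodule.mem_iSup_of_mem (pointIdeal (qpow q k))
    (Submodule.mem_iSup_of_mem (pointIdeal_mem hq k) ?_)
  rw [Submodule.mem_torsionBySet_iff]
  rintro ⟨f, hf⟩
  change f ∈ Ideal.span _ at hf
  rw [← ker_evalAt, RingHom.mem_ker] at hf
  change f • weightIdem q k • v = 0
  rw [← mul_smul]
  refine h _ (fun l => ?_) v
  rw [map_mul, evalAt_weightIdem hq]
  split_ifs with hl
  · rw [hl, hf, zero_mul]
  · rw [mul_zero]

end WeightIdempotents

/-! ### Weight modules as finite dimensional complex vector spaces with operators -/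

namespace WMod

variable {p : ℕ} [NeZero p] {q : ℂˣ} {hq : IsPrimitiveRoot q p} {t t' : LaurentPolynomial ℂ}

instance (V : WMod (unitOrbit hq) t) : Module ℂ V.carrier :=
  Module.compHom V.carrier (C : ℂ →+* LaurentPolynomial ℂ)

theorem complex_smul_def (V : WMod (unitOrbit hq) t) (c : ℂ) (v : V.carrier) :
    c • v = (C c : LaurentPolynomial ℂ) • v := rfl

instance (V : WMod (unitOrbit hq) t) : IsScalarTower ℂ (LaurentPolynomial ℂ) V.carrier :=
  ⟨fun c f v => by rw [complex_smul_def, smul_eq_C_mul, mul_smul]⟩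

variable (V : WMod (unitOrbit hq) t)

/-- The action of `R` factors through the values on the orbit. All identities between the elements
`weightIdem` acting on a module are verified pointwise in this way. -/
theorem smul_congr {f g : LaurentPolynomial ℂ}
    (h : ∀ k : ZMod p, evalAt (qpow q k) f = evalAt (qpow q k) g) (v : V.carrier) :
    f • v = g • v := by
  rw [← sub_eq_zero, ← sub_smul]
  exact V.smul_eq_zero_of_mem_ideal (mem_unitOrbit_ideal hq fun k => by
    rw [map_sub, h k, sub_self]) v

theorem sum_weightIdem_smul (v : V.carrier) : ∑ k : ZMod p, weightIdem q k • v = v := by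
  rw [← Finset.sum_smul]
  conv_rhs => rw [← one_smul (LaurentPolynomial ℂ) v]
  exact V.smul_congr (fun l => by simp [map_sum, evalAt_weightIdem hq]) v

theorem smul_weightIdem_smul (f : LaurentPolynomial ℂ) (k : ZMod p) (v : V.carrier) :
    f • weightIdem q k • v = evalAt (qpow q k) f • weightIdem q k • v := by
  rw [complex_smul_def, ← mul_smul, ← mul_smul]
  refine V.smul_congr (fun l => ?_) v
  rw [map_mul, map_mul, evalAt_C, evalAt_weightIdem hq]
  split_ifs with h
  · rw [h]
  · simp

/-- The operator `X`, as a `ℂ`-linear map. -/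
def opX : V.carrier →ₗ[ℂ] V.carrier where
  toFun := V.action.X
  map_add' := map_add _
  map_smul' c v := by
    rw [complex_smul_def, map_smulₛₗ]
    change qShift q (C c) • _ = _
    rw [qShift_apply, scaleHom_C]
    rfl

/-- The operator `Y`, as a `ℂ`-linear map. -/
def opY : V.carrier →ₗ[ℂ] V.carrier where
  toFun := V.action.Y
  map_add' := map_add _
  map_smul' c v := by
    rw [complex_smul_def, map_smulₛₗ]
    change (qShift q).symm (C c) • _ = _
    rw [qShift_symm_apply, scaleHom_C]
    rfl

/-- The multiplication by an element of `ℂ[z, z⁻¹]`, as a `ℂ`-linear map. -/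
def opSMul (f : LaurentPolynomial ℂ) : V.carrier →ₗ[ℂ] V.carrier where
  toFun v := f • v
  map_add' := smul_add f
  map_smul' c v := by
    change f • (c • v) = c • (f • v)
    rw [complex_smul_def, complex_smul_def, smul_comm]

theorem opSMul_apply (f : LaurentPolynomial ℂ) (v : V.carrier) : V.opSMul f v = f • v := rfl

theorem opX_smul (f : LaurentPolynomial ℂ) (v : V.carrier) :
    V.opX (f • v) = qShift q f • V.opX v := map_smulₛₗ V.action.X f v

theorem opY_smul (f : LaurentPolynomial ℂ) (v : V.carrier) :
    V.opY (f • v) = (qShift q).symm f • V.opY v := map_smulₛₗ V.action.Y f v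

theorem opY_opX (v : V.carrier) : V.opY (V.opX v) = t • v := V.action.YX v

theorem opX_opY (v : V.carrier) : V.opX (V.opY v) = qShift q t • v := V.action.XY v

/-- The weight space of the weight `(z - q^k)`. -/
def wt (k : ZMod p) : Submodule ℂ V.carrier where
  carrier := {v | ∀ f : LaurentPolynomial ℂ, f • v = evalAt (qpow q k) f • v}
  zero_mem' f := by rw [smul_zero, smul_zero]
  add_mem' hv hw f := by rw [smul_add, smul_add, hv f, hw f]
  smul_mem' c v hv f := by
    change f • (c • v) = _ • (c • v)
    rw [complex_smul_def V c, smul_comm, hv f, complex_smul_def, complex_smul_def, smul_comm]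

variable {V}

theorem smul_of_mem_wt {k : ZMod p} {v : V.carrier} (hv : v ∈ V.wt k) (f : LaurentPolynomial ℂ) :
    f • v = evalAt (qpow q k) f • v := hv f

theorem weightIdem_smul_mem_wt (k : ZMod p) (v : V.carrier) : weightIdem q k • v ∈ V.wt k :=
  fun f => V.smul_weightIdem_smul f k v

theorem opX_mem_wt {k : ZMod p} {v : V.carrier} (hv : v ∈ V.wt k) : V.opX v ∈ V.wt (k + 1) := by
  intro f
  have h := V.opX_smul ((qShift q).symm f) v
  rw [RingEquiv.apply_symm_apply, smul_of_mem_wt hv, map_smul, evalAt_qpow_pred hq rfl] at h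
  exact h.symm

theorem opY_mem_wt {k : ZMod p} {v : V.carrier} (hv : v ∈ V.wt (k + 1)) : V.opY v ∈ V.wt k := by
  intro f
  have h := V.opY_smul (qShift q f) v
  rw [RingEquiv.symm_apply_apply, smul_of_mem_wt hv, map_smul, evalAt_qpow_succ hq rfl] at h
  exact h.symm

theorem opY_opX_of_mem_wt {k : ZMod p} {v : V.carrier} (hv : v ∈ V.wt k) :
    V.opY (V.opX v) = evalAt (qpow q k) t • v := by
  rw [opY_opX, smul_of_mem_wt hv]

theorem opX_opY_of_mem_wt {k : ZMod p} {v : V.carrier} (hv : v ∈ V.wt (k + 1)) :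
    V.opX (V.opY v) = evalAt (qpow q k) t • v := by
  rw [opX_opY, smul_of_mem_wt hv, evalAt_qpow_succ hq rfl]

theorem pow_opX_mem_wt {k : ZMod p} {v : V.carrier} (hv : v ∈ V.wt k) (n : ℕ) :
    (V.opX ^ n) v ∈ V.wt (k + n) := by
  induction n with
  | zero => simpa using hv
  | succ n ih =>
    rw [pow_succ', Module.End.mul_apply, Nat.cast_succ, ← add_assoc]
    exact opX_mem_wt ih

theorem pow_opY_mem_wt {k : ZMod p} {v : V.carrier} (hv : v ∈ V.wt k) (n : ℕ) :
    (V.opY ^ n) v ∈ V.wt (k - n) := by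
  induction n with
  | zero => simpa using hv
  | succ n ih =>
    rw [pow_succ', Module.End.mul_apply, Nat.cast_succ]
    refine opY_mem_wt ?_
    rwa [← sub_sub, sub_add_cancel]

/-- The weight components of generators over `R` span over `ℂ`, since `R` acts on each component by
scalars. -/
instance (V : WMod (unitOrbit hq) t) : Module.Finite ℂ V.carrier := by
  have := V.isWeightModule.moduleFinite (unitOrbit hq).carrier_finite
  obtain ⟨s, hs⟩ := this
  classical
  refine ⟨⟨Finset.univ.biUnion fun k : ZMod p => s.image fun v => weightIdem q k • v, ?_⟩⟩
  refine eq_top_iff.mpr fun v _ => ?_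
  have hv : v ∈ Submodule.span (LaurentPolynomial ℂ) (s : Set V.carrier) := hs ▸ trivial
  induction hv using Submodule.span_induction with
  | zero => exact zero_mem _
  | add x y _ _ hx hy => exact add_mem (hx trivial) (hy trivial)
  | mem x hx =>
    rw [← V.sum_weightIdem_smul x]
    refine Submodule.sum_mem _ fun k _ => Submodule.subset_span ?_
    simp only [Finset.coe_biUnion, Set.mem_iUnion]
    exact ⟨k, Finset.mem_coe.mpr (Finset.mem_univ k),
      Finset.mem_coe.mpr (Finset.mem_image_of_mem _ hx)⟩
  | smul f x _ hx =>
    have h : ∀ x ∈ Submodule.span ℂ ((Finset.univ.biUnion fun k : ZMod p =>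
        s.image fun v => weightIdem q k • v : Finset V.carrier) : Set V.carrier),
        f • x ∈ Submodule.span ℂ ((Finset.univ.biUnion fun k : ZMod p =>
        s.image fun v => weightIdem q k • v : Finset V.carrier) : Set V.carrier) := by
      intro x hx
      induction hx using Submodule.span_induction with
      | zero => rw [smul_zero]; exact zero_mem _
      | add x y _ _ hx hy => rw [smul_add]; exact add_mem hx hy
      | smul c x _ hx => rw [complex_smul_def, smul_comm]; exact Submodule.smul_mem _ c hx
      | mem x hx =>
        have hx' := hx
        simp only [Finset.coe_biUnion, Set.mem_iUnion, Finset.mem_coe, Finset.mem_image] at hx'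
        obtain ⟨k, _, v, _, rfl⟩ := hx'
        rw [V.smul_weightIdem_smul]
        exact Submodule.smul_mem _ _ (Submodule.subset_span hx)
    exact h x (hx trivial)

end WMod

/-! ### Characters -/

/-- The trace is additive on short exact sequences. -/
theorem LinearMap.trace_eq_add_of_exact {K A B D : Type*} [Field K] [AddCommGroup A]
    [AddCommGroup B] [AddCommGroup D] [Module K A] [Module K B] [Module K D] [Module.Finite K A]
    [Module.Finite K B] [Module.Finite K D] {i : A →ₗ[K] B} {π : B →ₗ[K] D}
    (hi : Function.Injective i) (hex : Function.Exact i π) (hπ : Function.Surjective π)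
    {f : A →ₗ[K] A} {g : B →ₗ[K] B} {h : D →ₗ[K] D} (hfg : g ∘ₗ i = i ∘ₗ f)
    (hgh : π ∘ₗ g = h ∘ₗ π) :
    LinearMap.trace K B g = LinearMap.trace K A f + LinearMap.trace K D h := by
  obtain ⟨r, hr⟩ := i.exists_leftInverse_of_injective (LinearMap.ker_eq_bot.mpr hi)
  obtain ⟨s, hs⟩ := π.exists_rightInverse_of_surjective (LinearMap.range_eq_top.mpr hπ)
  have hπi : π ∘ₗ i = 0 := LinearMap.ext fun a => hex.apply_apply_eq_zero a
  -- The correction puts the section into the kernel of `r`. Then `i ∘ r` and `s' ∘ π` are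
  -- complementary projections, and cyclicity of the trace moves the two halves to `A` and `D`.
  set s' : D →ₗ[K] B := s - i ∘ₗ r ∘ₗ s with hs'
  have hs1 : π ∘ₗ s' = LinearMap.id := by
    rw [hs', LinearMap.comp_sub, ← LinearMap.comp_assoc, hπi, LinearMap.zero_comp, sub_zero, hs]
  have hid : i ∘ₗ r + s' ∘ₗ π = LinearMap.id := by
    refine LinearMap.ext fun b => ?_
    have hb : π (b - s (π b)) = 0 := by
      rw [map_sub, sub_eq_zero]
      exact (LinearMap.congr_fun hs (π b)).symm
    obtain ⟨a, ha⟩ := (hex _).mp hb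
    have hra : r (b - s (π b)) = a := by rw [← ha]; exact LinearMap.congr_fun hr a
    simp only [hs', LinearMap.add_apply, LinearMap.comp_apply, LinearMap.sub_apply,
      LinearMap.id_apply]
    rw [map_sub] at hra
    have h2 : i (r b) - i (r (s (π b))) = b - s (π b) := by rw [← map_sub, hra, ha]
    rw [← add_sub_assoc, add_comm, add_sub_assoc, h2, add_sub_cancel]
  calc LinearMap.trace K B g = LinearMap.trace K B (g ∘ₗ (i ∘ₗ r + s' ∘ₗ π)) := by
        rw [hid, LinearMap.comp_id]
    _ = LinearMap.trace K B ((i ∘ₗ f) ∘ₗ r) + LinearMap.trace K B ((g ∘ₗ s') ∘ₗ π) := by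
        rw [LinearMap.comp_add, map_add, ← LinearMap.comp_assoc, hfg, ← LinearMap.comp_assoc]
    _ = LinearMap.trace K A (r ∘ₗ i ∘ₗ f) + LinearMap.trace K D (π ∘ₗ g ∘ₗ s') := by
        rw [LinearMap.trace_comp_comm' (i ∘ₗ f) r, LinearMap.trace_comp_comm' (g ∘ₗ s') π]
    _ = _ := by
        rw [← LinearMap.comp_assoc, hr, LinearMap.id_comp, ← LinearMap.comp_assoc, hgh,
          LinearMap.comp_assoc, hs1, LinearMap.comp_id]

/-- The characters of weight modules that detect their composition factors: the dimensions of the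
weight spaces, and the traces of the positive powers of the monodromies of `X` and of `Y`. -/
inductive CharIndex (p : ℕ) : Type
  | dim (k : ZMod p)
  | x (n : ℕ)
  | y (n : ℕ)

namespace WMod

variable {p : ℕ} [NeZero p] {q : ℂˣ} {hq : IsPrimitiveRoot q p} {t t' : LaurentPolynomial ℂ}

/-- Morphisms are `ℂ`-linear. -/
def homC {V W : WMod (unitOrbit hq) t} (f : V.carrier →ₗ[GWA (qShift q) t] W.carrier) :
    V.carrier →ₗ[ℂ] W.carrier where
  toFun := f
  map_add' := map_add f
  map_smul' c v := map_smul (homR f) (C c : LaurentPolynomial ℂ) v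

theorem pow_opX_homC {V W : WMod (unitOrbit hq) t}
    (f : V.carrier →ₗ[GWA (qShift q) t] W.carrier) (n : ℕ) :
    (W.opX ^ n) ∘ₗ homC f = homC f ∘ₗ (V.opX ^ n) := by
  induction n with
  | zero => rfl
  | succ n ih =>
    rw [pow_succ', pow_succ', Module.End.mul_eq_comp, Module.End.mul_eq_comp, LinearMap.comp_assoc,
      ih, ← LinearMap.comp_assoc, ← LinearMap.comp_assoc]
    congr 1
    exact LinearMap.ext fun v => (map_smul f (GWA.X (qShift q) t) v).symm

theorem pow_opY_homC {V W : WMod (unitOrbit hq) t}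
    (f : V.carrier →ₗ[GWA (qShift q) t] W.carrier) (n : ℕ) :
    (W.opY ^ n) ∘ₗ homC f = homC f ∘ₗ (V.opY ^ n) := by
  induction n with
  | zero => rfl
  | succ n ih =>
    rw [pow_succ', pow_succ', Module.End.mul_eq_comp, Module.End.mul_eq_comp, LinearMap.comp_assoc,
      ih, ← LinearMap.comp_assoc, ← LinearMap.comp_assoc]
    congr 1
    exact LinearMap.ext fun v => (map_smul f (GWA.Y (qShift q) t) v).symm

theorem opSMul_homC {V W : WMod (unitOrbit hq) t}
    (f : V.carrier →ₗ[GWA (qShift q) t] W.carrier) (r : LaurentPolynomial ℂ) :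
    W.opSMul r ∘ₗ homC f = homC f ∘ₗ V.opSMul r :=
  LinearMap.ext fun v => (map_smul f (GWA.ofR (qShift q) t r) v).symm

/-- The operator whose trace is the character. -/
def charOp (V : WMod (unitOrbit hq) t) : CharIndex p → (V.carrier →ₗ[ℂ] V.carrier)
  | .dim k => V.opSMul (weightIdem q k)
  | .x n => V.opSMul (weightIdem q (0 : ZMod p)) ∘ₗ (V.opX ^ (p * (n + 1)))
  | .y n => V.opSMul (weightIdem q (0 : ZMod p)) ∘ₗ (V.opY ^ (p * (n + 1)))

/-- The value of a character on a weight module. -/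
def char (V : WMod (unitOrbit hq) t) (χ : CharIndex p) : ℂ :=
  LinearMap.trace ℂ V.carrier (V.charOp χ)

theorem charOp_homC {V W : WMod (unitOrbit hq) t}
    (f : V.carrier →ₗ[GWA (qShift q) t] W.carrier) (χ : CharIndex p) :
    W.charOp χ ∘ₗ homC f = homC f ∘ₗ V.charOp χ := by
  cases χ with
  | dim k => exact opSMul_homC f _
  | x n =>
    rw [charOp, charOp, LinearMap.comp_assoc, pow_opX_homC, ← LinearMap.comp_assoc, opSMul_homC,
      LinearMap.comp_assoc]
  | y n =>
    rw [charOp, charOp, LinearMap.comp_assoc, pow_opY_homC, ← LinearMap.comp_assoc, opSMul_homC,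
      LinearMap.comp_assoc]

/-- Morphisms commute with the operators whose traces are taken, so these induce compatible
operators on the three terms. This is what lets a character descend to the Grothendieck group. -/
theorem char_eq_add (χ : CharIndex p) (A B D : WMod (unitOrbit hq) t)
    (f : A.carrier →ₗ[GWA (qShift q) t] B.carrier) (g : B.carrier →ₗ[GWA (qShift q) t] D.carrier)
    (hf : Function.Injective f) (hfg : Function.Exact f g) (hg : Function.Surjective g) :
    B.char χ = A.char χ + D.char χ :=
  LinearMap.trace_eq_add_of_exact (i := homC f) (π := homC g) hf hfg hg (charOp_homC f χ)
    (charOp_homC g χ).symm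

/-! ### Multiplicativity of the characters: `V ⊗_R W` as a direct summand of `V ⊗_ℂ W` -/

section tensor

variable (V : WMod (unitOrbit hq) t) (W : WMod (unitOrbit hq) t')

/-- The projection `V ⊗_ℂ W → V ⊗_R W`. -/
def tensorProj : V.carrier ⊗[ℂ] W.carrier →ₗ[ℂ] (V.tensor W).carrier :=
  TensorProduct.lift (LinearMap.mk₂ ℂ (fun v w => (tensorEquiv V W).symm (v ⊗ₜ w))
    (fun v v' w => by rw [TensorProduct.add_tmul, map_add])
    (fun c v w => by
      rw [complex_smul_def, complex_smul_def, ← TensorProduct.smul_tmul', map_smul])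
    (fun v w w' => by rw [TensorProduct.tmul_add, map_add])
    (fun c v w => by
      rw [complex_smul_def, complex_smul_def, TensorProduct.tmul_smul, map_smul]))

theorem tensorProj_tmul (v : V.carrier) (w : W.carrier) :
    tensorProj V W (v ⊗ₜ w) = (tensorEquiv V W).symm (v ⊗ₜ w) := rfl

/-- The section `v ⊗ w ↦ ∑ e_k v ⊗ e_k w` of the projection `V ⊗_ℂ W → V ⊗_R W`. -/
def tensorSection : (V.tensor W).carrier →ₗ[ℂ] V.carrier ⊗[ℂ] W.carrier :=
  LinearMap.restrictScalars ℂ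
    (TensorProduct.lift (LinearMap.mk₂ (LaurentPolynomial ℂ)
      (fun v w => ∑ k : ZMod p, (weightIdem q k • v) ⊗ₜ[ℂ] (weightIdem q k • w))
      (fun v v' w => by
        simp only [smul_add, TensorProduct.add_tmul, Finset.sum_add_distrib])
      (fun f v w => by
        rw [Finset.smul_sum]
        refine Finset.sum_congr rfl fun k _ => ?_
        rw [TensorProduct.smul_tmul', smul_comm])
      (fun v w w' => by
        simp only [smul_add, TensorProduct.tmul_add, Finset.sum_add_distrib])
      (fun f v w => by
        rw [Finset.smul_sum]
        refine Finset.sum_congr rfl fun k _ => ?_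
        -- `R` acts on `V ⊗_ℂ W` through the left factor here. On both components of weight `k` the
        -- element `f` is the scalar `f(q^k)`, which may be moved across `⊗_ℂ`.
        rw [TensorProduct.smul_tmul', smul_comm _ f w, smul_weightIdem_smul W f k w,
          smul_weightIdem_smul V f k v]
        exact (TensorProduct.smul_tmul (evalAt (qpow q k) f) _ _).symm)) ∘ₗ
      (tensorEquiv V W).toLinearMap)

theorem tensorSection_tmul (v : V.carrier) (w : W.carrier) :
    tensorSection V W ((tensorEquiv V W).symm (v ⊗ₜ w)) =
      ∑ k : ZMod p, (weightIdem q k • v) ⊗ₜ[ℂ] (weightIdem q k • w) := rfl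

theorem weightIdem_smul_weightIdem_smul (k l : ZMod p) (v : V.carrier) :
    weightIdem q k • weightIdem q l • v = if k = l then weightIdem q k • v else 0 := by
  rw [smul_weightIdem_smul, evalAt_weightIdem hq]
  by_cases h : k = l
  · simp [h]
  · simp [h, Ne.symm h]

theorem tensor_induction {P : (V.tensor W).carrier → Prop} (h0 : P 0)
    (hadd : ∀ x y, P x → P y → P (x + y))
    (h : ∀ v w, P ((tensorEquiv V W).symm (v ⊗ₜ w))) (x : (V.tensor W).carrier) : P x := by
  obtain ⟨y, rfl⟩ := (tensorEquiv V W).symm.surjective x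
  induction y with
  | zero => rw [map_zero]; exact h0
  | add x y hx hy => rw [map_add]; exact hadd _ _ hx hy
  | tmul v w => exact h v w

/-- Over `R` the idempotent moves across the tensor sign, so the summand for `k` becomes `e_k v ⊗
w`, and the `e_k` sum to the identity. -/
theorem tensorProj_comp_tensorSection : tensorProj V W ∘ₗ tensorSection V W = LinearMap.id := by
  refine LinearMap.ext fun x => ?_
  induction x using tensor_induction with
  | h0 => simp only [map_zero]
  | hadd x y hx hy => simp only [map_add, hx, hy]
  | h v w =>
    rw [LinearMap.comp_apply, tensorSection_tmul, map_sum, LinearMap.id_apply]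
    simp only [tensorProj_tmul]
    rw [← map_sum]
    congr 1
    have : ∀ k : ZMod p, (weightIdem q k • v) ⊗ₜ[LaurentPolynomial ℂ] (weightIdem q k • w) =
        (weightIdem q k • v) ⊗ₜ[LaurentPolynomial ℂ] w := fun k => by
      rw [← TensorProduct.smul_tmul, weightIdem_smul_weightIdem_smul, if_pos rfl]
    simp only [this]
    rw [← TensorProduct.sum_tmul, V.sum_weightIdem_smul]

theorem opSMul_comp_tensorProj (k : ZMod p) :
    (V.tensor W).opSMul (weightIdem q k) ∘ₗ tensorProj V W = tensorProj V W ∘ₗ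
      TensorProduct.map (V.opSMul (weightIdem q k)) (W.opSMul (weightIdem q k)) := by
  refine TensorProduct.ext' fun v w => ?_
  rw [LinearMap.comp_apply, LinearMap.comp_apply, TensorProduct.map_tmul, tensorProj_tmul,
    tensorProj_tmul, opSMul_apply, opSMul_apply, opSMul_apply, ← map_smul,
    ← TensorProduct.smul_tmul, weightIdem_smul_weightIdem_smul, if_pos rfl,
    TensorProduct.smul_tmul']

/-- On tensors whose two factors have the same weight `k`, only the summand for `k` of the section
survives, and it is the identity. -/
theorem tensorSection_tensorProj_map (k : ZMod p) :
    tensorSection V W ∘ₗ tensorProj V W ∘ₗ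
      TensorProduct.map (V.opSMul (weightIdem q k)) (W.opSMul (weightIdem q k)) =
      TensorProduct.map (V.opSMul (weightIdem q k)) (W.opSMul (weightIdem q k)) := by
  refine TensorProduct.ext' fun v w => ?_
  rw [LinearMap.comp_apply, LinearMap.comp_apply, TensorProduct.map_tmul, tensorProj_tmul,
    tensorSection_tmul, Finset.sum_eq_single k]
  · simp only [opSMul_apply, weightIdem_smul_weightIdem_smul, if_true]
  · intro l _ hl
    rw [opSMul_apply, weightIdem_smul_weightIdem_smul, if_neg hl, TensorProduct.zero_tmul]
  · exact fun h => absurd (Finset.mem_univ k) h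

/-- The section identifies the weight space of `V ⊗_R W` with the tensor product over `ℂ` of the
weight spaces. Cyclicity of the trace transports the operator there, where the trace of a tensor
product of maps is the product of the traces. -/
theorem trace_tensor (k : ZMod p) {F : V.carrier →ₗ[ℂ] V.carrier} {G : W.carrier →ₗ[ℂ] W.carrier}
    {H : (V.tensor W).carrier →ₗ[ℂ] (V.tensor W).carrier}
    (hH : H ∘ₗ tensorProj V W = tensorProj V W ∘ₗ TensorProduct.map F G) :
    LinearMap.trace ℂ _ ((V.tensor W).opSMul (weightIdem q k) ∘ₗ H) =
      LinearMap.trace ℂ _ (V.opSMul (weightIdem q k) ∘ₗ F) *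
        LinearMap.trace ℂ _ (W.opSMul (weightIdem q k) ∘ₗ G) := by
  calc LinearMap.trace ℂ _ ((V.tensor W).opSMul (weightIdem q k) ∘ₗ H)
      = LinearMap.trace ℂ _ (((V.tensor W).opSMul (weightIdem q k) ∘ₗ H) ∘ₗ
          (tensorProj V W ∘ₗ tensorSection V W)) := by
        rw [tensorProj_comp_tensorSection, LinearMap.comp_id]
    _ = LinearMap.trace ℂ _ ((tensorProj V W ∘ₗ
          TensorProduct.map (V.opSMul (weightIdem q k)) (W.opSMul (weightIdem q k)) ∘ₗ
          TensorProduct.map F G) ∘ₗ tensorSection V W) := by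
        rw [← LinearMap.comp_assoc _ _ (tensorProj V W), ← opSMul_comp_tensorProj]
        simp only [LinearMap.comp_assoc]
        rw [← LinearMap.comp_assoc _ _ H, hH, LinearMap.comp_assoc]
    _ = LinearMap.trace ℂ _ (TensorProduct.map (V.opSMul (weightIdem q k))
          (W.opSMul (weightIdem q k)) ∘ₗ TensorProduct.map F G) := by
        rw [LinearMap.trace_comp_comm', ← LinearMap.comp_assoc, ← LinearMap.comp_assoc,
          LinearMap.comp_assoc _ (tensorProj V W), tensorSection_tensorProj_map]
    _ = _ := by
        rw [← TensorProduct.map_comp, LinearMap.trace_tensorProduct']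

theorem pow_opX_comp_tensorProj (n : ℕ) : ((V.tensor W).opX ^ n) ∘ₗ tensorProj V W =
    tensorProj V W ∘ₗ TensorProduct.map (V.opX ^ n) (W.opX ^ n) := by
  induction n with
  | zero => exact TensorProduct.ext' fun v w => rfl
  | succ n ih =>
    rw [pow_succ, pow_succ, pow_succ, Module.End.mul_eq_comp, Module.End.mul_eq_comp,
      Module.End.mul_eq_comp, TensorProduct.map_comp, ← LinearMap.comp_assoc, ← ih,
      LinearMap.comp_assoc, LinearMap.comp_assoc]
    congr 1
    exact TensorProduct.ext' fun v w => tensor_X V W (v ⊗ₜ w)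

theorem pow_opY_comp_tensorProj (n : ℕ) : ((V.tensor W).opY ^ n) ∘ₗ tensorProj V W =
    tensorProj V W ∘ₗ TensorProduct.map (V.opY ^ n) (W.opY ^ n) := by
  induction n with
  | zero => exact TensorProduct.ext' fun v w => rfl
  | succ n ih =>
    rw [pow_succ, pow_succ, pow_succ, Module.End.mul_eq_comp, Module.End.mul_eq_comp,
      Module.End.mul_eq_comp, TensorProduct.map_comp, ← LinearMap.comp_assoc, ← ih,
      LinearMap.comp_assoc, LinearMap.comp_assoc]
    congr 1
    exact TensorProduct.ext' fun v w => tensor_Y V W (v ⊗ₜ w)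

/-- The characters are multiplicative. -/
theorem char_tensor (χ : CharIndex p) : (V.tensor W).char χ = V.char χ * W.char χ := by
  cases χ with
  | dim k =>
    have h := trace_tensor V W k (F := LinearMap.id) (G := LinearMap.id) (H := LinearMap.id)
      (by rw [TensorProduct.map_id]; rfl)
    simp only [LinearMap.comp_id] at h
    exact h
  | x n => exact trace_tensor V W 0 (pow_opX_comp_tensorProj V W _)
  | y n => exact trace_tensor V W 0 (pow_opY_comp_tensorProj V W _)

end tensor

end WMod

/-! ### Characters as multiplicative maps on the Grothendieck ring -/

namespace GrothendieckRing

variable {p : ℕ} [NeZero p] {q : ℂˣ} {hq : IsPrimitiveRoot q p}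
  {M : Submonoid (LaurentPolynomial ℂ)}

/-- A character as a linear map from the Grothendieck ring to the monoid algebra of the degrees. -/
def charLin (hq : IsPrimitiveRoot q p) (M : Submonoid (LaurentPolynomial ℂ)) (χ : CharIndex p) :
    GrothendieckRing (unitOrbit hq) M →ₗ[ℂ] MonoidAlgebra ℂ M :=
  lift fun t ht => MonoidAlgebra.lsingle (⟨t, ht⟩ : M) ∘ₗ
    LinearMap.liftBaseChange ℂ (K0.lift (fun V : WMod (unitOrbit hq) t => V.char χ)
      (WMod.char_eq_add χ)).toIntLinearMap

theorem charLin_cls (χ : CharIndex p) {t : LaurentPolynomial ℂ} (ht : t ∈ M)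
    (V : WMod (unitOrbit hq) t) :
    charLin hq M χ (cls ht V) = MonoidAlgebra.single (⟨t, ht⟩ : M) (V.char χ) := by
  rw [charLin, cls, lift_incl, LinearMap.comp_apply, LinearMap.liftBaseChange_tmul, one_smul]
  exact congrArg (MonoidAlgebra.single (⟨t, ht⟩ : M))
    (K0.lift_mk (fun V : WMod (unitOrbit hq) t => V.char χ) (WMod.char_eq_add χ) V)

theorem cls_mul_cls {t t' : LaurentPolynomial ℂ} (ht : t ∈ M) (ht' : t' ∈ M)
    (V : WMod (unitOrbit hq) t) (W : WMod (unitOrbit hq) t') :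
    cls ht V * cls ht' W = cls (mul_mem ht ht') (V.tensor W) := mulHom_cls ht ht' V W

theorem charLin_mul (χ : CharIndex p) (a b : GrothendieckRing (unitOrbit hq) M) :
    charLin hq M χ (a * b) = charLin hq M χ a * charLin hq M χ b := by
  suffices h : (LinearMap.mul ℂ _).compr₂ (charLin hq M χ) =
      (LinearMap.mul ℂ _).compl₁₂ (charLin hq M χ) (charLin hq M χ) from
    congrArg (fun f => f a b) h
  refine hom_ext fun t ht V => hom_ext fun t' ht' W => ?_
  rw [LinearMap.compr₂_apply, LinearMap.compl₁₂_apply, LinearMap.mul_apply', LinearMap.mul_apply',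
    cls_mul_cls, charLin_cls, charLin_cls, charLin_cls, MonoidAlgebra.single_mul_single,
    WMod.char_tensor]
  rfl

end GrothendieckRing

/-! ### The characters of the circle and interval modules -/

/-- Used to turn the coefficient collected in `p` successive steps into a product over the whole
circle. -/
theorem prod_range_zmod {p : ℕ} [NeZero p] {A : Type*} [CommMonoid A] (f : ZMod p → A) :
    ∏ j ∈ Finset.range p, f (j : ZMod p) = ∏ m, f m := by
  refine Finset.prod_bij (fun j _ => (j : ZMod p)) (fun _ _ => Finset.mem_univ _) ?_ ?_
    (fun _ _ => rfl)
  · intro a ha b hb h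
    have h' := (ZMod.natCast_eq_natCast_iff' a b p).mp h
    rwa [Nat.mod_eq_of_lt (Finset.mem_range.mp ha), Nat.mod_eq_of_lt (Finset.mem_range.mp hb)] at h'
  · intro b _
    exact ⟨b.val, Finset.mem_range.mpr (ZMod.val_lt b), ZMod.natCast_zmod_val b⟩

section DiagModules

variable {p : ℕ} [NeZero p] {q : ℂˣ} {hq : IsPrimitiveRoot q p} {t : LaurentPolynomial ℂ}
  {ι : Type} {κ : ι → ZMod p}
  (D : GWAAction (qShift q) t (DiagModule q κ))
  (hfin : Module.Finite (LaurentPolynomial ℂ) (DiagModule q κ))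
  (hsup : ⨆ m ∈ (unitOrbit hq).carrier, weightSpace (LaurentPolynomial ℂ) (DiagModule q κ) m = ⊤)

/-- The coordinates on an object defined by operators on a diagonal module. -/
def diagEquiv : (WMod.ofAction (unitOrbit hq) (DiagModule q κ) D hfin hsup).carrier ≃ₗ[ℂ] (ι → ℂ) :=
  { AddEquiv.refl (ι → ℂ) with
    map_smul' := fun c v => by
      refine (D.toEnd_ofR (C c) v).trans (funext fun i => ?_)
      exact congrArg (· * v i) (evalAt_C (qpow q (κ i)) c) }

theorem diagEquiv_smul (f : LaurentPolynomial ℂ)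
    (v : (WMod.ofAction (unitOrbit hq) (DiagModule q κ) D hfin hsup).carrier) (i : ι) :
    diagEquiv D hfin hsup (f • v) i = evalAt (qpow q (κ i)) f * diagEquiv D hfin hsup v i :=
  congrFun (D.toEnd_ofR f v) i

theorem diagEquiv_opX (v : (WMod.ofAction (unitOrbit hq) (DiagModule q κ) D hfin hsup).carrier) :
    diagEquiv D hfin hsup (WMod.opX _ v) = D.X (diagEquiv D hfin hsup v) :=
  D.toEnd_X v

theorem diagEquiv_opY (v : (WMod.ofAction (unitOrbit hq) (DiagModule q κ) D hfin hsup).carrier) :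
    diagEquiv D hfin hsup (WMod.opY _ v) = D.Y (diagEquiv D hfin hsup v) :=
  D.toEnd_Y v

variable [Fintype ι]

theorem trace_eq_sum_of_diagonal
    {F : (WMod.ofAction (unitOrbit hq) (DiagModule q κ) D hfin hsup).carrier →ₗ[ℂ]
      (WMod.ofAction (unitOrbit hq) (DiagModule q κ) D hfin hsup).carrier} {c : ι → ℂ}
    (h : ∀ v i, diagEquiv D hfin hsup (F v) i = c i * diagEquiv D hfin hsup v i) :
    LinearMap.trace ℂ _ F = ∑ i, c i := by
  classical
  rw [← LinearMap.trace_conj' F (diagEquiv D hfin hsup),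
    LinearMap.trace_eq_matrix_trace ℂ (Pi.basisFun ℂ ι), Matrix.trace]
  refine Finset.sum_congr rfl fun i _ => ?_
  rw [Matrix.diag_apply, LinearMap.toMatrix_apply, LinearEquiv.conj_apply_apply,
    Pi.basisFun_repr, h, LinearEquiv.apply_symm_apply, Pi.basisFun_apply, Pi.single_eq_same,
    mul_one]

theorem char_dim_ofAction (k : ZMod p) :
    (WMod.ofAction (unitOrbit hq) (DiagModule q κ) D hfin hsup).char (.dim k) =
      ∑ i, if κ i = k then 1 else 0 :=
  trace_eq_sum_of_diagonal D hfin hsup (fun v i => by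
    rw [WMod.charOp, WMod.opSMul_apply, diagEquiv_smul, evalAt_weightIdem hq])

end DiagModules

/-! ### Characters of circle modules -/

section Circle

variable {p : ℕ} [NeZero p] {q : ℂˣ} {hq : IsPrimitiveRoot q p} {t : LaurentPolynomial ℂ}
  {w : ZMod p → Letter} {hw : ∀ k, w k = .one ↔ evalAt (qpow q k) t ≠ 0} {ξ : ℂˣ}

theorem prod_wrap (ξ : ℂˣ) : ∏ k : ZMod p, wrap ξ k = ξ := by
  simp [wrap]

/-- The coordinates on the circle module. -/
abbrev circleEquiv (hq : IsPrimitiveRoot q p) (t : LaurentPolynomial ℂ) (w : ZMod p → Letter)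
    (hw : ∀ k, w k = .one ↔ evalAt (qpow q k) t ≠ 0) (ξ : ℂˣ) :
    (circleModule hq t w hw ξ).carrier ≃ₗ[ℂ] (ZMod p → ℂ) :=
  diagEquiv (circleAction hq t w hw ξ) DiagModule.finite (DiagModule.iSup_weightSpace hq)

theorem circleEquiv_opX (v : (circleModule hq t w hw ξ).carrier) (k : ZMod p) :
    circleEquiv hq t w hw ξ (WMod.opX _ v) k = (w (k - 1)).xCoeff (evalAt (qpow q (k - 1)) t) *
      (wrap ξ (k - 1) : ℂˣ) * circleEquiv hq t w hw ξ v (k - 1) :=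
  congrFun (diagEquiv_opX (circleAction hq t w hw ξ) _ _ v) k

theorem circleEquiv_opY (v : (circleModule hq t w hw ξ).carrier) (k : ZMod p) :
    circleEquiv hq t w hw ξ (WMod.opY _ v) k = (w k).yCoeff *
      ((wrap ξ k)⁻¹ : ℂˣ) * circleEquiv hq t w hw ξ v (k + 1) :=
  congrFun (diagEquiv_opY (circleAction hq t w hw ξ) _ _ v) k

theorem circleEquiv_pow_opX (v : (circleModule hq t w hw ξ).carrier) (n : ℕ) (k : ZMod p) :
    circleEquiv hq t w hw ξ ((WMod.opX _ ^ n) v) k = (∏ j ∈ Finset.range n,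
      (w (k - 1 - (j : ZMod p))).xCoeff (evalAt (qpow q (k - 1 - (j : ZMod p))) t) *
        (wrap ξ (k - 1 - (j : ZMod p)) : ℂˣ)) *
        circleEquiv hq t w hw ξ v (k - n) := by
  induction n generalizing v with
  | zero => simp
  | succ n ih =>
    have h : k - ((n + 1 : ℕ) : ZMod p) = k - n - 1 := by push_cast; ring
    rw [pow_succ, Module.End.mul_apply, ih, circleEquiv_opX, Finset.prod_range_succ, h,
      sub_right_comm k 1]
    ring

theorem circleEquiv_pow_opY (v : (circleModule hq t w hw ξ).carrier) (n : ℕ) (k : ZMod p) :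
    circleEquiv hq t w hw ξ ((WMod.opY _ ^ n) v) k = (∏ j ∈ Finset.range n,
      (w (k + (j : ZMod p))).yCoeff * ((wrap ξ (k + (j : ZMod p)))⁻¹ : ℂˣ)) *
        circleEquiv hq t w hw ξ v (k + n) := by
  induction n generalizing v with
  | zero => simp
  | succ n ih =>
    rw [pow_succ, Module.End.mul_apply, ih, circleEquiv_opY, Finset.prod_range_succ]
    push_cast
    rw [add_assoc]
    ring

/-- After `p` steps every basis vector returns to its line, and each step around the circle has been
taken exactly once, wherever the walk began. Hence `X^p` is a scalar, the monodromy, and all its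
traces are powers of this scalar. -/
theorem circle_pow_opX_card : (circleModule hq t w hw ξ).opX ^ p =
    ((ξ : ℂ) * ∏ k, (w k).xCoeff (evalAt (qpow q k) t)) • 1 := by
  refine LinearMap.ext fun v => (circleEquiv hq t w hw ξ).injective (funext fun k => ?_)
  have h : ∏ j, (w (k - 1 - j)).xCoeff (evalAt (qpow q (k - 1 - j)) t) *
      ((wrap ξ (k - 1 - j) : ℂˣ) : ℂ) =
        ∏ j, (w j).xCoeff (evalAt (qpow q j) t) * ((wrap ξ j : ℂˣ) : ℂ) :=
    Equiv.prod_comp (Equiv.subLeft (k - 1))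
      (fun j => (w j).xCoeff (evalAt (qpow q j) t) * ((wrap ξ j : ℂˣ) : ℂ))
  rw [circleEquiv_pow_opX, prod_range_zmod (fun j => (w (k - 1 - j)).xCoeff
    (evalAt (qpow q (k - 1 - j)) t) * (wrap ξ (k - 1 - j) : ℂˣ)), h, Finset.prod_mul_distrib,
    ← Units.coe_prod, prod_wrap,
    LinearMap.smul_apply, map_smul, Pi.smul_apply, smul_eq_mul, Module.End.one_apply,
    ZMod.natCast_self, sub_zero, mul_comm (ξ : ℂ)]

theorem circle_pow_opY_card : (circleModule hq t w hw ξ).opY ^ p =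
    (((ξ⁻¹ : ℂˣ) : ℂ) * ∏ k, (w k).yCoeff) • 1 := by
  refine LinearMap.ext fun v => (circleEquiv hq t w hw ξ).injective (funext fun k => ?_)
  have h : ∏ j, (w (k + j)).yCoeff * (((wrap ξ (k + j))⁻¹ : ℂˣ) : ℂ) =
      ∏ j, (w j).yCoeff * (((wrap ξ j)⁻¹ : ℂˣ) : ℂ) :=
    Equiv.prod_comp (Equiv.addLeft k) (fun j => (w j).yCoeff * (((wrap ξ j)⁻¹ : ℂˣ) : ℂ))
  rw [circleEquiv_pow_opY, prod_range_zmod (fun j => (w (k + j)).yCoeff *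
    ((wrap ξ (k + j))⁻¹ : ℂˣ)), h,
    Finset.prod_mul_distrib, ← Units.coe_prod, Finset.prod_inv_distrib, prod_wrap,
    LinearMap.smul_apply, map_smul, Pi.smul_apply, smul_eq_mul, Module.End.one_apply,
    ZMod.natCast_self, add_zero, mul_comm ((ξ⁻¹ : ℂˣ) : ℂ)]

theorem char_dim_circle (k : ZMod p) : (circleModule hq t w hw ξ).char (.dim k) = 1 := by
  rw [circleModule, char_dim_ofAction]
  simp

theorem trace_weightIdem_circle (c : ℂ) :
    LinearMap.trace ℂ _ ((circleModule hq t w hw ξ).opSMul (weightIdem q (0 : ZMod p)) ∘ₗ (c • 1)) =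
      c := by
  have h : LinearMap.trace ℂ _
      ((circleModule hq t w hw ξ).opSMul (weightIdem q (0 : ZMod p))) = 1 :=
    char_dim_circle (hq := hq) (t := t) (w := w) (hw := hw) (ξ := ξ) 0
  rw [LinearMap.comp_smul, map_smul, Module.End.one_eq_id, LinearMap.comp_id, h, smul_eq_mul,
    mul_one]

theorem char_x_circle (n : ℕ) : (circleModule hq t w hw ξ).char (.x n) =
    ((ξ : ℂ) * ∏ k, (w k).xCoeff (evalAt (qpow q k) t)) ^ (n + 1) := by
  rw [WMod.char, WMod.charOp, pow_mul, circle_pow_opX_card, smul_pow, one_pow,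
    trace_weightIdem_circle]

theorem char_y_circle (n : ℕ) : (circleModule hq t w hw ξ).char (.y n) =
    (((ξ⁻¹ : ℂˣ) : ℂ) * ∏ k, (w k).yCoeff) ^ (n + 1) := by
  rw [WMod.char, WMod.charOp, pow_mul, circle_pow_opY_card, smul_pow, one_pow,
    trace_weightIdem_circle]

end Circle

/-! ### Characters of interval modules -/

section Interval

variable {p : ℕ} [NeZero p] {q : ℂˣ} {hq : IsPrimitiveRoot q p} {t : LaurentPolynomial ℂ}
  {i : ZMod p} {ℓ : ℕ} {hi : evalAt (qpow q i) t = 0}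
  {hj : evalAt (qpow q (i + 1 + (ℓ : ZMod p))) t = 0}
  {hk : ∀ m < ℓ, evalAt (qpow q (i + 1 + (m : ZMod p))) t ≠ 0}

/-- The coordinates on the interval module. -/
abbrev intervalEquiv (hq : IsPrimitiveRoot q p) (t : LaurentPolynomial ℂ) (i : ZMod p) (ℓ : ℕ)
    (hi : evalAt (qpow q i) t = 0) (hj : evalAt (qpow q (i + 1 + (ℓ : ZMod p))) t = 0)
    (hk : ∀ m < ℓ, evalAt (qpow q (i + 1 + (m : ZMod p))) t ≠ 0) :
    (intervalModule hq t i ℓ hi hj hk).carrier ≃ₗ[ℂ] (Fin (ℓ + 1) → ℂ) :=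
  diagEquiv (intervalAction hq t i ℓ hi hj) DiagModule.finite (DiagModule.iSup_weightSpace hq)

theorem intervalEquiv_opX (v : (intervalModule hq t i ℓ hi hj hk).carrier) :
    intervalEquiv hq t i ℓ hi hj hk (WMod.opX _ v) = Fin.cons (α := fun _ => ℂ) 0 fun m : Fin ℓ =>
      evalAt (qpow q (intervalWeight i ℓ m.castSucc)) t *
        intervalEquiv hq t i ℓ hi hj hk v m.castSucc :=
  diagEquiv_opX (intervalAction hq t i ℓ hi hj) _ _ v

theorem intervalEquiv_opY (v : (intervalModule hq t i ℓ hi hj hk).carrier) :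
    intervalEquiv hq t i ℓ hi hj hk (WMod.opY _ v) = Fin.snoc (α := fun _ => ℂ) (fun m : Fin ℓ =>
      intervalEquiv hq t i ℓ hi hj hk v m.succ) 0 :=
  diagEquiv_opY (intervalAction hq t i ℓ hi hj) _ _ v

/-- `X` moves the coordinates one place up and nothing enters at the lower end, so `n` applications
clear the first `n` coordinates. -/
theorem intervalEquiv_pow_opX_eq_zero (v : (intervalModule hq t i ℓ hi hj hk).carrier) (n : ℕ)
    (m : Fin (ℓ + 1)) (hm : (m : ℕ) < n) :
    intervalEquiv hq t i ℓ hi hj hk ((WMod.opX _ ^ n) v) m = 0 := by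
  induction n generalizing m with
  | zero => omega
  | succ n ih =>
    rw [pow_succ', Module.End.mul_apply, intervalEquiv_opX]
    refine Fin.cases (fun _ => ?_) (fun m hm => ?_) m hm
    · rw [Fin.cons_zero]
    · rw [Fin.cons_succ, ih _ (by simpa using hm), mul_zero]

theorem intervalEquiv_pow_opY_eq_zero (v : (intervalModule hq t i ℓ hi hj hk).carrier) (n : ℕ)
    (m : Fin (ℓ + 1)) (hm : ℓ < m + n) :
    intervalEquiv hq t i ℓ hi hj hk ((WMod.opY _ ^ n) v) m = 0 := by
  induction n generalizing m with
  | zero => omega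
  | succ n ih =>
    rw [pow_succ', Module.End.mul_apply, intervalEquiv_opY]
    refine Fin.lastCases (fun _ => ?_) (fun m hm => ?_) m hm
    · rw [Fin.snoc_last]
    · rw [Fin.snoc_castSucc, ih _ (by simp at hm ⊢; omega)]

theorem interval_pow_opX_eq_zero {n : ℕ} (hn : ℓ < n) :
    (intervalModule hq t i ℓ hi hj hk).opX ^ n = 0 :=
  LinearMap.ext fun v => (intervalEquiv hq t i ℓ hi hj hk).injective (funext fun m => by
    rw [intervalEquiv_pow_opX_eq_zero v n m (by omega), LinearMap.zero_apply, map_zero]; rfl)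

theorem interval_pow_opY_eq_zero {n : ℕ} (hn : ℓ < n) :
    (intervalModule hq t i ℓ hi hj hk).opY ^ n = 0 :=
  LinearMap.ext fun v => (intervalEquiv hq t i ℓ hi hj hk).injective (funext fun m => by
    rw [intervalEquiv_pow_opY_eq_zero v n m (by omega), LinearMap.zero_apply, map_zero]; rfl)

/-- There are `ℓ + 1 ≤ p` basis vectors, so already `X^p` vanishes and no walk closes up. -/
theorem char_x_interval (hℓ : ℓ < p) (n : ℕ) :
    (intervalModule hq t i ℓ hi hj hk).char (.x n) = 0 := by
  rw [WMod.char, WMod.charOp, interval_pow_opX_eq_zero (by nlinarith), LinearMap.comp_zero,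
    map_zero]

theorem char_y_interval (hℓ : ℓ < p) (n : ℕ) :
    (intervalModule hq t i ℓ hi hj hk).char (.y n) = 0 := by
  rw [WMod.char, WMod.charOp, interval_pow_opY_eq_zero (by nlinarith), LinearMap.comp_zero,
    map_zero]

/-- For `ℓ < p` each weight occurs at most once, and the basis vector of weight `k` can only be the
one at distance `cycDist (i + 1) k` from the lower end. -/
theorem char_dim_interval (hℓ : ℓ < p) (k : ZMod p) :
    (intervalModule hq t i ℓ hi hj hk).char (.dim k) = if cycDist (i + 1) k ≤ ℓ then 1 else 0 := by
  rw [intervalModule, char_dim_ofAction]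
  have key : ∀ m : Fin (ℓ + 1), intervalWeight i ℓ m = k ↔ (m : ℕ) = cycDist (i + 1) k := by
    intro m
    rw [intervalWeight, cycDist]
    constructor
    · intro h
      rw [← h, add_sub_cancel_left, ZMod.val_natCast, Nat.mod_eq_of_lt (by omega)]
    · intro h
      rw [h, ZMod.natCast_zmod_val, add_sub_cancel]
  simp only [key]
  split_ifs with h
  · rw [Finset.sum_eq_single ⟨cycDist (i + 1) k, by omega⟩]
    · simp
    · intro m _ hm
      rw [if_neg]
      exact fun h' => hm (Fin.ext h')
    · exact fun h => absurd (Finset.mem_univ _) h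
  · refine Finset.sum_eq_zero fun m _ => ?_
    rw [if_neg]
    omega

end Interval

/-! ### Composition factors of weight modules -/

namespace WMod

variable {p : ℕ} [NeZero p] {q : ℂˣ} {hq : IsPrimitiveRoot q p} {t : LaurentPolynomial ℂ}

theorem weightIdem_smul_of_mem_wt {V : WMod (unitOrbit hq) t} {k : ZMod p} {v : V.carrier}
    (hv : v ∈ V.wt k) (l : ZMod p) : weightIdem q l • v = if k = l then v else 0 := by
  rw [smul_of_mem_wt hv, evalAt_weightIdem hq]
  split_ifs
  · rw [one_smul]
  · rw [zero_smul]

theorem smul_complex_smul_comm {V : WMod (unitOrbit hq) t} (f : LaurentPolynomial ℂ) (c : ℂ)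
    (v : V.carrier) : f • c • v = c • f • v := (V.opSMul f).map_smul c v

/-- Nonzero vectors of distinct weights are linearly independent. -/
theorem linearIndependent_of_mem_wt {V : WMod (unitOrbit hq) t} {ι : Type*} [Fintype ι]
    {κ : ι → ZMod p} (hκ : Function.Injective κ) {v : ι → V.carrier} (hv : ∀ i, v i ∈ V.wt (κ i))
    (h0 : ∀ i, v i ≠ 0) : LinearIndependent ℂ v := by
  rw [Fintype.linearIndependent_iff]
  intro g hg i
  have h := congrArg (fun x => weightIdem q (κ i) • x) hg
  simp only [Finset.smul_sum, smul_zero] at h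
  rw [Finset.sum_eq_single i] at h
  · rw [smul_complex_smul_comm, weightIdem_smul_of_mem_wt (hv i), if_pos rfl] at h
    exact (smul_eq_zero.mp h).resolve_right (h0 i)
  · intro j _ hj
    rw [smul_complex_smul_comm, weightIdem_smul_of_mem_wt (hv j), if_neg (fun e => hj (hκ e)),
      smul_zero]
  · exact fun h => absurd (Finset.mem_univ _) h

/-- The quotient by a submodule. -/
def quotient (V : WMod (unitOrbit hq) t) (N : Submodule (GWA (qShift q) t) V.carrier) :
    WMod (unitOrbit hq) t where
  carrier := V.carrier ⧸ N
  isWeight := by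
    let _ : Module (LaurentPolynomial ℂ) (V.carrier ⧸ N) :=
      Module.compHom (V.carrier ⧸ N) (GWA.ofR (qShift q) t)
    let π : V.carrier →ₗ[LaurentPolynomial ℂ] (V.carrier ⧸ N) :=
      { toFun := N.mkQ
        map_add' := map_add _
        map_smul' := fun f v => map_smul N.mkQ (GWA.ofR (qShift q) t f) v }
    have := V.isWeightModule.moduleFinite (unitOrbit hq).carrier_finite
    have : Module.Finite (LaurentPolynomial ℂ) (V.carrier ⧸ N) :=
      Module.Finite.of_surjective π N.mkQ_surjective
    refine IsWeightModule.of_iSup _ (iSup_weightSpace_eq_top hq fun f hf v => ?_)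
    obtain ⟨v, rfl⟩ := N.mkQ_surjective v
    exact ((π.map_smul f v).symm.trans (congrArg π
      (V.smul_eq_zero_of_mem_ideal (mem_unitOrbit_ideal hq hf) v))).trans (map_zero π)

/-- The projection to the quotient. -/
def quotientMk (V : WMod (unitOrbit hq) t) (N : Submodule (GWA (qShift q) t) V.carrier) :
    V.carrier →ₗ[GWA (qShift q) t] (V.quotient N).carrier := N.mkQ

theorem quotientMk_surjective (V : WMod (unitOrbit hq) t)
    (N : Submodule (GWA (qShift q) t) V.carrier) : Function.Surjective (V.quotientMk N) :=
  N.mkQ_surjective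

theorem finrank_quotient_lt (V : WMod (unitOrbit hq) t)
    {N : Submodule (GWA (qShift q) t) V.carrier} (hN : N ≠ ⊥) :
    Module.finrank ℂ (V.quotient N).carrier < Module.finrank ℂ V.carrier := by
  have h := LinearMap.finrank_range_add_finrank_ker (homC (V.quotientMk N))
  have hr : LinearMap.range (homC (V.quotientMk N)) = ⊤ :=
    LinearMap.range_eq_top.mpr (V.quotientMk_surjective N)
  rw [hr, finrank_top] at h
  have hk : 0 < Module.finrank ℂ (LinearMap.ker (homC (V.quotientMk N))) := by
    obtain ⟨v, hv, hv0⟩ := N.ne_bot_iff.mp hN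
    have hv' : v ∈ LinearMap.ker (homC (V.quotientMk N)) :=
      (Submodule.Quotient.mk_eq_zero N).mpr hv
    have : Nontrivial (LinearMap.ker (homC (V.quotientMk N))) :=
      ⟨⟨v, hv'⟩, 0, fun e => hv0 (congrArg Subtype.val e)⟩
    exact Module.finrank_pos
  omega

section circle

variable {w : ZMod p → Letter} {hw : ∀ k, w k = .one ↔ evalAt (qpow q k) t ≠ 0} {ξ : ℂˣ}

/-- A morphism from a circle module is given by the images of the basis vectors. -/
theorem exists_hom_circleModule {V : WMod (unitOrbit hq) t} {v : ZMod p → V.carrier}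
    (hv : ∀ k, v k ∈ V.wt k) (h0 : ∀ k, v k ≠ 0)
    (hX : ∀ k, V.opX (v k) =
      ((w k).xCoeff (evalAt (qpow q k) t) * (wrap ξ k : ℂˣ)) • v (k + 1))
    (hY : ∀ k, V.opY (v (k + 1)) = ((w k).yCoeff * ((wrap ξ k)⁻¹ : ℂˣ)) • v k) :
    ∃ f : (circleModule hq t w hw ξ).carrier →ₗ[GWA (qShift q) t] V.carrier,
      Function.Injective f := by
  -- Injectivity costs nothing: the images of the basis vectors are nonzero and have distinct
  -- weights.
  have hli := linearIndependent_of_mem_wt Function.injective_id hv h0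
  let e := circleEquiv hq t w hw ξ
  let f : (circleModule hq t w hw ξ).carrier →ₗ[ℂ] V.carrier :=
    (Fintype.linearCombination ℂ v) ∘ₗ e.toLinearMap
  have hf : ∀ x, f x = ∑ k, e x k • v k := fun x => rfl
  refine ⟨mkHom f.toAddMonoidHom (fun r x => ?_) (fun x => ?_) (fun x => ?_), ?_⟩
  · change f (r • x) = r • f x
    rw [hf, hf, Finset.smul_sum]
    refine Finset.sum_congr rfl fun k _ => ?_
    rw [show e (r • x) k = _ * e x k from diagEquiv_smul _ _ _ r x k, smul_complex_smul_comm,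
      smul_of_mem_wt (hv k), smul_smul, mul_comm]
  · change f (opX _ x) = V.opX (f x)
    rw [hf, hf, map_sum, ← Equiv.sum_comp (Equiv.addRight (1 : ZMod p))]
    refine Finset.sum_congr rfl fun k _ => ?_
    rw [Equiv.coe_addRight, circleEquiv_opX, add_sub_cancel_right, map_smul, hX, smul_smul,
      mul_comm]
  · change f (opY _ x) = V.opY (f x)
    rw [hf, hf, map_sum, ← Equiv.sum_comp (Equiv.addRight (1 : ZMod p))
      (fun k => V.opY (e x k • v k))]
    refine Finset.sum_congr rfl fun k _ => ?_
    rw [Equiv.coe_addRight, circleEquiv_opY, map_smul, hY, smul_smul, mul_comm]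
  · change Function.Injective f
    exact (hli.fintypeLinearCombination_injective).comp e.injective

end circle

theorem intervalWeight_injective {p : ℕ} (i : ZMod p) {ℓ : ℕ} (hℓ : ℓ < p) :
    Function.Injective (intervalWeight i ℓ) := fun a b h => by
  have h' := (ZMod.natCast_eq_natCast_iff' a b p).mp (add_left_cancel h)
  rw [Nat.mod_eq_of_lt (by omega), Nat.mod_eq_of_lt (by omega)] at h'
  exact Fin.ext h'

/-- A morphism from an interval module is given by the images of the basis vectors. -/
theorem exists_hom_intervalModule {i : ZMod p} {ℓ : ℕ} (hℓ : ℓ < p)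
    (hi : evalAt (qpow q i) t = 0) (hj : evalAt (qpow q (i + 1 + (ℓ : ZMod p))) t = 0)
    (hk : ∀ m < ℓ, evalAt (qpow q (i + 1 + (m : ZMod p))) t ≠ 0)
    {V : WMod (unitOrbit hq) t} {v : Fin (ℓ + 1) → V.carrier}
    (hv : ∀ m, v m ∈ V.wt (intervalWeight i ℓ m)) (h0 : ∀ m, v m ≠ 0)
    (hX : ∀ m : Fin ℓ, V.opX (v m.castSucc) =
      evalAt (qpow q (intervalWeight i ℓ m.castSucc)) t • v m.succ)
    (hX' : V.opX (v (Fin.last ℓ)) = 0)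
    (hY : ∀ m : Fin ℓ, V.opY (v m.succ) = v m.castSucc) (hY' : V.opY (v 0) = 0) :
    ∃ f : (intervalModule hq t i ℓ hi hj hk).carrier →ₗ[GWA (qShift q) t] V.carrier,
      Function.Injective f := by
  have hli := linearIndependent_of_mem_wt (intervalWeight_injective i hℓ) hv h0
  let e := intervalEquiv hq t i ℓ hi hj hk
  let f : (intervalModule hq t i ℓ hi hj hk).carrier →ₗ[ℂ] V.carrier :=
    (Fintype.linearCombination ℂ v) ∘ₗ e.toLinearMap
  have hf : ∀ x, f x = ∑ k, e x k • v k := fun x => rfl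
  refine ⟨mkHom f.toAddMonoidHom (fun r x => ?_) (fun x => ?_) (fun x => ?_), ?_⟩
  · change f (r • x) = r • f x
    rw [hf, hf, Finset.smul_sum]
    refine Finset.sum_congr rfl fun k _ => ?_
    rw [show e (r • x) k = _ * e x k from diagEquiv_smul _ _ _ r x k, smul_complex_smul_comm,
      smul_of_mem_wt (hv k), smul_smul, mul_comm]
  · change f (opX _ x) = V.opX (f x)
    rw [hf, hf, map_sum, Fin.sum_univ_succ, Fin.sum_univ_castSucc, intervalEquiv_opX,
      Fin.cons_zero, zero_smul, zero_add, map_smul, hX', smul_zero, add_zero]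
    refine Finset.sum_congr rfl fun k _ => ?_
    rw [Fin.cons_succ, map_smul, hX, smul_smul, mul_comm]
  · change f (opY _ x) = V.opY (f x)
    rw [hf, hf, map_sum, Fin.sum_univ_castSucc, Fin.sum_univ_succ, intervalEquiv_opY,
      Fin.snoc_last, zero_smul, add_zero, map_smul, hY', smul_zero, zero_add]
    refine Finset.sum_congr rfl fun k _ => ?_
    rw [Fin.snoc_castSucc, map_smul, hY]
  · change Function.Injective f
    exact (hli.fintypeLinearCombination_injective).comp e.injective

/-- The modules that occur as composition factors: the interval modules between consecutive
breaks, and the circle modules of words in `1`, `x` or in `1`, `y`. -/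
inductive IsBasic {hq : IsPrimitiveRoot q p} {t : LaurentPolynomial ℂ} :
    WMod (unitOrbit hq) t → Prop
  | interval (i : ZMod p) (ℓ : ℕ) (hℓ : ℓ < p) (hi) (hj) (hk) :
      IsBasic (intervalModule hq t i ℓ hi hj hk)
  | circleX (w : ZMod p → Letter) (hw) (ξ : ℂˣ) (h : ∀ k, w k = .one ∨ w k = .x) :
      IsBasic (circleModule hq t w hw ξ)
  | circleY (w : ZMod p → Letter) (hw) (ξ : ℂˣ) (h : ∀ k, w k = .one ∨ w k = .y)
      (h' : ∃ k, w k = .y) : IsBasic (circleModule hq t w hw ξ)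

theorem exists_eigenvector_of_mapsTo {E : Type*} [AddCommGroup E] [Module ℂ E]
    [Module.Finite ℂ E] (f : E →ₗ[ℂ] E) {U : Submodule ℂ E} (hU : U ≠ ⊥)
    (hf : ∀ v ∈ U, f v ∈ U) : ∃ v ∈ U, v ≠ 0 ∧ ∃ c : ℂ, f v = c • v := by
  have : Nontrivial U := Submodule.nontrivial_iff_ne_bot.mpr hU
  obtain ⟨c, hc⟩ := Module.End.exists_eigenvalue (f.restrict hf)
  obtain ⟨v, hv⟩ := hc.exists_hasEigenvector
  refine ⟨v, v.2, fun h => hv.2 (Subtype.ext h), c, ?_⟩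
  exact congrArg Subtype.val hv.apply_eq_smul

/-- Representatives are compatible with one step around the circle except at the wrap, where the
value is `p` instead of `0`. In the constructions of circle submodules the monodromy enters at
exactly this place. -/
theorem val_sub_one_add_one (a : ZMod p) : (a - 1).val + 1 = if a = 0 then p else a.val := by
  have hlt := ZMod.val_lt (a - 1)
  have h : a = (((a - 1).val + 1 : ℕ) : ZMod p) := by
    push_cast
    rw [ZMod.natCast_zmod_val, sub_add_cancel]
  by_cases hp : (a - 1).val + 1 = p
  · rw [if_pos, hp]
    rw [h, hp, ZMod.natCast_self]
  · have h2 : a.val = (a - 1).val + 1 := by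
      conv_lhs => rw [h]
      rw [ZMod.val_natCast, Nat.mod_eq_of_lt (by omega)]
    rw [if_neg, h2]
    rintro rfl
    rw [ZMod.val_zero] at h2
    omega

variable {V : WMod (unitOrbit hq) t}

/-- Among all pairs of a vector as described and an exponent `s`, take one with `s` minimal. The
vectors `v, Y v, …, Y^(s-1) v` are then a basis of an interval module, because minimality excludes
breaks in between. -/
theorem exists_interval_sub (h : ∃ (s : ℕ) (k : ZMod p) (v : V.carrier), v ≠ 0 ∧ v ∈ V.wt k ∧
    evalAt (qpow q k) t = 0 ∧ V.opX v = 0 ∧ (V.opY ^ s) v = 0) :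
    ∃ (S : WMod (unitOrbit hq) t) (f : S.carrier →ₗ[GWA (qShift q) t] V.carrier),
      IsBasic S ∧ Function.Injective f := by
  classical
  obtain ⟨k, v, hv0, hv, hk, hXv, hYv⟩ := Nat.find_spec h
  have hmin := fun m (hm : m < Nat.find h) => Nat.find_min h hm
  -- The minimal exponent is positive, since `Y^0 v = v` is not zero.
  obtain ⟨ℓ, hℓ⟩ : ∃ ℓ, Nat.find h = ℓ + 1 := by
    refine Nat.exists_eq_succ_of_ne_zero fun h0 => hv0 ?_
    rwa [h0] at hYv
  rw [hℓ] at hYv hmin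
  have hne : ∀ m ≤ ℓ, (V.opY ^ m) v ≠ 0 := fun m hm h0 =>
    hmin m (by omega) ⟨k, v, hv0, hv, hk, hXv, h0⟩
  obtain ⟨i, hi⟩ : ∃ i : ZMod p, i + 1 + (ℓ : ZMod p) = k := ⟨k - ℓ - 1, by ring⟩
  have hwt : ∀ m ≤ ℓ, (V.opY ^ (ℓ - m)) v ∈ V.wt (i + 1 + (m : ZMod p)) := fun m hm => by
    have := pow_opY_mem_wt hv (ℓ - m)
    rwa [← hi, Nat.cast_sub hm, add_sub_assoc, sub_sub_cancel] at this
  have hstep : ∀ m < ℓ, V.opY ((V.opY ^ (ℓ - (m + 1))) v) = (V.opY ^ (ℓ - m)) v := fun m hm => by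
    rw [← Module.End.mul_apply, ← pow_succ']
    congr 2
    omega
  have hXstep : ∀ m < ℓ, V.opX ((V.opY ^ (ℓ - m)) v) =
      evalAt (qpow q (i + 1 + (m : ZMod p))) t • (V.opY ^ (ℓ - (m + 1))) v := fun m hm => by
    rw [← hstep m hm]
    refine opX_opY_of_mem_wt ?_
    have := hwt (m + 1) hm
    push_cast at this
    rwa [← add_assoc] at this
  -- The last vector `Y^ℓ v` has weight `i + 1` and is killed by `Y`, while `X Y` acts on it by the
  -- scalar `t(q^i)`.
  have hi0 : evalAt (qpow q i) t = 0 := by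
    have h1 : (V.opY ^ ℓ) v ∈ V.wt (i + 1) := by simpa using hwt 0 (Nat.zero_le _)
    have h2 := opX_opY_of_mem_wt h1
    rw [← Module.End.mul_apply V.opY, ← pow_succ', hYv, map_zero] at h2
    exact (smul_eq_zero.mp h2.symm).resolve_right (hne ℓ le_rfl)
  have hj0 : evalAt (qpow q (i + 1 + (ℓ : ZMod p))) t = 0 := by rw [hi, hk]
  -- At a break in between, `Y^(ℓ-m) v` would be killed by `X` and by `Y^(m+1)`, contradicting
  -- minimality since `m + 1 < ℓ + 1`.
  have hk0 : ∀ m < ℓ, evalAt (qpow q (i + 1 + (m : ZMod p))) t ≠ 0 := fun m hm h0 => by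
    refine hmin (m + 1) (by omega) ⟨_, _, hne (ℓ - m) (by omega), hwt m hm.le, h0, ?_, ?_⟩
    · rw [hXstep m hm, h0, zero_smul]
    · rw [← Module.End.mul_apply, ← pow_add]
      rw [show m + 1 + (ℓ - m) = ℓ + 1 by omega, hYv]
  -- A longer string would meet the weight `k` a second time, at `m = ℓ - p`, and this weight is a
  -- break.
  have hℓp : ℓ < p := by
    by_contra hlt
    refine hk0 (ℓ - p) (by have := NeZero.pos p; omega) ?_
    rw [Nat.cast_sub (by omega), ZMod.natCast_self, sub_zero, hj0]
  obtain ⟨f, hf⟩ := exists_hom_intervalModule (V := V)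
    (v := fun m : Fin (ℓ + 1) => (V.opY ^ (ℓ - (m : ℕ))) v) hℓp hi0 hj0 hk0
    (fun m => hwt m (by omega)) (fun m => hne _ (by omega)) (fun m => hXstep m m.2)
    (by simpa using hXv) (fun m => hstep m m.2)
    (by
      change V.opY ((V.opY ^ ℓ) v) = 0
      rw [← Module.End.mul_apply, ← pow_succ', hYv])
  exact ⟨_, f, .interval i ℓ hℓp _ _ _, hf⟩

/-- At a break `k` the product `X Y` vanishes on vectors of weight `k + 1`, so `Y^p` preserves the
vectors of weight `k` killed by `X`. An eigenvector there has nonzero eigenvalue by `hA`, and its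
images under powers of `Y` fill a circle with the letter `y` at the breaks. -/
theorem exists_circleY_sub
    (hA : ¬ ∃ (s : ℕ) (k : ZMod p) (v : V.carrier), v ≠ 0 ∧ v ∈ V.wt k ∧
      evalAt (qpow q k) t = 0 ∧ V.opX v = 0 ∧ (V.opY ^ s) v = 0)
    (hB : ∃ (k : ZMod p) (v : V.carrier), v ≠ 0 ∧ v ∈ V.wt k ∧
      evalAt (qpow q k) t = 0 ∧ V.opX v = 0) :
    ∃ (S : WMod (unitOrbit hq) t) (f : S.carrier →ₗ[GWA (qShift q) t] V.carrier),
      IsBasic S ∧ Function.Injective f := by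
  classical
  obtain ⟨k, v₀, hv₀, hv₀k, hk, hXv₀⟩ := hB
  have hp := NeZero.pos p
  obtain ⟨v, ⟨hvk, hXv⟩, hv, c, hc⟩ := exists_eigenvector_of_mapsTo (V.opY ^ p)
    (U := V.wt k ⊓ LinearMap.ker V.opX) (fun h => hv₀ (by
      have : v₀ ∈ V.wt k ⊓ LinearMap.ker V.opX := ⟨hv₀k, hXv₀⟩
      rwa [h] at this)) (by
      rintro v ⟨hv, _⟩
      refine ⟨?_, ?_⟩
      · have := pow_opY_mem_wt hv p
        rwa [ZMod.natCast_self, sub_zero] at this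
      · change V.opX ((V.opY ^ p) v) = 0
        have h3 : (V.opY ^ p) v = V.opY ((V.opY ^ (p - 1)) v) := by
          rw [← Module.End.mul_apply, ← pow_succ', Nat.sub_add_cancel hp]
        have h1 := pow_opY_mem_wt hv (p - 1)
        rw [Nat.cast_sub hp, ZMod.natCast_self, zero_sub, Nat.cast_one, sub_neg_eq_add] at h1
        rw [h3, opX_opY_of_mem_wt h1, hk, zero_smul])
  have hXv' : V.opX v = 0 := hXv
  have hne : ∀ s, (V.opY ^ s) v ≠ 0 := fun s h => hA ⟨s, k, v, hv, hvk, hk, hXv', h⟩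
  have hc0 : c ≠ 0 := by
    rintro rfl
    rw [zero_smul] at hc
    exact hne p hc
  let w : ZMod p → Letter := fun m => if evalAt (qpow q m) t = 0 then .y else .one
  have hw : ∀ m, w m = .one ↔ evalAt (qpow q m) t ≠ 0 := fun m => by
    by_cases h : evalAt (qpow q m) t = 0 <;> simp [w, h]
  have hx : ∀ m, (w m).xCoeff (evalAt (qpow q m) t) = evalAt (qpow q m) t := fun m => by
    by_cases h : evalAt (qpow q m) t = 0 <;> simp [w, h, Letter.xCoeff]
  have hy : ∀ m, (w m).yCoeff = 1 := fun m => by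
    by_cases h : evalAt (qpow q m) t = 0 <;> simp [w, h, Letter.yCoeff]
  -- All coefficients of `Y` other than the wrap are `1`, so the monodromy of `Y` on the circle
  -- module is `ξ⁻¹`; it has to be `c`.
  let ξ : ℂˣ := (Units.mk0 c hc0)⁻¹
  -- Going down `k.val` steps reaches weight `0`, and `(-m).val` further steps reach weight `m`.
  -- Counting from weight `0` puts the wrap at the step from `1` to `0`, as `wrap` requires.
  let u : ZMod p → V.carrier := fun m => (V.opY ^ ((-m).val + k.val)) v
  have hu : ∀ m, u m ∈ V.wt m := fun m => by
    have := pow_opY_mem_wt hvk ((-m).val + k.val)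
    rw [Nat.cast_add, ZMod.natCast_zmod_val, ZMod.natCast_zmod_val] at this
    rwa [show k - (-m + k) = m by ring] at this
  have hY : ∀ m, V.opY (u (m + 1)) = ((w m).yCoeff * ((wrap ξ m)⁻¹ : ℂˣ)) • u m := fun m => by
    have hval := val_sub_one_add_one (-m)
    rw [show -m - 1 = -(m + 1) by ring] at hval
    have h1 : V.opY (u (m + 1)) = (V.opY ^ ((-(m + 1)).val + 1 + k.val)) v := by
      rw [← Module.End.mul_apply, ← pow_succ']
      congr 2
      omega
    rw [h1, hval, hy, one_mul]
    by_cases hm : m = 0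
    · subst hm
      rw [neg_zero, if_pos rfl, wrap, if_pos rfl, add_comm, pow_add, Module.End.mul_apply, hc,
        map_smul]
      simp [u, ξ]
    · rw [if_neg (neg_ne_zero.mpr hm), wrap, if_neg hm, inv_one, Units.val_one, one_smul]
  -- Every `u m` is a nonzero multiple of some `Y u (m + 1)`, so `X Y = σ(t)` determines `X`: its
  -- coefficient is `t(q^m)` for both letters, and this is zero at the breaks.
  have hX : ∀ m, V.opX (u m) =
      ((w m).xCoeff (evalAt (qpow q m) t) * (wrap ξ m : ℂˣ)) • u (m + 1) := fun m => by
    have h1 := hY m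
    rw [hy, one_mul] at h1
    have h2 : u m = ((wrap ξ m : ℂˣ) : ℂ) • V.opY (u (m + 1)) := by
      rw [h1, smul_smul, Units.mul_inv, one_smul]
    rw [h2, map_smul, opX_opY_of_mem_wt (hu (m + 1)), hx, smul_smul, mul_comm]
  obtain ⟨f, hf⟩ := exists_hom_circleModule (hw := hw) hu (fun m => hne _) hX hY
  refine ⟨_, f, .circleY w hw ξ (fun m => ?_) ⟨k, if_pos hk⟩, hf⟩
  by_cases h : evalAt (qpow q m) t = 0 <;> simp [w, h]

/-- `X` is injective on every weight space: at breaks by hypothesis, elsewhere because `Y X` is a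
nonzero scalar. An eigenvector of `X^p` of weight `0` therefore has nonzero eigenvalue, and its
images under `X` fill a circle with the letter `x` at the breaks. -/
theorem exists_circleX_sub [Nontrivial V.carrier]
    (hB : ¬ ∃ (k : ZMod p) (v : V.carrier), v ≠ 0 ∧ v ∈ V.wt k ∧
      evalAt (qpow q k) t = 0 ∧ V.opX v = 0) :
    ∃ (S : WMod (unitOrbit hq) t) (f : S.carrier →ₗ[GWA (qShift q) t] V.carrier),
      IsBasic S ∧ Function.Injective f := by
  classical
  have hp := NeZero.pos p
  have hinj : ∀ (k : ZMod p) (v : V.carrier), v ∈ V.wt k → V.opX v = 0 → v = 0 := by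
    intro k v hv hXv
    by_contra h0
    by_cases hk : evalAt (qpow q k) t = 0
    · exact hB ⟨k, v, h0, hv, hk, hXv⟩
    · have := opY_opX_of_mem_wt hv
      rw [hXv, map_zero] at this
      exact (smul_ne_zero hk h0) this.symm
  have hpow : ∀ (k : ZMod p) (v : V.carrier), v ∈ V.wt k → v ≠ 0 → ∀ n, (V.opX ^ n) v ≠ 0 := by
    intro k v hv h0 n
    induction n with
    | zero => simpa using h0
    | succ n ih =>
      rw [pow_succ', Module.End.mul_apply]
      exact fun h => ih (hinj _ _ (pow_opX_mem_wt hv n) h)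
  obtain ⟨v₀, hv₀⟩ := exists_ne (0 : V.carrier)
  obtain ⟨k, hk⟩ : ∃ k : ZMod p, weightIdem q k • v₀ ≠ 0 := by
    by_contra! h
    apply hv₀
    rw [← V.sum_weightIdem_smul v₀]
    exact Finset.sum_eq_zero fun k _ => h k
  have hwt0 : V.wt 0 ≠ ⊥ := by
    refine (Submodule.ne_bot_iff _).mpr ⟨(V.opX ^ (-k).val) (weightIdem q k • v₀), ?_,
      hpow k _ (weightIdem_smul_mem_wt k v₀) hk _⟩
    have := pow_opX_mem_wt (weightIdem_smul_mem_wt (V := V) k v₀) (-k).val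
    rwa [ZMod.natCast_zmod_val, add_neg_cancel] at this
  obtain ⟨v, hv, hvne, η, hη⟩ := exists_eigenvector_of_mapsTo (V.opX ^ p) hwt0 (fun v hv => by
    have := pow_opX_mem_wt hv p
    rwa [ZMod.natCast_self, add_zero] at this)
  have hη0 : η ≠ 0 := by
    rintro rfl
    rw [zero_smul] at hη
    exact hpow 0 v hv hvne p hη
  let w : ZMod p → Letter := fun m => if evalAt (qpow q m) t = 0 then .x else .one
  have hw : ∀ m, w m = .one ↔ evalAt (qpow q m) t ≠ 0 := fun m => by
    by_cases h : evalAt (qpow q m) t = 0 <;> simp [w, h]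
  let c : ZMod p → ℂ := fun m => (w m).xCoeff (evalAt (qpow q m) t)
  have hc : ∀ m, c m ≠ 0 := fun m => by
    by_cases h : evalAt (qpow q m) t = 0 <;> simp [c, w, h, Letter.xCoeff]
  have hcp : ∏ m, c m ≠ 0 := Finset.prod_ne_zero_iff.mpr fun m _ => hc m
  -- Here the steps of `X` carry the coefficients `t(q^m)` away from the breaks. The parameter is
  -- chosen so that all steps together multiply by the eigenvalue `η`.
  let ξ : ℂˣ := Units.mk0 (η / ∏ m, c m) (div_ne_zero hη0 hcp)
  let d : ZMod p → ℂ := fun m => c m * (wrap ξ m : ℂˣ)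
  have hd : ∀ m, d m ≠ 0 := fun m => mul_ne_zero (hc m) (Units.ne_zero _)
  have hdp : ∏ m, d m = η := by
    rw [Finset.prod_mul_distrib, ← Units.coe_prod, prod_wrap, Units.val_mk0, mul_div_cancel₀ _ hcp]
  -- The normalisation divides `X^n v` by the coefficients of the `n` steps taken, so that each
  -- single step has coefficient `d m`.
  let D : ℕ → ℂ := fun n => (∏ j ∈ Finset.range n, d (j : ZMod p))⁻¹
  have hD : ∀ n, D n ≠ 0 := fun n => inv_ne_zero (Finset.prod_ne_zero_iff.mpr fun j _ => hd _)
  have hDs : ∀ n, D n = d (n : ZMod p) * D (n + 1) := fun n => by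
    simp only [D, Finset.prod_range_succ, mul_inv_rev]
    rw [← mul_assoc, mul_inv_cancel₀ (hd _), one_mul]
  let u : ZMod p → V.carrier := fun m => D m.val • (V.opX ^ m.val) v
  have hu : ∀ m, u m ∈ V.wt m := fun m => by
    have := pow_opX_mem_wt hv m.val
    rw [ZMod.natCast_zmod_val, zero_add] at this
    exact Submodule.smul_mem _ _ this
  have hu0 : ∀ m, u m ≠ 0 := fun m => smul_ne_zero (hD _) (hpow 0 v hv hvne _)
  have hX : ∀ m, V.opX (u m) = d m • u (m + 1) := fun m => by
    have hval := val_sub_one_add_one (m + 1)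
    rw [add_sub_cancel_right] at hval
    have h1 : V.opX (u m) = (d m * D (m.val + 1)) • (V.opX ^ (m.val + 1)) v := by
      change V.opX (D m.val • (V.opX ^ m.val) v) = _
      rw [map_smul, hDs, ZMod.natCast_zmod_val, ← Module.End.mul_apply, ← pow_succ']
    rw [h1, hval, mul_smul]
    congr 1
    -- At the wrap, `X^p v = η v`, and the factor `η` cancels against the `p`-th normalisation
    -- factor because `∏ d = η`.
    by_cases hm : m + 1 = 0
    · rw [if_pos hm, hm, hη, smul_smul]
      simp only [D, u]
      rw [prod_range_zmod d, hdp, inv_mul_cancel₀ hη0]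
      simp
    · rw [if_neg hm]
  -- At a break `X Y` vanishes and `X` is injective, so `Y u (m + 1) = 0`; elsewhere `Y` is
  -- determined by `Y X = t`.
  have hY : ∀ m, V.opY (u (m + 1)) = ((w m).yCoeff * ((wrap ξ m)⁻¹ : ℂˣ)) • u m := fun m => by
    by_cases hm : evalAt (qpow q m) t = 0
    · have hwm : w m = .x := if_pos hm
      rw [hwm, Letter.yCoeff, zero_mul, zero_smul]
      refine hinj m _ (opY_mem_wt (hu _)) ?_
      rw [opX_opY_of_mem_wt (hu _), hm, zero_smul]
    · have hwm : w m = .one := if_neg hm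
      have h1 : u (m + 1) = (d m)⁻¹ • V.opX (u m) := by
        rw [hX, smul_smul, inv_mul_cancel₀ (hd m), one_smul]
      rw [h1, map_smul, opY_opX_of_mem_wt (hu m), smul_smul]
      congr 1
      simp only [d, c, hwm, Letter.xCoeff, Letter.yCoeff, mul_inv_rev, one_mul,
        Units.val_inv_eq_inv_val]
      rw [mul_assoc, inv_mul_cancel₀ hm, mul_one]
  obtain ⟨f, hf⟩ := exists_hom_circleModule (hw := hw) hu hu0 hX hY
  refine ⟨_, f, .circleX w hw ξ (fun m => ?_), hf⟩
  by_cases h : evalAt (qpow q m) t = 0 <;> simp [w, h]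

/-- Every nonzero weight module has a submodule isomorphic to an interval module or to a circle
module. -/
theorem exists_basic_sub (V : WMod (unitOrbit hq) t) [Nontrivial V.carrier] :
    ∃ (S : WMod (unitOrbit hq) t) (f : S.carrier →ₗ[GWA (qShift q) t] V.carrier),
      IsBasic S ∧ Function.Injective f := by
  by_cases hA : ∃ (s : ℕ) (k : ZMod p) (v : V.carrier), v ≠ 0 ∧ v ∈ V.wt k ∧
      evalAt (qpow q k) t = 0 ∧ V.opX v = 0 ∧ (V.opY ^ s) v = 0
  · exact exists_interval_sub hA
  by_cases hB : ∃ (k : ZMod p) (v : V.carrier), v ≠ 0 ∧ v ∈ V.wt k ∧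
      evalAt (qpow q k) t = 0 ∧ V.opX v = 0
  · exact exists_circleY_sub hA hB
  · exact exists_circleX_sub hB

theorem IsBasic.nontrivial {S : WMod (unitOrbit hq) t} (h : IsBasic S) : Nontrivial S.carrier := by
  cases h with
  | interval i ℓ hℓ hi hj hk =>
    exact (intervalEquiv hq t i ℓ hi hj hk).toEquiv.nontrivial
  | circleX w hw ξ h => exact (circleEquiv hq t w hw ξ).toEquiv.nontrivial
  | circleY w hw ξ h => exact (circleEquiv hq t w hw ξ).toEquiv.nontrivial

end WMod

/-- The Grothendieck group is generated by the classes of the basic modules. -/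
theorem K0.mk_mem_of_basic {p : ℕ} [NeZero p] {q : ℂˣ} {hq : IsPrimitiveRoot q p}
    {t : LaurentPolynomial ℂ} (H : AddSubgroup (K0 (unitOrbit hq) t))
    (hH : ∀ S : WMod (unitOrbit hq) t, S.IsBasic → K0.mk S ∈ H) (V : WMod (unitOrbit hq) t) :
    K0.mk V ∈ H := by
  induction hn : Module.finrank ℂ V.carrier using Nat.strong_induction_on generalizing V with
  | _ n ih =>
    rcases subsingleton_or_nontrivial V.carrier with hV | hV
    · have h := K0.mk_eq_of_equiv (V := V) (W := K0.zeroObj (unitOrbit hq) t)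
        { toFun := fun _ => 0
          invFun := fun _ => 0
          left_inv := fun _ => Subsingleton.elim _ _
          right_inv := fun _ => Subsingleton.elim _ _
          map_add' := fun _ _ => Subsingleton.elim _ _ }
        (fun _ _ => Subsingleton.elim _ _) (fun _ => Subsingleton.elim _ _)
        (fun _ => Subsingleton.elim _ _)
      rw [h, K0.mk_zeroObj]
      exact zero_mem H
    · obtain ⟨S, f, hS, hf⟩ := V.exists_basic_sub
      have hN : LinearMap.range f ≠ ⊥ := by
        have := hS.nontrivial
        intro h
        obtain ⟨s, hs⟩ := exists_ne (0 : S.carrier)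
        refine hs (hf ?_)
        rw [map_zero]
        exact (Submodule.mem_bot _).mp (h ▸ LinearMap.mem_range_self f s)
      rw [K0.mk_eq_add f (V.quotientMk (LinearMap.range f)) hf
        (LinearMap.exact_map_mkQ_range f) (V.quotientMk_surjective _)]
      refine add_mem (hH S hS) (ih _ ?_ _ rfl)
      rw [← hn]
      exact V.finrank_quotient_lt hN

/-! ### The cyclic order -/

section Cyclic

variable {p : ℕ} [NeZero p]

theorem cycDist_lt (a b : ZMod p) : cycDist a b < p := ZMod.val_lt _

theorem cycDist_self {p : ℕ} (a : ZMod p) : cycDist a a = 0 := by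
  rw [cycDist, sub_self, ZMod.val_zero]

theorem cycDist_inj {o a b : ZMod p} : cycDist o a = cycDist o b ↔ a = b :=
  ⟨fun h => sub_left_injective (ZMod.val_injective p h), fun h => h ▸ rfl⟩

theorem cycDist_ne {o a b : ZMod p} (h : a ≠ b) : cycDist o a ≠ cycDist o b :=
  fun h' => h (cycDist_inj.mp h')

/-- Distances in terms of the distances from a base point. -/
theorem cycDist_cases (o a b : ZMod p) :
    (cycDist o a ≤ cycDist o b ∧ cycDist a b + cycDist o a = cycDist o b) ∨
      (cycDist o b < cycDist o a ∧ cycDist a b + cycDist o a = cycDist o b + p) := by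
  have h : cycDist o b = (cycDist a b + cycDist o a) % p := by
    have hb : b - o = ((cycDist a b + cycDist o a : ℕ) : ZMod p) := by
      push_cast
      rw [cycDist, cycDist, ZMod.natCast_zmod_val, ZMod.natCast_zmod_val]
      ring
    rw [cycDist, hb, ZMod.val_natCast]
  have h1 := cycDist_lt a b
  have h2 := cycDist_lt o a
  by_cases hlt : cycDist a b + cycDist o a < p
  · rw [Nat.mod_eq_of_lt hlt] at h
    omega
  · rw [Nat.mod_eq_sub_mod (by omega), Nat.mod_eq_of_lt (by omega)] at h
    omega

theorem cycDist_succ_left (i k : ZMod p) :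
    cycDist (i + 1) k + 1 = if k = i then p else cycDist i k := by
  have h := WMod.val_sub_one_add_one (k - i)
  rw [cycDist, cycDist, ← sub_sub, h]
  simp only [sub_eq_zero]

open Classical in
/-- The indicator function of the arc `i < k ≤ j`. -/
def arcInd (i j k : ZMod p) : ℂ := if CycLtLe i k j then 1 else 0

/-- The arcs from `i` to `j` and from `j` to `i` partition the circle. As in the lemmas that follow,
`cycDist_cases` expresses the distances from other points through distances from `i`, and the claim
becomes linear arithmetic. -/
theorem arcInd_add_arcInd {i j : ZMod p} (h : i ≠ j) (m : ZMod p) :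
    arcInd i j m + arcInd j i m = 1 := by
  unfold arcInd CycLtLe
  have h1 := cycDist_ne (o := i) h
  have h2 := cycDist_cases i j m
  have h3 := cycDist_cases i j i
  have h4 := cycDist_self i
  have h5 := cycDist_lt i m
  have h6 := cycDist_lt i j
  split_ifs <;> first | (exfalso; omega) | norm_num

/-- The point `k` cuts the arc into two. This is the shadow of the relation that splits `x_{ij}` in
the presence of a factor `x_k`. -/
theorem arcInd_eq_add {i j k : ZMod p} (h : CycLtLt i k j) (m : ZMod p) :
    arcInd i j m = arcInd i k m + arcInd k j m := by
  unfold CycLtLt at h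
  unfold arcInd CycLtLe
  have h2 := cycDist_cases i k m
  have h3 := cycDist_cases i k j
  have h4 := cycDist_self i
  have h5 := cycDist_lt i m
  have h6 := cycDist_lt i j
  split_ifs <;> first | (exfalso; omega) | norm_num

/-- Supports of tensor products are intersections of supports, so a product of two `x_{ij}` is
governed by the intersection of two arcs. This and the next three lemmas treat its possible shapes:
empty, one end piece, one of the arcs, two pieces. -/
theorem arcInd_mul_disjoint {i j k l : ZMod p}
    (h : CycLtLe i j k ∧ CycLeLt j k l ∧ CycLtLe k l i) (m : ZMod p) :
    arcInd i j m * arcInd k l m = 0 := by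
  unfold CycLtLe CycLeLt at h
  unfold arcInd CycLtLe
  have h1 := cycDist_cases i j k
  have h2 := cycDist_cases i j l
  have h3 := cycDist_cases i k l
  have h7 := cycDist_cases i k i
  have h8 := cycDist_cases i k m
  have h4 := cycDist_self i
  have h5 := cycDist_lt i m
  have h6 := cycDist_lt i k
  split_ifs <;> first | (exfalso; omega) | norm_num

theorem arcInd_mul_overlap {i j k l : ZMod p}
    (h : CycLeLt i k j ∧ CycLtLe k j l ∧ CycLeLe j l i) (m : ZMod p) :
    arcInd i j m * arcInd k l m = arcInd k j m := by
  unfold CycLtLe CycLeLt CycLeLe at h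
  unfold arcInd CycLtLe
  have h1 := cycDist_cases i k j
  have h2 := cycDist_cases i k l
  have h3 := cycDist_cases i j l
  have h7 := cycDist_cases i j i
  have h8 := cycDist_cases i k m
  have h4 := cycDist_self i
  have h5 := cycDist_lt i m
  have h6 := cycDist_lt i k
  have h9 := cycDist_lt i l
  have h10 := cycDist_lt i j
  split_ifs <;> first | (exfalso; omega) | norm_num

theorem arcInd_mul_nested {i j k l : ZMod p} (hij : i ≠ j)
    (h : CycLeLt i k l ∧ CycLtLe k l j ∧ CycLeLe l j i) (m : ZMod p) :
    arcInd i j m * arcInd k l m = arcInd k l m := by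
  unfold CycLtLe CycLeLt CycLeLe at h
  unfold arcInd CycLtLe
  have h0 := cycDist_ne (o := i) hij
  have h1 := cycDist_cases i k j
  have h2 := cycDist_cases i k l
  have h3 := cycDist_cases i l j
  have h7 := cycDist_cases i l i
  have h8 := cycDist_cases i k m
  have h4 := cycDist_self i
  have h5 := cycDist_lt i m
  have h6 := cycDist_lt i k
  have h9 := cycDist_lt i l
  have h10 := cycDist_lt i j
  split_ifs <;> first | (exfalso; omega) | norm_num

/-- Each arc contains the complement of the other, so the arcs cover the circle and overlap near
both ends. -/
theorem arcInd_mul_twice {i j k l : ZMod p} (hij : i ≠ j)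
    (h : CycLtLt i l k ∧ CycLtLt l k j ∧ CycLtLe k j i) (m : ZMod p) :
    arcInd i j m * arcInd k l m = arcInd i l m + arcInd k j m := by
  unfold CycLtLe CycLtLt at h
  unfold arcInd CycLtLe
  have h0 := cycDist_ne (o := i) hij
  have h1 := cycDist_cases i k j
  have h2 := cycDist_cases i k l
  have h3 := cycDist_cases i l k
  have h10 := cycDist_cases i l j
  have h7 := cycDist_cases i k i
  have h8 := cycDist_cases i k m
  have h4 := cycDist_self i
  have h5 := cycDist_lt i m
  have h6 := cycDist_lt i k
  have h9 := cycDist_lt i l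
  have h11 := cycDist_lt i j
  split_ifs <;> first | (exfalso; omega) | norm_num

end Cyclic

/-! ### The values of the characters on the generators -/

section Values

variable {p : ℕ} [NeZero p] {q : ℂˣ} {hq : IsPrimitiveRoot q p}

open GrothendieckRing

/-- The monodromy of `X` on the module with the class `y_i`. -/
def yMonodromy (q : ℂˣ) (i : ZMod p) : ℂ :=
  ∏ k, (if k = i then Letter.x else .one).xCoeff (evalAt (qpow q k) (linearFactor (qpow q i)))

/-- The factors away from `i` are the differences `q^k - q^i`, which do not vanish because `q` is
primitive. -/
theorem yMonodromy_ne_zero (hq : IsPrimitiveRoot q p) (i : ZMod p) : yMonodromy q i ≠ 0 := by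
  refine Finset.prod_ne_zero_iff.mpr fun k _ => ?_
  split_ifs with h
  · exact one_ne_zero
  · exact fun h' => h ((evalAt_linearFactor_eq_zero hq).mp h')

/-- The element `z - q^i` in the monoid algebra of the degrees. -/
def degMon (q : ℂˣ) (i : ZMod p) : MonoidAlgebra ℂ (breakMonoid p q) :=
  MonoidAlgebra.single ⟨linearFactor (qpow q i), linearFactor_mem i⟩ 1

/-- The degree of a generator, in the monoid algebra. -/
def genMon (q : ℂˣ) : Gen p → MonoidAlgebra ℂ (breakMonoid p q)
  | .u _ => 1
  | .x i => degMon q i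
  | .y i => degMon q i
  | .yStar i => degMon q i
  | .xx i j _ => degMon q i * degMon q j

/-- The values of the characters on the generators. -/
def genVal (q : ℂˣ) : CharIndex p → Gen p → ℂ
  | .dim k, .xx i j _ => arcInd i j k
  | .dim _, _ => 1
  | .x n, .u ξ => (ξ : ℂ) ^ (n + 1)
  | .x n, .y i => yMonodromy q i ^ (n + 1)
  | .x _, _ => 0
  | .y n, .u ξ => ((ξ⁻¹ : ℂˣ) : ℂ) ^ (n + 1)
  | .y _, .yStar _ => 1
  | .y _, _ => 0

theorem pred_lt : p - 1 < p := Nat.sub_lt (NeZero.pos p) one_pos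

theorem smul_degMon (c : ℂ) (i : ZMod p) : c • degMon q i =
    MonoidAlgebra.single ⟨linearFactor (qpow q i), linearFactor_mem i⟩ c := by
  rw [degMon, MonoidAlgebra.smul_single, smul_eq_mul, mul_one]

/-- Matches the support of the interval module, counted from its lowest weight `i + 1`, with the
half-open arc that excludes `i` and includes `j`. -/
theorem cycDist_succ_left_le_iff {i j : ZMod p} (hij : i ≠ j) (k : ZMod p) :
    cycDist (i + 1) k ≤ (j - i).val - 1 ↔ CycLtLe i k j := by
  have h1 := cycDist_succ_left i k
  have h2 := cycDist_ne (o := i) hij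
  have h3 := cycDist_self i
  have h4 := cycDist_lt i j
  change _ ≤ cycDist i j - 1 ↔ _
  unfold CycLtLe
  by_cases hk : k = i
  · subst hk
    rw [if_pos rfl] at h1
    omega
  · rw [if_neg hk] at h1
    have := cycDist_ne (o := i) hk
    omega

/-- On `y_i` only `X` can go around the circle, on `y_i^*` only `Y`, on `u_ξ` both, and on `x_i` and
`x_{ij}` neither. All coefficients of `Y` on `y_i^*` are `1`, so no constants appear there, in
contrast to `y_i`. -/
theorem charLin_genClass (χ : CharIndex p) (g : Gen p) :
    charLin hq (breakMonoid p q) χ (genClass hq g) = genVal q χ g • genMon q g := by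
  cases g with
  | u ξ =>
    have h : ∀ c : ℂ, c • (1 : MonoidAlgebra ℂ (breakMonoid p q)) =
        MonoidAlgebra.single ⟨1, one_mem _⟩ c := fun c => by
      rw [MonoidAlgebra.one_def, MonoidAlgebra.smul_single, smul_eq_mul, mul_one]; rfl
    rw [genClass, clsU, charLin_cls, genMon, h]
    congr 1
    cases χ with
    | dim k => exact char_dim_circle k
    | x n => rw [char_x_circle]; simp [Letter.xCoeff, genVal]
    | y n => rw [char_y_circle]; simp [Letter.yCoeff, genVal]
  | x i =>
    rw [genClass, clsX, charLin_cls, genMon, smul_degMon]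
    congr 1
    cases χ with
    | dim k =>
      rw [char_dim_interval pred_lt, if_pos]
      · rfl
      · have := cycDist_lt (i + 1) k
        omega
    | x n => exact char_x_interval pred_lt n
    | y n => exact char_y_interval pred_lt n
  | y i =>
    rw [genClass, clsY, charLin_cls, genMon, smul_degMon]
    congr 1
    cases χ with
    | dim k => exact char_dim_circle k
    | x n => rw [char_x_circle, Units.val_one, one_mul]; rfl
    | y n =>
      rw [char_y_circle, Finset.prod_eq_zero (Finset.mem_univ i), mul_zero,
        zero_pow (Nat.succ_ne_zero n)]
      · rfl
      · rw [if_pos rfl]; rfl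
  | yStar i =>
    rw [genClass, clsYStar, charLin_cls, genMon, smul_degMon]
    congr 1
    cases χ with
    | dim k => exact char_dim_circle k
    | x n =>
      rw [char_x_circle, Finset.prod_eq_zero (Finset.mem_univ i), mul_zero,
        zero_pow (Nat.succ_ne_zero n)]
      · rfl
      · rw [if_pos rfl]; rfl
    | y n =>
      rw [char_y_circle, Finset.prod_eq_one, inv_one, Units.val_one, one_mul, one_pow]
      · rfl
      · intro k _
        split_ifs <;> rfl
  | xx i j hij =>
    have hlt := ZMod.val_lt (j - i)
    have hlt' : (j - i).val - 1 < p := by omega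
    rw [genClass, clsXX, charLin_cls, genMon, degMon, degMon, MonoidAlgebra.single_mul_single,
      MonoidAlgebra.smul_single, mul_one, smul_eq_mul, mul_one]
    congr 1
    cases χ with
    | dim k =>
      rw [char_dim_interval hlt', genVal, arcInd]
      by_cases h : CycLtLe i k j
      · rw [if_pos h, if_pos ((cycDist_succ_left_le_iff hij k).mpr h)]
      · rw [if_neg h, if_neg (mt (cycDist_succ_left_le_iff hij k).mp h)]
    | x n => exact char_x_interval hlt' n
    | y n => exact char_y_interval hlt' n

/-- The identity is the class of `R ⧸ ⋂ 𝔪`, not a circle module by definition. Its characters follow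
from multiplicativity, because those of `u_1` are already known to be `1`. -/
theorem charLin_one (χ : CharIndex p) : charLin hq (breakMonoid p q) χ 1 = 1 := by
  have h1 : charLin hq (breakMonoid p q) χ (genClass hq (.u 1)) = 1 := by
    rw [charLin_genClass]
    cases χ <;> simp [genVal, genMon]
  have h2 := charLin_mul χ (1 : GrothendieckRing (unitOrbit hq) (breakMonoid p q))
    (genClass hq (.u 1))
  rw [one_mul, h1, mul_one] at h2
  exact h2.symm

/-- A character as a homomorphism of algebras. -/
def charHom (hq : IsPrimitiveRoot q p) (χ : CharIndex p) :
    GrothendieckRing (unitOrbit hq) (breakMonoid p q) →ₐ[ℂ] MonoidAlgebra ℂ (breakMonoid p q) :=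
  AlgHom.ofLinearMap (charLin hq (breakMonoid p q) χ) (charLin_one χ) (charLin_mul χ)

theorem charHom_genClass (χ : CharIndex p) (g : Gen p) :
    charHom hq χ (genClass hq g) = genVal q χ g • genMon q g := charLin_genClass χ g

theorem charHom_cls (χ : CharIndex p) {t : LaurentPolynomial ℂ} (ht : t ∈ breakMonoid p q)
    (V : WMod (unitOrbit hq) t) :
    charHom hq χ (cls ht V) = MonoidAlgebra.single ⟨t, ht⟩ (V.char χ) := charLin_cls χ ht V

/-- The defining relations hold for the values of the characters. -/
theorem aeval_genVal_eq {a b : MvPolynomial (Gen p) ℂ} (h : GrothendieckRel a b)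
    (χ : CharIndex p) :
    MvPolynomial.aeval (fun g => genVal q χ g • genMon q g) a =
      MvPolynomial.aeval (fun g => genVal q χ g • genMon q g) b := by
  -- Arc identities are carried into the monoid algebra, where they get multiplied by the common
  -- degree. Only the dimensions need them: for relations not purely in the `u_ξ`, both monodromies
  -- vanish on both sides.
  have key : ∀ {c d : ℂ}, c = d → algebraMap ℂ (MonoidAlgebra ℂ (breakMonoid p q)) c =
    algebraMap ℂ (MonoidAlgebra ℂ (breakMonoid p q)) d := fun h => h ▸ rfl
  cases h with
  | u_one => cases χ <;> simp [genVal, genMon]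
  | u_mul ξ ξ' =>
    cases χ <;> simp [genVal, genMon, smul_smul, mul_pow, mul_comm]
  | u_x ξ i => cases χ <;> simp [genVal, genMon]
  | u_xx ξ i j h => cases χ <;> simp [genVal, genMon]
  | y_yStar i j h =>
    cases χ with
    | dim k =>
      have := key (arcInd_add_arcInd h k)
      simp only [map_add, map_one] at this
      simp only [map_mul, map_add, MvPolynomial.aeval_X, genVal, genMon, Algebra.smul_def, map_one]
      linear_combination -(degMon q i * degMon q j) * this
    | x n => simp [genVal, genMon]
    | y n => simp [genVal, genMon]
  | x_x i j h =>
    cases χ with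
    | dim k =>
      have := key (arcInd_add_arcInd h k)
      simp only [map_add, map_one] at this
      simp only [map_mul, map_add, MvPolynomial.aeval_X, genVal, genMon, Algebra.smul_def, map_one]
      linear_combination -(degMon q i * degMon q j) * this
    | x n => simp [genVal, genMon]
    | y n => simp [genVal, genMon]
  | x_y i j h =>
    cases χ with
    | dim k =>
      have := key (arcInd_add_arcInd h k)
      simp only [map_add, map_one] at this
      simp only [map_mul, map_add, MvPolynomial.aeval_X, genVal, genMon, Algebra.smul_def, map_one]
      linear_combination -(degMon q i * degMon q j) * this
    | x n => simp [genVal, genMon]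
    | y n => simp [genVal, genMon]
  | x_yStar i j h =>
    cases χ with
    | dim k =>
      have := key (arcInd_add_arcInd h k)
      simp only [map_add, map_one] at this
      simp only [map_mul, map_add, MvPolynomial.aeval_X, genVal, genMon, Algebra.smul_def, map_one]
      linear_combination -(degMon q i * degMon q j) * this
    | x n => simp [genVal, genMon]
    | y n => simp [genVal, genMon]
  | y_yStar_self i => cases χ <;> simp [genVal, genMon, sq]
  | x_y_self i => cases χ <;> simp [genVal, genMon, sq]
  | x_yStar_self i => cases χ <;> simp [genVal, genMon, sq]
  | xx_x i j k hij hik hkj h =>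
    cases χ with
    | dim m =>
      have := key (arcInd_eq_add h m)
      simp only [map_add] at this
      simp only [map_mul, map_add, MvPolynomial.aeval_X, genVal, genMon, Algebra.smul_def, map_one]
      linear_combination (degMon q i * degMon q j * degMon q k) * this
    | x n => simp [genVal, genMon]
    | y n => simp [genVal, genMon]
  | xx_xx_disjoint i j k l hij hkl h =>
    cases χ with
    | dim m =>
      have := key (arcInd_mul_disjoint h m)
      simp only [map_mul, map_zero] at this
      simp only [map_mul, map_zero, MvPolynomial.aeval_X, genVal, genMon, Algebra.smul_def]
      linear_combination (degMon q i * degMon q j * degMon q k * degMon q l) * this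
    | x n => simp [genVal, genMon]
    | y n => simp [genVal, genMon]
  | xx_xx_overlap i j k l hij hkl hkj h =>
    cases χ with
    | dim m =>
      have := key (arcInd_mul_overlap h m)
      simp only [map_mul] at this
      simp only [map_mul, map_one, MvPolynomial.aeval_X, genVal, genMon, Algebra.smul_def]
      linear_combination (degMon q i * degMon q j * degMon q k * degMon q l) * this
    | x n => simp [genVal, genMon]
    | y n => simp [genVal, genMon]
  | xx_xx_nested i j k l hij hkl h =>
    cases χ with
    | dim m =>
      have := key (arcInd_mul_nested hij h m)
      simp only [map_mul] at this
      simp only [map_mul, map_one, MvPolynomial.aeval_X, genVal, genMon, Algebra.smul_def]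
      linear_combination (degMon q i * degMon q j * degMon q k * degMon q l) * this
    | x n => simp [genVal, genMon]
    | y n => simp [genVal, genMon]
  | xx_xx_twice i j k l hij hkl hil hkj h =>
    cases χ with
    | dim m =>
      have := key (arcInd_mul_twice hij h m)
      simp only [map_mul, map_add] at this
      simp only [map_mul, map_add, map_one, MvPolynomial.aeval_X, genVal, genMon, Algebra.smul_def]
      linear_combination (degMon q i * degMon q j * degMon q k * degMon q l) * this
    | x n => simp [genVal, genMon]
    | y n => simp [genVal, genMon]
  | xx_y i j k h => cases χ <;> simp [genVal, genMon]
  | xx_yStar i j k h => cases χ <;> simp [genVal, genMon]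

end Values

/-! ### Degrees and characters of the normal forms -/

section NormalForms

variable {p : ℕ} [NeZero p] {q : ℂˣ} {hq : IsPrimitiveRoot q p}

open GrothendieckRing

/-- The product `∏ (z - q^k)^{a_k}`. -/
def degProd (q : ℂˣ) (a : ZMod p → ℕ) : breakMonoid p q :=
  ∏ k, (⟨linearFactor (qpow q k), linearFactor_mem k⟩ : breakMonoid p q) ^ a k

theorem coe_degProd (a : ZMod p → ℕ) :
    (degProd q a : LaurentPolynomial ℂ) = ∏ k, linearFactor (qpow q k) ^ a k := by
  rw [degProd, Submonoid.coe_finsetProd]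
  rfl

theorem degProd_zero : degProd q (0 : ZMod p → ℕ) = 1 := by simp [degProd]

theorem degProd_add (a b : ZMod p → ℕ) : degProd q (a + b) = degProd q a * degProd q b := by
  simp only [degProd, Pi.add_apply, pow_add, Finset.prod_mul_distrib]

theorem degProd_single (i : ZMod p) (n : ℕ) : degProd q (Pi.single i n) =
    (⟨linearFactor (qpow q i), linearFactor_mem i⟩ : breakMonoid p q) ^ n := by
  rw [degProd, Finset.prod_eq_single i]
  · rw [Pi.single_eq_same]
  · intro k _ hk
    rw [Pi.single_eq_of_ne hk, pow_zero]
  · exact fun h => absurd (Finset.mem_univ i) h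

theorem evalAt_degProd_eq_zero (hq : IsPrimitiveRoot q p) (a : ZMod p → ℕ) (k : ZMod p) :
    evalAt (qpow q k) (degProd q a : LaurentPolynomial ℂ) = 0 ↔ a k ≠ 0 := by
  rw [coe_degProd, map_prod, Finset.prod_eq_zero_iff]
  constructor
  · rintro ⟨l, _, hl⟩
    rw [map_pow] at hl
    obtain ⟨h, h'⟩ := pow_eq_zero_iff'.mp hl
    obtain rfl := (evalAt_linearFactor_eq_zero hq).mp h
    exact h'
  · intro h
    refine ⟨k, Finset.mem_univ k, ?_⟩
    rw [map_pow, (evalAt_linearFactor_eq_zero hq).mpr rfl, zero_pow h]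

theorem linearFactor_ne_zero (c : ℂˣ) : linearFactor c ≠ 0 := by
  intro h
  -- The value at `-c` is `-2c`, which is not zero.
  have h1 := evalAt_linearFactor (-c) c
  rw [h, map_zero, Units.val_neg] at h1
  exact c.ne_zero (by linear_combination (1 / 2 : ℂ) * h1)

theorem degProd_eq_single_mul {a : ZMod p → ℕ} {k : ZMod p} {n : ℕ} (h : n ≤ a k) :
    (degProd q a : LaurentPolynomial ℂ) =
      linearFactor (qpow q k) ^ n * (degProd q (a - Pi.single k n) : LaurentPolynomial ℂ) := by
  have ha : a = Pi.single k n + (a - Pi.single k n) := by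
    refine funext fun l => ?_
    by_cases hl : l = k
    · subst hl
      simp only [Pi.add_apply, Pi.sub_apply, Pi.single_eq_same]
      omega
    · simp [Pi.single_eq_of_ne hl]
  have h1 := congrArg (degProd q) ha
  rw [degProd_add, degProd_single] at h1
  exact congrArg Subtype.val h1

/-- If the exponents at `k` differed, cancelling the smaller power of `z - q^k` and evaluating at
`q^k` would give zero on one side only. Consequently exponents can be read off from degrees. -/
theorem degProd_injective (hq : IsPrimitiveRoot q p) :
    Function.Injective (degProd q : (ZMod p → ℕ) → breakMonoid p q) := by
  have key : ∀ a b : ZMod p → ℕ, degProd q a = degProd q b → ∀ k, a k ≤ b k := by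
    intro a b h k
    by_contra! hlt
    have h' : (degProd q a : LaurentPolynomial ℂ) = degProd q b := congrArg Subtype.val h
    rw [degProd_eq_single_mul hlt.le, degProd_eq_single_mul (le_refl (b k))] at h'
    have h0 : linearFactor (qpow q k) ^ b k ≠ 0 := pow_ne_zero _ (linearFactor_ne_zero _)
    have h1 := congrArg (evalAt (qpow q k)) (mul_left_cancel₀ h0 h')
    rw [(evalAt_degProd_eq_zero hq _ k).mpr] at h1
    · have := (evalAt_degProd_eq_zero hq _ k).mp h1.symm
      simp at this
    · simp only [Pi.sub_apply, Pi.single_eq_same]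
      omega
  exact fun a b h => funext fun k => le_antisymm (key a b h k) (key b a h.symm k)

theorem exists_eq_degProd {t : LaurentPolynomial ℂ} (ht : t ∈ breakMonoid p q) :
    ∃ a : ZMod p → ℕ, t = degProd q a := by
  unfold breakMonoid at ht
  induction ht using Submonoid.closure_induction with
  | mem x hx =>
    obtain ⟨k, rfl⟩ := hx
    exact ⟨Pi.single k 1, by rw [degProd_single, pow_one]⟩
  | one => exact ⟨0, by rw [degProd_zero]; rfl⟩
  | mul x y _ _ hx hy =>
    obtain ⟨a, rfl⟩ := hx
    obtain ⟨b, rfl⟩ := hy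
    exact ⟨a + b, by rw [degProd_add]; rfl⟩

/-! ### Numerical invariants attached to normal forms -/

namespace NormalForm

/-- The exponents of the degree of a normal form. -/
def deg : NormalForm p → ZMod p → ℕ
  | .xx i j _ a _ => a + Pi.single i 1 + Pi.single j 1
  | .xPow i a _ => Pi.single i a
  | .u _ => 0
  | .uy _ a _ => a
  | .uyStar _ a _ => a

/-- The monodromy of `X` on the module of a normal form. -/
def monX (q : ℂˣ) : NormalForm p → ℂ
  | .u ξ => ξ
  | .uy ξ a _ => ξ * ∏ k, yMonodromy q k ^ a k
  | _ => 0

/-- The monodromy of `Y` on the module of a normal form. -/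
def monY : NormalForm p → ℂ
  | .u ξ => (ξ⁻¹ : ℂˣ)
  | .uyStar ξ _ _ => (ξ⁻¹ : ℂˣ)
  | _ => 0

/-- The dimensions of the weight spaces of the module of a normal form. -/
def dim (k : ZMod p) : NormalForm p → ℂ
  | .xx i j _ _ _ => arcInd i j k
  | _ => 1

/-- The values of the characters on the normal forms. -/
def val (q : ℂˣ) : CharIndex p → NormalForm p → ℂ
  | .dim k, n => n.dim k
  | .x m, n => n.monX q ^ (m + 1)
  | .y m, n => n.monY ^ (m + 1)

end NormalForm

theorem prod_smul_degMon_pow (c : ZMod p → ℂ) (a : ZMod p → ℕ) :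
    ∏ k, (c k • degMon q k) ^ a k = MonoidAlgebra.single (degProd q a) (∏ k, c k ^ a k) := by
  have h1 : ∀ k, (c k • degMon q k) ^ a k = c k ^ a k • (MonoidAlgebra.of ℂ (breakMonoid p q)
      (⟨linearFactor (qpow q k), linearFactor_mem k⟩ ^ a k)) := fun k => by
    rw [smul_pow, map_pow]; rfl
  simp only [h1]
  rw [Finset.prod_smul, ← map_prod]
  change _ • MonoidAlgebra.single (degProd q a) 1 = _
  rw [MonoidAlgebra.smul_single, smul_eq_mul, mul_one]

theorem prod_zero_pow {a : ZMod p → ℕ} (ha : a ≠ 0) : ∏ k, (0 : ℂ) ^ a k = 0 := by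
  obtain ⟨k, hk⟩ := Function.ne_iff.mp ha
  exact Finset.prod_eq_zero (Finset.mem_univ k) (zero_pow hk)

theorem charHom_normalFormElement (χ : CharIndex p) (n : NormalForm p) :
    charHom hq χ (normalFormElement hq n) =
      MonoidAlgebra.single (degProd q n.deg) (n.val q χ) := by
  have hu : ∀ ξ, charHom hq χ (clsU hq ξ) = MonoidAlgebra.single 1 (genVal q χ (.u ξ)) := fun ξ =>
    (charHom_genClass χ (.u ξ)).trans (by
      rw [genMon, MonoidAlgebra.one_def, MonoidAlgebra.smul_single, smul_eq_mul, mul_one])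
  have hx : ∀ i, charHom hq χ (clsX hq i) = genVal q χ (.x i) • degMon q i := fun i =>
    charHom_genClass χ (.x i)
  have hy : ∀ i, charHom hq χ (clsY hq i) = genVal q χ (.y i) • degMon q i := fun i =>
    charHom_genClass χ (.y i)
  have hy' : ∀ i, charHom hq χ (clsYStar hq i) = genVal q χ (.yStar i) • degMon q i := fun i =>
    charHom_genClass χ (.yStar i)
  cases n with
  | xx i j h a ha =>
    have hxx : charHom hq χ (clsXX hq i j h) = genVal q χ (.xx i j h) • (degMon q i * degMon q j) :=
      charHom_genClass χ (.xx i j h)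
    rw [normalFormElement, map_mul, map_prod, hxx]
    simp only [map_pow, hx]
    rw [prod_smul_degMon_pow, degMon, degMon, MonoidAlgebra.single_mul_single,
      MonoidAlgebra.smul_single, MonoidAlgebra.single_mul_single, mul_one, smul_eq_mul, mul_one,
      NormalForm.deg, degProd_add, degProd_add, degProd_single, degProd_single, pow_one, pow_one]
    congr 1
    · rw [mul_comm, mul_assoc]
    · cases χ <;> simp [genVal, NormalForm.val, NormalForm.dim, NormalForm.monX, NormalForm.monY]
  | xPow i a ha =>
    rw [normalFormElement, map_pow, hx, smul_degMon, MonoidAlgebra.single_pow, NormalForm.deg,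
      degProd_single]
    congr 1
    cases χ <;>
      simp [genVal, NormalForm.val, NormalForm.dim, NormalForm.monX, NormalForm.monY, ha.ne']
  | u ξ =>
    rw [normalFormElement, hu, NormalForm.deg, degProd_zero]
    cases χ <;> simp [genVal, NormalForm.val, NormalForm.dim, NormalForm.monX, NormalForm.monY]
  | uy ξ a ha =>
    rw [normalFormElement, map_mul, map_prod, hu]
    simp only [map_pow, hy]
    rw [prod_smul_degMon_pow, MonoidAlgebra.single_mul_single, one_mul, NormalForm.deg]
    congr 1
    cases χ <;> simp [genVal, NormalForm.val, NormalForm.dim, NormalForm.monX, NormalForm.monY,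
      prod_zero_pow ha, mul_pow, ← Finset.prod_pow, ← pow_mul, mul_comm]
  | uyStar ξ a ha =>
    rw [normalFormElement, map_mul, map_prod, hu]
    simp only [map_pow, hy']
    rw [prod_smul_degMon_pow, MonoidAlgebra.single_mul_single, one_mul, NormalForm.deg]
    congr 1
    cases χ <;> simp [genVal, NormalForm.val, NormalForm.dim, NormalForm.monX, NormalForm.monY,
      prod_zero_pow ha]

/-! ### Linear independence -/

/-- If `∑ c_n μ_n^m = 0` for all `m > 0`, then the coefficient of every simple nonzero `μ_n`
vanishes. -/
theorem coeff_eq_zero_of_power_sums {ι : Type*} {s : Finset ι} {c μ : ι → ℂ}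
    (h : ∀ m : ℕ, ∑ n ∈ s, c n * μ n ^ (m + 1) = 0) {n₀ : ι} (hn₀ : n₀ ∈ s) (hμ : μ n₀ ≠ 0)
    (hne : ∀ n ∈ s, μ n = μ n₀ → n = n₀) : c n₀ = 0 := by
  classical
  -- By linearity the vanishing extends from positive powers to every polynomial without constant
  -- term.
  have hP : ∀ P : Polynomial ℂ, ∑ n ∈ s, c n * (μ n * P.eval (μ n)) = 0 := fun P => by
    simp only [Polynomial.eval_eq_sum_range, Finset.mul_sum]
    rw [Finset.sum_comm]
    refine Finset.sum_eq_zero fun m _ => ?_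
    rw [← mul_zero (P.coeff m), ← h m, Finset.mul_sum]
    exact Finset.sum_congr rfl fun n _ => by ring
  -- This polynomial kills all `μ n` with `n ≠ n₀` but not `μ n₀`. Repetitions or zeros among the
  -- other values do no harm.
  have h1 := hP (∏ n ∈ s.erase n₀, (Polynomial.X - Polynomial.C (μ n)))
  rw [Finset.sum_eq_single n₀] at h1
  · rw [Polynomial.eval_prod] at h1
    refine (mul_eq_zero.mp h1).resolve_right (mul_ne_zero hμ ?_)
    refine Finset.prod_ne_zero_iff.mpr fun n hn => ?_
    rw [Polynomial.eval_sub, Polynomial.eval_X, Polynomial.eval_C, sub_ne_zero]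
    exact fun e => (Finset.mem_erase.mp hn).1 (hne n (Finset.mem_erase.mp hn).2 e.symm)
  · intro n hn hn'
    rw [Polynomial.eval_prod, Finset.prod_eq_zero (Finset.mem_erase.mpr ⟨hn', hn⟩), mul_zero,
      mul_zero]
    simp
  · exact fun h => absurd hn₀ h

namespace NormalForm

/-- The degree fixes the exponents, hence the factor of the monodromy coming from the `y_k`, and the
rest is `ξ`. In one degree `u` and `uy` cannot both occur. -/
theorem eq_of_monX_eq (hq : IsPrimitiveRoot q p) {n n' : NormalForm p} (hd : n.deg = n'.deg)
    (h : n.monX q = n'.monX q) (h0 : n'.monX q ≠ 0) : n = n' := by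
  have hprod : ∀ a : ZMod p → ℕ, ∏ k, yMonodromy q k ^ a k ≠ 0 := fun a =>
    Finset.prod_ne_zero_iff.mpr fun k _ => pow_ne_zero _ (yMonodromy_ne_zero hq k)
  cases n' with
  | u ξ' =>
    cases n with
    | u ξ => exact congrArg _ (Units.ext h)
    | uy ξ a ha => exact absurd hd ha
    | _ => exact absurd h.symm h0
  | uy ξ' a' ha' =>
    cases n with
    | u ξ => exact absurd hd.symm ha'
    | uy ξ a ha =>
      obtain rfl : a = a' := hd
      obtain rfl : ξ = ξ' := Units.ext (mul_right_cancel₀ (hprod a) h)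
      rfl
    | _ => exact absurd h.symm h0
  | _ => exact absurd rfl h0

theorem eq_of_monY_eq {n n' : NormalForm p} (hd : n.deg = n'.deg)
    (h : n.monY = n'.monY) (h0 : n'.monY ≠ 0) : n = n' := by
  cases n' with
  | u ξ' =>
    cases n with
    | u ξ => exact congrArg _ (inv_injective (Units.ext h))
    | uyStar ξ a ha => exact absurd hd ha
    | _ => exact absurd h.symm h0
  | uyStar ξ' a' ha' =>
    cases n with
    | u ξ => exact absurd hd.symm ha'
    | uyStar ξ a ha =>
      obtain rfl : a = a' := hd
      obtain rfl : ξ = ξ' := inv_injective (Units.ext h)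
      rfl
    | _ => exact absurd h.symm h0
  | _ => exact absurd rfl h0

theorem deg_xx_left {i j : ZMod p} {h : i ≠ j} {a : ZMod p → ℕ}
    {ha : ∀ k, a k ≠ 0 → CycLeLe j k i} : (NormalForm.xx i j h a ha).deg i ≠ 0 := by
  simp [deg]

theorem deg_xx_right {i j : ZMod p} {h : i ≠ j} {a : ZMod p → ℕ}
    {ha : ∀ k, a k ≠ 0 → CycLeLe j k i} : (NormalForm.xx i j h a ha).deg j ≠ 0 := by
  simp [deg]

/-- There are no breaks between `i` and `j`. -/
theorem deg_xx_eq_zero {i j : ZMod p} {h : i ≠ j} {a : ZMod p → ℕ}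
    {ha : ∀ k, a k ≠ 0 → CycLeLe j k i} {k : ZMod p} (hk : CycLtLt i k j) :
    (NormalForm.xx i j h a ha).deg k = 0 := by
  have h4 := cycDist_self i
  unfold CycLtLt at hk
  have hki : k ≠ i := by rintro rfl; omega
  have hkj : k ≠ j := by rintro rfl; omega
  simp only [deg, Pi.add_apply, Pi.single_eq_of_ne hki, Pi.single_eq_of_ne hkj, add_zero]
  by_contra h0
  have h1 := ha k h0
  unfold CycLeLe at h1
  have h2 := cycDist_cases i j k
  have h3 := cycDist_cases i j i
  have h5 := cycDist_lt i j
  omega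

/-- In one degree the breaks are fixed, and both arcs run between consecutive ones. Since `j'` is a
break inside the first arc it must be its endpoint `j`, and neither starting point may lie strictly
between the other one and `j`. -/
theorem xx_eq_xx {i j i' j' : ZMod p} {h : i ≠ j} {h' : i' ≠ j'} {a a' : ZMod p → ℕ}
    {ha : ∀ k, a k ≠ 0 → CycLeLe j k i} {ha' : ∀ k, a' k ≠ 0 → CycLeLe j' k i'}
    (hd : (NormalForm.xx i j h a ha).deg = (NormalForm.xx i' j' h' a' ha').deg)
    (hj : CycLtLe i j' j) : NormalForm.xx i j h a ha = NormalForm.xx i' j' h' a' ha' := by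
  obtain rfl : j' = j := by
    by_contra hne
    have h1 := cycDist_ne (o := i) hne
    unfold CycLtLe at hj
    have h2 : (NormalForm.xx i j h a ha).deg j' = 0 :=
      deg_xx_eq_zero (h := h) (ha := ha) (by unfold CycLtLt; omega)
    rw [hd] at h2
    exact deg_xx_right h2
  obtain rfl : i = i' := by
    by_contra hne
    have h1 : ¬ CycLtLt i i' j' := fun hlt => by
      have h2 := deg_xx_eq_zero (h := h) (ha := ha) hlt
      rw [hd] at h2
      exact deg_xx_left h2
    have h2 : ¬ CycLtLt i' i j' := fun hlt => by
      have h2 := deg_xx_eq_zero (h := h') (ha := ha') hlt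
      rw [← hd] at h2
      exact deg_xx_left h2
    unfold CycLtLt at h1 h2
    have h3 := cycDist_cases i i' i
    have h4 := cycDist_cases i i' j'
    have h5 := cycDist_self i
    have h6 := cycDist_ne (o := i) hne
    have h7 := cycDist_ne (o := i) h'
    have h8 := cycDist_ne (o := i) h
    have h9 := cycDist_lt i i'
    omega
  have : a = a' := by
    simp only [deg, add_assoc] at hd
    exact add_right_cancel hd
  subst this
  rfl

/-- One degree has at least two distinct breaks, the other exactly one. -/
theorem deg_xx_ne_deg_xPow {i j l : ZMod p} {h : i ≠ j} {a : ZMod p → ℕ}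
    {ha : ∀ k, a k ≠ 0 → CycLeLe j k i} {b : ℕ} {hb : 0 < b} :
    (NormalForm.xx i j h a ha).deg ≠ (NormalForm.xPow l b hb).deg := by
  intro hd
  have h1 : (NormalForm.xPow l b hb).deg i ≠ 0 := hd ▸ deg_xx_left
  have h2 : (NormalForm.xPow l b hb).deg j ≠ 0 := hd ▸ deg_xx_right
  have h3 : ∀ k, (NormalForm.xPow l b hb).deg k ≠ 0 → k = l := fun k hk => by
    by_contra hne
    exact hk (by simp [NormalForm.deg, Pi.single_eq_of_ne hne])
  exact h ((h3 i h1).trans (h3 j h2).symm)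

end NormalForm

theorem coeff_degProd_single (hq : IsPrimitiveRoot q p) (a d : ZMod p → ℕ) (c : ℂ) :
    MonoidAlgebra.coeff (MonoidAlgebra.single (degProd q a) c) (degProd q d) =
      if a = d then c else 0 := by
  classical
  rw [MonoidAlgebra.coeff_single, Finsupp.single_apply]
  exact if_congr (degProd_injective hq).eq_iff rfl rfl

theorem sum_mul_val_eq_zero (hq : IsPrimitiveRoot q p) {s : Finset (NormalForm p)}
    {g : NormalForm p → ℂ} {χ : CharIndex p}
    (h : ∑ n ∈ s, g n • MonoidAlgebra.single (degProd q n.deg) (n.val q χ) = 0)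
    (d : ZMod p → ℕ) : ∑ n ∈ s with n.deg = d, g n * n.val q χ = 0 := by
  have h1 := congrArg (fun x => MonoidAlgebra.coeff x (degProd q d)) h
  simp only [MonoidAlgebra.coeff_sum, MonoidAlgebra.coeff_smul, Finsupp.coe_finsetSum,
    Finset.sum_apply, Finsupp.smul_apply, coeff_degProd_single hq, smul_eq_mul,
    MonoidAlgebra.coeff_zero, Finsupp.coe_zero, Pi.zero_apply, mul_ite, mul_zero] at h1
  rw [Finset.sum_filter]
  exact h1

/-- The characters separate the normal forms. -/
theorem eq_zero_of_sum_single (hq : IsPrimitiveRoot q p) {s : Finset (NormalForm p)}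
    {g : NormalForm p → ℂ}
    (hg : ∀ χ, ∑ n ∈ s, g n • MonoidAlgebra.single (degProd q n.deg) (n.val q χ) = 0) :
    ∀ n ∈ s, g n = 0 := by
  have hcoef : ∀ (χ : CharIndex p) (d : ZMod p → ℕ),
      ∑ n ∈ s with n.deg = d, g n * n.val q χ = 0 := fun χ => sum_mul_val_eq_zero hq (hg χ)
  -- Within one degree every nonzero monodromy occurs for a single normal form, so power sums
  -- isolate its coefficient. Traces of `X` remove `u` and `uy`, those of `Y` remove `uyStar`.
  have hX : ∀ n ∈ s, n.monX q ≠ 0 → g n = 0 := fun n₀ hn₀ h0 => by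
    have h1 : ∀ m : ℕ, ∑ n ∈ s with n.deg = n₀.deg, g n * n.monX q ^ (m + 1) = 0 := fun m =>
      hcoef (.x m) n₀.deg
    refine coeff_eq_zero_of_power_sums h1 (Finset.mem_filter.mpr ⟨hn₀, rfl⟩) h0 fun n hn h => ?_
    exact NormalForm.eq_of_monX_eq hq (Finset.mem_filter.mp hn).2 h h0
  have hY : ∀ n ∈ s, n.monY ≠ 0 → g n = 0 := fun n₀ hn₀ h0 => by
    have h1 : ∀ m : ℕ, ∑ n ∈ s with n.deg = n₀.deg, g n * n.monY ^ (m + 1) = 0 := fun m =>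
      hcoef (.y m) n₀.deg
    refine coeff_eq_zero_of_power_sums h1 (Finset.mem_filter.mpr ⟨hn₀, rfl⟩) h0 fun n hn h => ?_
    exact NormalForm.eq_of_monY_eq (Finset.mem_filter.mp hn).2 h h0
  have hprod : ∀ a : ZMod p → ℕ, ∏ k, yMonodromy q k ^ a k ≠ 0 := fun a =>
    Finset.prod_ne_zero_iff.mpr fun k _ => pow_ne_zero _ (yMonodromy_ne_zero hq k)
  have hu : ∀ ξ, NormalForm.u ξ ∈ s → g (.u ξ) = 0 := fun ξ hn => hX _ hn ξ.ne_zero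
  have huy : ∀ ξ a ha, NormalForm.uy ξ a ha ∈ s → g (.uy ξ a ha) = 0 := fun ξ a ha hn =>
    hX _ hn (mul_ne_zero ξ.ne_zero (hprod a))
  have huy' : ∀ ξ a ha, NormalForm.uyStar ξ a ha ∈ s → g (.uyStar ξ a ha) = 0 := fun ξ a ha hn =>
    hY _ hn (Units.ne_zero _)
  intro n₀ hn₀
  cases n₀ with
  | u ξ => exact hu ξ hn₀
  | uy ξ a ha => exact huy ξ a ha hn₀
  | uyStar ξ a ha => exact huy' ξ a ha hn₀
  | xx i j h a ha =>
    -- The weight `j` lies in the arc ending at `j` and in no other arc between consecutive breaks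
    -- of this degree.
    have h1 := hcoef (.dim j) (NormalForm.xx i j h a ha).deg
    have hself : arcInd i j j = 1 := by
      have h2 := cycDist_ne (o := i) h
      have h3 := cycDist_self i
      exact if_pos ⟨by omega, le_rfl⟩
    rw [Finset.sum_eq_single (NormalForm.xx i j h a ha)] at h1
    · simpa [NormalForm.val, NormalForm.dim, hself] using h1
    · intro n hn hne
      obtain ⟨hns, hd⟩ := Finset.mem_filter.mp hn
      cases n with
      | u ξ => rw [hu ξ hns, zero_mul]
      | uy ξ a ha => rw [huy ξ a ha hns, zero_mul]
      | uyStar ξ a ha => rw [huy' ξ a ha hns, zero_mul]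
      | xPow l b hb => exact absurd hd.symm NormalForm.deg_xx_ne_deg_xPow
      | xx i' j' h' a' ha' =>
        rw [NormalForm.val, NormalForm.dim, arcInd, if_neg, mul_zero]
        exact fun hlt => hne (NormalForm.xx_eq_xx hd hlt)
    · exact fun hn => (hn (Finset.mem_filter.mpr ⟨hn₀, rfl⟩)).elim
  | xPow i b hb =>
    -- With a single break there is only one interval in this degree, so any weight would serve.
    have h1 := hcoef (.dim i) (NormalForm.xPow i b hb).deg
    rw [Finset.sum_eq_single (NormalForm.xPow i b hb)] at h1
    · simpa [NormalForm.val, NormalForm.dim] using h1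
    · intro n hn hne
      obtain ⟨hns, hd⟩ := Finset.mem_filter.mp hn
      cases n with
      | u ξ => rw [hu ξ hns, zero_mul]
      | uy ξ a ha => rw [huy ξ a ha hns, zero_mul]
      | uyStar ξ a ha => rw [huy' ξ a ha hns, zero_mul]
      | xx i' j' h' a' ha' => exact absurd hd NormalForm.deg_xx_ne_deg_xPow
      | xPow l c hc =>
        exfalso
        change (Pi.single l c : ZMod p → ℕ) = Pi.single i b at hd
        obtain rfl : l = i := by
          by_contra hli
          have := congrFun hd l
          rw [Pi.single_eq_same, Pi.single_eq_of_ne hli] at this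
          omega
        obtain rfl : c = b := Pi.single_injective l hd
        exact hne rfl
    · exact fun hn => (hn (Finset.mem_filter.mpr ⟨hn₀, rfl⟩)).elim

end NormalForms

/-! ### The classes of the basic modules -/

section BasicClasses

variable {p : ℕ} [NeZero p] {q : ℂˣ} {hq : IsPrimitiveRoot q p}

open GrothendieckRing

/-- `i` and `i + ℓ + 1` are consecutive elements of the support of `b`. -/
def IsGap (b : ZMod p → ℕ) (i : ZMod p) (ℓ : ℕ) : Prop :=
  b i ≠ 0 ∧ b (i + 1 + (ℓ : ZMod p)) ≠ 0 ∧ ∀ m < ℓ, b (i + 1 + (m : ZMod p)) = 0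

/-- The word `w` has the letter `1` exactly outside the support of `b`. -/
def IsWord (b : ZMod p → ℕ) (w : ZMod p → Letter) : Prop := ∀ k, w k = .one ↔ b k = 0

theorem IsWord.iff_evalAt {b : ZMod p → ℕ} {w : ZMod p → Letter} (hq : IsPrimitiveRoot q p)
    (h : IsWord b w) (k : ZMod p) :
    w k = .one ↔ evalAt (qpow q k) (degProd q b : LaurentPolynomial ℂ) ≠ 0 := by
  rw [ne_eq, evalAt_degProd_eq_zero hq, not_not]
  exact h k

open Classical in
/-- The class of the interval module between consecutive breaks. -/
def intervalCls (hq : IsPrimitiveRoot q p) (b : ZMod p → ℕ) (i : ZMod p) (ℓ : ℕ) :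
    GrothendieckRing (unitOrbit hq) (breakMonoid p q) :=
  if h : IsGap b i ℓ then
    cls (degProd q b).2 (intervalModule hq (degProd q b) i ℓ
      ((evalAt_degProd_eq_zero hq b i).mpr h.1) ((evalAt_degProd_eq_zero hq b _).mpr h.2.1)
      (fun m hm h0 => (evalAt_degProd_eq_zero hq b _).mp h0 (h.2.2 m hm)))
  else 0

open Classical in
/-- The class of the circle module of a word. -/
def circleCls (hq : IsPrimitiveRoot q p) (b : ZMod p → ℕ) (w : ZMod p → Letter) (ξ : ℂˣ) :
    GrothendieckRing (unitOrbit hq) (breakMonoid p q) :=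
  if h : IsWord b w then
    cls (degProd q b).2 (circleModule hq (degProd q b) w (h.iff_evalAt hq) ξ)
  else 0

/-- The word with the letter `l` on the support of `b` and `1` elsewhere. -/
def supportWord (l : Letter) (b : ZMod p → ℕ) (k : ZMod p) : Letter := if b k = 0 then .one else l

theorem isWord_supportWord {l : Letter} (hl : l ≠ .one) (b : ZMod p → ℕ) :
    IsWord b (supportWord l b) := fun k => by
  by_cases h : b k = 0 <;> simp [supportWord, h, hl]

theorem IsWord.eq_supportWord {b : ZMod p → ℕ} {w : ZMod p → Letter} {l : Letter}
    (h : IsWord b w) (hl : ∀ k, w k = .one ∨ w k = l) : w = supportWord l b := by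
  refine funext fun k => ?_
  by_cases hk : b k = 0
  · rw [supportWord, if_pos hk, (h k).mpr hk]
  · rw [supportWord, if_neg hk]
    exact (hl k).resolve_left fun h1 => hk ((h k).mp h1)

theorem prod_xCoeff_supportWord_ne_zero (hq : IsPrimitiveRoot q p) (b : ZMod p → ℕ) :
    ∏ k, (supportWord .x b k).xCoeff
      (evalAt (qpow q k) (degProd q b : LaurentPolynomial ℂ)) ≠ 0 := by
  refine Finset.prod_ne_zero_iff.mpr fun k _ => ?_
  by_cases hk : b k = 0
  · rw [supportWord, if_pos hk]
    exact fun h => (evalAt_degProd_eq_zero hq b k).mp h hk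
  · rw [supportWord, if_neg hk]
    exact one_ne_zero

theorem prod_yMonodromy_ne_zero (hq : IsPrimitiveRoot q p) (b : ZMod p → ℕ) :
    ∏ k, yMonodromy q k ^ b k ≠ 0 :=
  Finset.prod_ne_zero_iff.mpr fun k _ => pow_ne_zero _ (yMonodromy_ne_zero hq k)

/-- The ratio of the monodromies of `X` on `⨂ y_k^{⊗ b_k}` and on the circle module with
parameter `1`. -/
def monRatio (hq : IsPrimitiveRoot q p) (b : ZMod p → ℕ) : ℂˣ :=
  Units.mk0 _ (prod_yMonodromy_ne_zero hq b) *
    (Units.mk0 _ (prod_xCoeff_supportWord_ne_zero hq b))⁻¹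

theorem monRatio_mul_prod (hq : IsPrimitiveRoot q p) (b : ZMod p → ℕ) :
    (monRatio hq b : ℂ) * ∏ k, (supportWord .x b k).xCoeff
      (evalAt (qpow q k) (degProd q b : LaurentPolynomial ℂ)) = ∏ k, yMonodromy q k ^ b k := by
  rw [monRatio, Units.val_mul, Units.val_inv_eq_inv_val, Units.val_mk0, Units.val_mk0,
    inv_mul_cancel_right₀ (prod_xCoeff_supportWord_ne_zero hq b)]

/-- The class of the basic module that corresponds to a normal form. -/
def basicClass (hq : IsPrimitiveRoot q p) :
    NormalForm p → GrothendieckRing (unitOrbit hq) (breakMonoid p q)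
  | .xx i j h a ha => intervalCls hq (NormalForm.xx i j h a ha).deg i ((j - i).val - 1)
  | .xPow i a _ => intervalCls hq (Pi.single i a) i (p - 1)
  | .u ξ => circleCls hq 0 (supportWord .x 0) ξ
  | .uy ξ a _ => circleCls hq a (supportWord .x a) (ξ * monRatio hq a)
  | .uyStar ξ a _ => circleCls hq a (supportWord .y a) ξ

theorem cycDist_add_succ (i : ZMod p) {m : ℕ} (hm : m + 1 < p) :
    cycDist i (i + 1 + (m : ZMod p)) = m + 1 := by
  have h : i + 1 + (m : ZMod p) - i = ((m + 1 : ℕ) : ZMod p) := by push_cast; ring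
  rw [cycDist, h, ZMod.val_natCast, Nat.mod_eq_of_lt hm]

theorem add_succ_cycDist (i k : ZMod p) : i + 1 + (cycDist (i + 1) k : ZMod p) = k := by
  rw [cycDist, ZMod.natCast_zmod_val]; ring

theorem isGap_xx {i j : ZMod p} {h : i ≠ j} {a : ZMod p → ℕ}
    {ha : ∀ k, a k ≠ 0 → CycLeLe j k i} :
    IsGap (NormalForm.xx i j h a ha).deg i ((j - i).val - 1) := by
  refine ⟨NormalForm.deg_xx_left, ?_, fun m hm => NormalForm.deg_xx_eq_zero ?_⟩
  · rw [add_one_add_dist h]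
    exact NormalForm.deg_xx_right
  · have hlt := ZMod.val_lt (j - i)
    have h1 := cycDist_add_succ i (m := m) (by omega)
    have h2 : cycDist i j = (j - i).val := rfl
    unfold CycLtLt
    omega

theorem isGap_single (i : ZMod p) {a : ℕ} (ha : 0 < a) :
    IsGap (Pi.single i a : ZMod p → ℕ) i (p - 1) := by
  refine ⟨by simp [ha.ne'], by rw [add_one_add_pred]; simp [ha.ne'], fun m hm => ?_⟩
  rw [Pi.single_eq_of_ne]
  intro h
  exact add_natCast_succ_ne (i := i) hm pred_lt (h.trans (add_one_add_pred i).symm)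

theorem charHom_intervalCls {b : ZMod p → ℕ} {i : ZMod p} {ℓ : ℕ} (h : IsGap b i ℓ) (hℓ : ℓ < p)
    (χ : CharIndex p) : charHom hq χ (intervalCls hq b i ℓ) = MonoidAlgebra.single (degProd q b)
      (match χ with
        | .dim k => if cycDist (i + 1) k ≤ ℓ then 1 else 0
        | _ => 0) := by
  rw [intervalCls, dif_pos h, charHom_cls]
  congr 1
  cases χ with
  | dim k => exact char_dim_interval hℓ k
  | x n => exact char_x_interval hℓ n
  | y n => exact char_y_interval hℓ n

theorem charHom_circleCls {b : ZMod p → ℕ} {w : ZMod p → Letter} (h : IsWord b w) (ξ : ℂˣ)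
    (χ : CharIndex p) : charHom hq χ (circleCls hq b w ξ) = MonoidAlgebra.single (degProd q b)
      (match χ with
        | .dim _ => 1
        | .x n => (ξ * ∏ k, (w k).xCoeff
            (evalAt (qpow q k) (degProd q b : LaurentPolynomial ℂ))) ^ (n + 1)
        | .y n => ((ξ⁻¹ : ℂˣ) * ∏ k, (w k).yCoeff) ^ (n + 1)) := by
  rw [circleCls, dif_pos h, charHom_cls]
  congr 1
  cases χ with
  | dim k => exact char_dim_circle k
  | x n => exact char_x_circle n
  | y n => exact char_y_circle n

/-- The parameter of the `x`-circle is rescaled by `monRatio` precisely to give it the monodromy of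
the product of the `y_k`. The `y`-circle needs no rescaling, as its coefficients of `Y` are all `1`.
-/
theorem charHom_basicClass (χ : CharIndex p) (n : NormalForm p) :
    charHom hq χ (basicClass hq n) = MonoidAlgebra.single (degProd q n.deg) (n.val q χ) := by
  cases n with
  | xx i j h a ha =>
    have hlt := ZMod.val_lt (j - i)
    rw [basicClass, charHom_intervalCls isGap_xx (by omega)]
    congr 1
    cases χ with
    | dim k =>
      simp only [NormalForm.val, NormalForm.dim, arcInd]
      by_cases hc : CycLtLe i k j
      · rw [if_pos hc, if_pos ((cycDist_succ_left_le_iff h k).mpr hc)]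
      · rw [if_neg hc, if_neg (mt (cycDist_succ_left_le_iff h k).mp hc)]
    | x m => simp [NormalForm.val, NormalForm.monX]
    | y m => simp [NormalForm.val, NormalForm.monY]
  | xPow i a ha =>
    rw [basicClass, charHom_intervalCls (isGap_single i ha) pred_lt, NormalForm.deg]
    congr 1
    cases χ with
    | dim k =>
      have := cycDist_lt (i + 1) k
      exact if_pos (by omega)
    | x m => simp [NormalForm.val, NormalForm.monX]
    | y m => simp [NormalForm.val, NormalForm.monY]
  | u ξ =>
    rw [basicClass, charHom_circleCls (isWord_supportWord (by decide) 0), NormalForm.deg]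
    congr 1
    cases χ with
    | dim k => rfl
    | x m => simp [NormalForm.val, NormalForm.monX, supportWord, Letter.xCoeff, degProd_zero]
    | y m => simp [NormalForm.val, NormalForm.monY, supportWord, Letter.yCoeff]
  | uy ξ a ha =>
    rw [basicClass, charHom_circleCls (isWord_supportWord (by decide) a), NormalForm.deg]
    congr 1
    cases χ with
    | dim k => rfl
    | x m =>
      simp only [NormalForm.val, NormalForm.monX]
      rw [Units.val_mul, mul_assoc, monRatio_mul_prod]
    | y m =>
      obtain ⟨k, hk : a k ≠ 0⟩ := Function.ne_iff.mp ha
      simp only [NormalForm.val, NormalForm.monY]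
      rw [Finset.prod_eq_zero (Finset.mem_univ k), mul_zero]
      rw [supportWord, if_neg hk]
      rfl
  | uyStar ξ a ha =>
    rw [basicClass, charHom_circleCls (isWord_supportWord (by decide) a), NormalForm.deg]
    congr 1
    cases χ with
    | dim k => rfl
    | x m =>
      obtain ⟨k, hk : a k ≠ 0⟩ := Function.ne_iff.mp ha
      simp only [NormalForm.val, NormalForm.monX]
      rw [Finset.prod_eq_zero (Finset.mem_univ k), mul_zero]
      rw [supportWord, if_neg hk]
      rfl
    | y m =>
      simp only [NormalForm.val, NormalForm.monY]
      rw [Finset.prod_eq_one, mul_one]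
      intro k _
      unfold supportWord
      split_ifs <;> rfl

/-- A gap of full length `ℓ + 1 = p` means a single break, hence a power of `x_i`. Otherwise the
endpoints differ, and the exponents are those of `b` lowered by one at each end. Since `intervalCls`
has a default value and is total, equalities of its arguments can be rewritten without transporting
proofs. -/
theorem exists_basicClass_eq_intervalCls {b : ZMod p → ℕ} {i : ZMod p} {ℓ : ℕ} (h : IsGap b i ℓ)
    (hℓ : ℓ < p) : ∃ n, basicClass hq n = intervalCls hq b i ℓ := by
  obtain ⟨hi, hj, hk⟩ := h
  by_cases hp : ℓ + 1 = p
  · obtain rfl : ℓ = p - 1 := by omega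
    have hb : b = Pi.single i (b i) := by
      refine funext fun k => ?_
      by_cases hki : k = i
      · subst hki; simp
      · rw [Pi.single_eq_of_ne hki]
        have h1 := cycDist_lt (i + 1) k
        have h2 := add_succ_cycDist i k
        have h3 : cycDist (i + 1) k ≠ p - 1 := fun h3 => by
          rw [h3, add_one_add_pred] at h2
          exact hki h2.symm
        rw [← h2]
        exact hk _ (by omega)
    refine ⟨.xPow i (b i) (Nat.pos_of_ne_zero hi), ?_⟩
    rw [basicClass, ← hb]
  · have hd := cycDist_add_succ i (m := ℓ) (by omega)
    set j := i + 1 + (ℓ : ZMod p) with hjdef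
    have hij : i ≠ j := fun h => by
      rw [← h, cycDist_self] at hd
      omega
    -- The truncated subtractions are exact because `b` is positive at both ends of a gap.
    have hb : (b - Pi.single i 1 - Pi.single j 1) + Pi.single i 1 + Pi.single j 1 = b := by
      refine funext fun k => ?_
      by_cases hki : k = i
      · subst hki
        simp only [Pi.add_apply, Pi.sub_apply, Pi.single_eq_same, Pi.single_eq_of_ne hij]
        omega
      · by_cases hkj : k = j
        · subst hkj
          simp only [Pi.add_apply, Pi.sub_apply, Pi.single_eq_same, Pi.single_eq_of_ne hki]
          omega
        · simp [Pi.single_eq_of_ne hki, Pi.single_eq_of_ne hkj]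
    -- A point outside the arc from `j` to `i` lies strictly between `i` and `j`, where a gap has no
    -- breaks.
    have ha : ∀ k, (b - Pi.single i 1 - Pi.single j 1 : ZMod p → ℕ) k ≠ 0 →
        CycLeLe j k i := fun k hk0 => by
      by_contra hc
      refine hk0 ?_
      have h2 := add_succ_cycDist i k
      have h3 : b k = 0 := by
        rw [← h2]
        refine hk _ ?_
        have h4 := cycDist_succ_left i k
        unfold CycLeLe at hc
        have h5 := cycDist_cases i j k
        have h6 := cycDist_cases i j i
        have h7 := cycDist_self i
        have h8 := cycDist_lt i k
        have h9 : k ≠ i := by rintro rfl; omega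
        rw [if_neg h9] at h4
        have h10 := cycDist_ne (o := i) h9
        omega
      simp [h3]
    have hdeg : (NormalForm.xx i j hij _ ha).deg = b := hb
    have hl : (j - i).val - 1 = ℓ := by
      change cycDist i j - 1 = ℓ
      omega
    exact ⟨.xx i j hij _ ha, by rw [basicClass, hdeg, hl]⟩

/-- A basic module is determined by its breaks and its parameter, which are the data of a normal
form. A circle without breaks is `u_ξ`; it is counted with the `x`-circles, and the letter `y`
demanded of a `y`-circle ensures that `b ≠ 0`. -/
theorem exists_basicClass_eq_cls {b : ZMod p → ℕ}
    {S : WMod (unitOrbit hq) (degProd q b : LaurentPolynomial ℂ)} (hS : S.IsBasic) :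
    ∃ n, basicClass hq n = cls (degProd q b).2 S := by
  have hword : ∀ w : ZMod p → Letter,
      (∀ k, w k = .one ↔ evalAt (qpow q k) (degProd q b : LaurentPolynomial ℂ) ≠ 0) →
      IsWord b w := fun w hw k => by
    rw [hw k, ne_eq, evalAt_degProd_eq_zero hq, not_not]
  cases hS with
  | interval i ℓ hℓ hi hj hk =>
    have h : IsGap b i ℓ := ⟨(evalAt_degProd_eq_zero hq b i).mp hi,
      (evalAt_degProd_eq_zero hq b _).mp hj, fun m hm => by
        by_contra h0
        exact hk m hm ((evalAt_degProd_eq_zero hq b _).mpr h0)⟩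
    obtain ⟨n, hn⟩ := exists_basicClass_eq_intervalCls (hq := hq) h hℓ
    exact ⟨n, hn.trans (by rw [intervalCls, dif_pos h])⟩
  | circleX w hw ξ h =>
    have h1 := hword w hw
    have h2 : cls (degProd q b).2 (circleModule hq (degProd q b) w hw ξ) =
        circleCls hq b (supportWord .x b) ξ := by
      rw [← h1.eq_supportWord h, circleCls, dif_pos h1]
    rw [h2]
    by_cases hb : b = 0
    · subst hb
      exact ⟨.u ξ, rfl⟩
    · refine ⟨.uy (ξ * (monRatio hq b)⁻¹) b hb, ?_⟩
      rw [basicClass, inv_mul_cancel_right]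
  | circleY w hw ξ h h' =>
    have h1 := hword w hw
    have h2 : cls (degProd q b).2 (circleModule hq (degProd q b) w hw ξ) =
        circleCls hq b (supportWord .y b) ξ := by
      rw [← h1.eq_supportWord h, circleCls, dif_pos h1]
    obtain ⟨k, hk⟩ := h'
    have hb : b ≠ 0 := fun hb => by
      have := (h1 k).mpr (congrFun hb k)
      rw [hk] at this
      cases this
    exact ⟨.uyStar ξ b hb, h2.symm⟩

theorem span_range_basicClass (hq : IsPrimitiveRoot q p) :
    Submodule.span ℂ (Set.range (basicClass hq)) = ⊤ := by
  -- It suffices that the projection modulo the span kills all classes of modules, and by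
  -- `K0.mk_mem_of_basic` only basic modules have to be inspected.
  have key : (Submodule.span ℂ (Set.range (basicClass hq))).mkQ = 0 := by
    refine GrothendieckRing.hom_ext fun t ht V => ?_
    obtain ⟨b, rfl⟩ := exists_eq_degProd ht
    rw [LinearMap.zero_apply, Submodule.mkQ_apply, Submodule.Quotient.mk_eq_zero]
    let φ : K0 (unitOrbit hq) (degProd q b : LaurentPolynomial ℂ) →+
        GrothendieckRing (unitOrbit hq) (breakMonoid p q) :=
      (incl (unitOrbit hq) ht).toAddMonoidHom.comp
        (TensorProduct.mk ℤ ℂ (K0 (unitOrbit hq) (degProd q b : LaurentPolynomial ℂ))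
          1).toAddMonoidHom
    refine K0.mk_mem_of_basic ((Submodule.span ℂ
      (Set.range (basicClass hq))).toAddSubgroup.comap φ) (fun S hS => ?_) V
    obtain ⟨n, hn⟩ := exists_basicClass_eq_cls hS
    exact Submodule.subset_span ⟨n, hn⟩
  rw [← Submodule.ker_mkQ (Submodule.span ℂ (Set.range (basicClass hq))), key, LinearMap.ker_zero]

end BasicClasses

/-! ### Reduction to normal forms -/

section Reduction

variable {p : ℕ} [NeZero p] {A : Type*} [CommRing A] [Algebra ℂ A]

theorem mul_prod_pow (c : ZMod p → A) (a : ZMod p → ℕ) (k : ZMod p) :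
    c k * ∏ l, c l ^ a l = ∏ l, c l ^ (a + Pi.single k 1 : ZMod p → ℕ) l := by
  simp only [Pi.add_apply, pow_add, Finset.prod_mul_distrib]
  rw [mul_comm, Finset.prod_eq_single (f := fun l => c l ^ (Pi.single k 1 : ZMod p → ℕ) l) k]
  · rw [Pi.single_eq_same, pow_one]
  · intro l _ hl
    rw [Pi.single_eq_of_ne hl, pow_zero]
  · exact fun h => absurd (Finset.mem_univ k) h

theorem prod_pow_eq_mul (c : ZMod p → A) {a : ZMod p → ℕ} {k : ZMod p} (hk : a k ≠ 0) :
    ∏ l, c l ^ a l = c k * ∏ l, c l ^ (a - Pi.single k 1 : ZMod p → ℕ) l := by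
  rw [mul_prod_pow]
  refine Finset.prod_congr rfl fun l _ => ?_
  by_cases hl : l = k
  · subst hl
    simp only [Pi.add_apply, Pi.sub_apply, Pi.single_eq_same]
    rw [Nat.sub_add_cancel (Nat.pos_of_ne_zero hk)]
  · simp [Pi.single_eq_of_ne hl]

/-- The normal form monomials in elements `f g` of an algebra. -/
def normalMonomial (f : Gen p → A) : NormalForm p → A
  | .xx i j h a _ => f (.xx i j h) * ∏ k, f (.x k) ^ a k
  | .xPow i a _ => f (.x i) ^ a
  | .u ξ => f (.u ξ)
  | .uy ξ a _ => f (.u ξ) * ∏ k, f (.y k) ^ a k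
  | .uyStar ξ a _ => f (.u ξ) * ∏ k, f (.yStar k) ^ a k

/-- The elements `f g` satisfy the defining relations. -/
def SatisfiesRel (f : Gen p → A) : Prop :=
  ∀ a b, GrothendieckRel a b → MvPolynomial.aeval f a = MvPolynomial.aeval f b

/-- The span of the monomials that contain some `x_i` or some `x_{ij}`, and no other generators. -/
def xSpan (f : Gen p → A) : Submodule ℂ A :=
  Submodule.span ℂ ({m | ∃ i j h, ∃ a : ZMod p → ℕ, m = f (.xx i j h) * ∏ k, f (.x k) ^ a k} ∪
    {m | ∃ a : ZMod p → ℕ, a ≠ 0 ∧ m = ∏ k, f (.x k) ^ a k})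

variable {f : Gen p → A}

theorem xx_mul_prod_mem_xSpan (i j : ZMod p) (h : i ≠ j) (a : ZMod p → ℕ) :
    f (.xx i j h) * ∏ k, f (.x k) ^ a k ∈ xSpan f :=
  Submodule.subset_span (Or.inl ⟨i, j, h, a, rfl⟩)

theorem prod_mem_xSpan {a : ZMod p → ℕ} (ha : a ≠ 0) : ∏ k, f (.x k) ^ a k ∈ xSpan f :=
  Submodule.subset_span (Or.inr ⟨a, ha, rfl⟩)

theorem mul_mem_of_mem_span {N : Submodule ℂ A} {s : Set A} {c : A} (h : ∀ m ∈ s, c * m ∈ N)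
    {x : A} (hx : x ∈ Submodule.span ℂ s) : c * x ∈ N := by
  have h1 : Submodule.span ℂ s ≤ N.comap (LinearMap.mulLeft ℂ c) := Submodule.span_le.mpr h
  exact h1 hx

theorem x_mul_mem_xSpan (k : ZMod p) {m : A} (hm : m ∈ xSpan f) : f (.x k) * m ∈ xSpan f := by
  refine mul_mem_of_mem_span ?_ hm
  rintro _ (⟨i, j, h, a, rfl⟩ | ⟨a, ha, rfl⟩)
  · rw [mul_left_comm, mul_prod_pow (fun k => f (.x k))]
    exact xx_mul_prod_mem_xSpan i j h _
  · rw [mul_prod_pow (fun k => f (.x k))]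
    refine prod_mem_xSpan fun h => ?_
    have := congrFun h k
    simp at this

namespace SatisfiesRel

theorem u_one (hf : SatisfiesRel f) : f (.u 1) = 1 := by
  simpa only [map_one, MvPolynomial.aeval_X] using hf _ _ .u_one

theorem u_mul_u (hf : SatisfiesRel f) (ξ ξ' : ℂˣ) : f (.u ξ) * f (.u ξ') = f (.u (ξ * ξ')) := by
  simpa only [map_mul, MvPolynomial.aeval_X] using hf _ _ (.u_mul ξ ξ')

theorem u_mul_x (hf : SatisfiesRel f) (ξ : ℂˣ) (i : ZMod p) : f (.u ξ) * f (.x i) = f (.x i) := by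
  simpa only [map_mul, MvPolynomial.aeval_X] using hf _ _ (.u_x ξ i)

theorem u_mul_xx (hf : SatisfiesRel f) (ξ : ℂˣ) (i j : ZMod p) (h : i ≠ j) :
    f (.u ξ) * f (.xx i j h) = f (.xx i j h) := by
  simpa only [map_mul, MvPolynomial.aeval_X] using hf _ _ (.u_xx ξ i j h)

theorem x_mul_x (hf : SatisfiesRel f) {i j : ZMod p} (h : i ≠ j) :
    f (.x i) * f (.x j) = f (.xx i j h) + f (.xx j i h.symm) := by
  simpa only [map_mul, map_add, MvPolynomial.aeval_X] using hf _ _ (.x_x i j h)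

/-- In the presence of an `x_i` the generator `y_j` acts like `x_j`, also for `i = j`. The same
holds for `y_j^*`. -/
theorem x_mul_y (hf : SatisfiesRel f) (i j : ZMod p) :
    f (.x i) * f (.y j) = f (.x i) * f (.x j) := by
  by_cases h : i = j
  · subst h
    simpa only [map_mul, map_pow, sq, MvPolynomial.aeval_X] using hf _ _ (.x_y_self i)
  · rw [hf.x_mul_x h]
    simpa only [map_mul, map_add, MvPolynomial.aeval_X] using hf _ _ (.x_y i j h)

theorem x_mul_yStar (hf : SatisfiesRel f) (i j : ZMod p) :
    f (.x i) * f (.yStar j) = f (.x i) * f (.x j) := by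
  by_cases h : i = j
  · subst h
    simpa only [map_mul, map_pow, sq, MvPolynomial.aeval_X] using hf _ _ (.x_yStar_self i)
  · rw [hf.x_mul_x h]
    simpa only [map_mul, map_add, MvPolynomial.aeval_X] using hf _ _ (.x_yStar i j h)

theorem y_mul_yStar (hf : SatisfiesRel f) (i j : ZMod p) :
    f (.y i) * f (.yStar j) = f (.x i) * f (.x j) := by
  by_cases h : i = j
  · subst h
    simpa only [map_mul, map_pow, sq, MvPolynomial.aeval_X] using hf _ _ (.y_yStar_self i)
  · rw [hf.x_mul_x h]
    simpa only [map_mul, map_add, MvPolynomial.aeval_X] using hf _ _ (.y_yStar i j h)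

theorem xx_mul_y (hf : SatisfiesRel f) (i j k : ZMod p) (h : i ≠ j) :
    f (.xx i j h) * f (.y k) = f (.xx i j h) * f (.x k) := by
  simpa only [map_mul, MvPolynomial.aeval_X] using hf _ _ (.xx_y i j k h)

theorem xx_mul_yStar (hf : SatisfiesRel f) (i j k : ZMod p) (h : i ≠ j) :
    f (.xx i j h) * f (.yStar k) = f (.xx i j h) * f (.x k) := by
  simpa only [map_mul, MvPolynomial.aeval_X] using hf _ _ (.xx_yStar i j k h)

theorem xx_mul_x (hf : SatisfiesRel f) {i j k : ZMod p} (hij : i ≠ j) (hik : i ≠ k) (hkj : k ≠ j)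
    (h : CycLtLt i k j) : f (.xx i j hij) * f (.x k) =
      f (.xx i k hik) * f (.x j) + f (.xx k j hkj) * f (.x i) := by
  simpa only [map_mul, map_add, MvPolynomial.aeval_X] using hf _ _ (.xx_x i j k hij hik hkj h)

theorem xx_mul_xx_overlap (hf : SatisfiesRel f) {i j k l : ZMod p} (hij : i ≠ j) (hkl : k ≠ l)
    (hkj : k ≠ j) (h : CycLeLt i k j ∧ CycLtLe k j l ∧ CycLeLe j l i) :
    f (.xx i j hij) * f (.xx k l hkl) = f (.xx k j hkj) * f (.x i) * f (.x l) := by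
  simpa only [map_mul, MvPolynomial.aeval_X] using
    hf _ _ (.xx_xx_overlap i j k l hij hkl hkj h)

theorem xx_mul_xx_nested (hf : SatisfiesRel f) {i j k l : ZMod p} (hij : i ≠ j) (hkl : k ≠ l)
    (h : CycLeLt i k l ∧ CycLtLe k l j ∧ CycLeLe l j i) :
    f (.xx i j hij) * f (.xx k l hkl) = f (.xx k l hkl) * f (.x i) * f (.x j) := by
  simpa only [map_mul, MvPolynomial.aeval_X] using hf _ _ (.xx_xx_nested i j k l hij hkl h)

/-- The product of two elements `x_{ij}` in terms of products with a single factor of this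
kind. -/
theorem xx_mul_xx (hf : SatisfiesRel f) (i j k l : ZMod p) (hij : i ≠ j) (hkl : k ≠ l) :
    f (.xx i j hij) * f (.xx k l hkl) = 0 ∨
    (∃ a b c d, ∃ h : a ≠ b,
      f (.xx i j hij) * f (.xx k l hkl) = f (.xx a b h) * f (.x c) * f (.x d)) ∨
    ∃ a b c d a' b' c' d', ∃ (h : a ≠ b) (h' : a' ≠ b'), f (.xx i j hij) * f (.xx k l hkl) =
      f (.xx a b h) * f (.x c) * f (.x d) + f (.xx a' b' h') * f (.x c') * f (.x d') := by
  have eii := cycDist_self i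
  have hD := cycDist_ne (o := i) hij
  have hKL := cycDist_ne (o := i) hkl
  have b1 := cycDist_lt i j
  have b2 := cycDist_lt i k
  have b3 := cycDist_lt i l
  have jk := cycDist_cases i j k
  have jl := cycDist_cases i j l
  have ji := cycDist_cases i j i
  have kj := cycDist_cases i k j
  have kl := cycDist_cases i k l
  have ki := cycDist_cases i k i
  have lj := cycDist_cases i l j
  have lk := cycDist_cases i l k
  have li := cycDist_cases i l i
  -- The cases record whether the second arc starts inside the first and whether it ends inside the
  -- first. Both: it is contained in the first, or the two arcs cover the circle. One: a simple
  -- overlap, in one of the two orders. Neither: the arcs are disjoint, or the second contains the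
  -- first.
  by_cases hK : cycDist i k < cycDist i j <;>
    by_cases hL : 0 < cycDist i l ∧ cycDist i l ≤ cycDist i j
  · by_cases hlt : cycDist i k < cycDist i l
    · exact Or.inr (Or.inl ⟨_, _, _, _, _, hf.xx_mul_xx_nested hij hkl
        (by unfold CycLeLt CycLtLe CycLeLe; omega)⟩)
    · have hil : i ≠ l := by rintro rfl; omega
      have hkj : k ≠ j := by rintro rfl; omega
      have h := hf _ _ (.xx_xx_twice i j k l hij hkl hil hkj
        (by unfold CycLtLt CycLtLe; omega))
      simp only [map_mul, map_add, MvPolynomial.aeval_X] at h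
      exact Or.inr (Or.inr ⟨_, _, _, _, _, _, _, _, _, _, h⟩)
  · have hkj : k ≠ j := by rintro rfl; omega
    exact Or.inr (Or.inl ⟨_, _, _, _, _, hf.xx_mul_xx_overlap hij hkl hkj
      (by unfold CycLeLt CycLtLe CycLeLe; omega)⟩)
  · have hil : i ≠ l := by rintro rfl; omega
    exact Or.inr (Or.inl ⟨_, _, _, _, _, (mul_comm _ _).trans (hf.xx_mul_xx_overlap hkl hij hil
      (by unfold CycLeLt CycLtLe CycLeLe; omega))⟩)
  · by_cases hlt : cycDist i l = 0 ∨ cycDist i k < cycDist i l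
    · have h := hf _ _ (.xx_xx_disjoint i j k l hij hkl
        (by unfold CycLeLt CycLtLe; omega))
      simp only [map_mul, map_zero, MvPolynomial.aeval_X] at h
      exact Or.inl h
    · exact Or.inr (Or.inl ⟨_, _, _, _, _, (mul_comm _ _).trans (hf.xx_mul_xx_nested hkl hij
        (by unfold CycLeLt CycLtLe CycLeLe; omega))⟩)

/-- A factor `x_i` or `x_{ij}` absorbs `u_ξ`, turns `y_k` and `y_k^*` into `x_k`, and a product of
two elements `x_{ij}` contains at most one such factor per term after rewriting. -/
theorem gen_mul_mem_xSpan (hf : SatisfiesRel f) (g : Gen p) {m : A} (hm : m ∈ xSpan f) :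
    f g * m ∈ xSpan f := by
  have hmem : ∀ {a b : ZMod p} (h : a ≠ b) (c d : ZMod p) (e : ZMod p → ℕ),
      f (.xx a b h) * f (.x c) * f (.x d) * ∏ k, f (.x k) ^ e k ∈ xSpan f := fun {a b} h c d e => by
    have h1 := x_mul_mem_xSpan c (x_mul_mem_xSpan d (xx_mul_prod_mem_xSpan (f := f) a b h e))
    convert h1 using 1
    ring
  cases g with
  | x k => exact x_mul_mem_xSpan k hm
  | u ξ =>
    refine mul_mem_of_mem_span ?_ hm
    rintro _ (⟨i, j, h, a, rfl⟩ | ⟨a, ha, rfl⟩)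
    · rw [← mul_assoc, hf.u_mul_xx]
      exact xx_mul_prod_mem_xSpan i j h a
    · have hm := prod_mem_xSpan (f := f) ha
      obtain ⟨i, hi⟩ := Function.ne_iff.mp ha
      rw [prod_pow_eq_mul (fun k => f (.x k)) hi] at hm ⊢
      rwa [← mul_assoc, hf.u_mul_x]
  | y k =>
    refine mul_mem_of_mem_span ?_ hm
    rintro _ (⟨i, j, h, a, rfl⟩ | ⟨a, ha, rfl⟩)
    · have h1 := x_mul_mem_xSpan k (xx_mul_prod_mem_xSpan (f := f) i j h a)
      convert h1 using 1
      linear_combination (∏ k, f (.x k) ^ a k) * hf.xx_mul_y i j k h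
    · have h1 := x_mul_mem_xSpan k (prod_mem_xSpan (f := f) ha)
      obtain ⟨i, hi⟩ := Function.ne_iff.mp ha
      rw [prod_pow_eq_mul (fun k => f (.x k)) hi] at h1 ⊢
      convert h1 using 1
      linear_combination (∏ l, f (.x l) ^ (a - Pi.single i 1 : ZMod p → ℕ) l) * hf.x_mul_y i k
  | yStar k =>
    refine mul_mem_of_mem_span ?_ hm
    rintro _ (⟨i, j, h, a, rfl⟩ | ⟨a, ha, rfl⟩)
    · have h1 := x_mul_mem_xSpan k (xx_mul_prod_mem_xSpan (f := f) i j h a)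
      convert h1 using 1
      linear_combination (∏ k, f (.x k) ^ a k) * hf.xx_mul_yStar i j k h
    · have h1 := x_mul_mem_xSpan k (prod_mem_xSpan (f := f) ha)
      obtain ⟨i, hi⟩ := Function.ne_iff.mp ha
      rw [prod_pow_eq_mul (fun k => f (.x k)) hi] at h1 ⊢
      convert h1 using 1
      linear_combination (∏ l, f (.x l) ^ (a - Pi.single i 1 : ZMod p → ℕ) l) * hf.x_mul_yStar i k
  | xx k l hkl =>
    refine mul_mem_of_mem_span ?_ hm
    rintro _ (⟨i, j, h, a, rfl⟩ | ⟨a, ha, rfl⟩)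
    · rw [← mul_assoc]
      rcases hf.xx_mul_xx k l i j hkl h with h1 | ⟨_, _, _, _, _, h1⟩ |
        ⟨_, _, _, _, _, _, _, _, _, _, h1⟩ <;> rw [h1]
      · rw [zero_mul]
        exact zero_mem _
      · exact hmem _ _ _ _
      · rw [add_mul]
        exact add_mem (hmem _ _ _ _) (hmem _ _ _ _)
    · exact xx_mul_prod_mem_xSpan k l hkl a

/-- A factor `x_k` with `k` strictly inside the arc of `x_{ij}` is removed by splitting the arc at
`k`. Both resulting arcs are shorter, so induction on the length terminates although the number of
factors stays the same. -/
theorem xx_mul_prod_mem_span (hf : SatisfiesRel f) (i j : ZMod p) (h : i ≠ j) (a : ZMod p → ℕ) :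
    f (.xx i j h) * ∏ k, f (.x k) ^ a k ∈ Submodule.span ℂ (Set.range (normalMonomial f)) := by
  induction hn : cycDist i j using Nat.strong_induction_on generalizing i j a with
  | _ n ih =>
    subst hn
    by_cases ha : ∀ k, a k ≠ 0 → CycLeLe j k i
    · exact Submodule.subset_span ⟨.xx i j h a ha, rfl⟩
    · push Not at ha
      obtain ⟨k, hk, hjk⟩ := ha
      unfold CycLeLe at hjk
      have eii := cycDist_self i
      have h1 := cycDist_cases i j k
      have h2 := cycDist_cases i j i
      have h3 := cycDist_cases i k j
      have h4 := cycDist_lt i k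
      have hD := cycDist_ne (o := i) h
      have hki : i ≠ k := by rintro rfl; omega
      have hkj : k ≠ j := by rintro rfl; omega
      have h5 := cycDist_ne (o := i) hki
      have h6 := cycDist_ne (o := i) hkj
      have hlt : CycLtLt i k j := by unfold CycLtLt; omega
      rw [prod_pow_eq_mul (fun k => f (.x k)) hk, ← mul_assoc, hf.xx_mul_x h hki hkj hlt, add_mul,
        mul_assoc, mul_assoc, mul_prod_pow (fun k => f (.x k)), mul_prod_pow (fun k => f (.x k))]
      exact add_mem (ih _ (by omega) i k hki _ rfl) (ih _ (by omega) k j hkj _ rfl)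

theorem xSpan_le (hf : SatisfiesRel f) :
    xSpan f ≤ Submodule.span ℂ (Set.range (normalMonomial f)) := by
  refine Submodule.span_le.mpr ?_
  rintro _ (⟨i, j, h, a, rfl⟩ | ⟨a, ha, rfl⟩)
  · exact hf.xx_mul_prod_mem_span i j h a
  · obtain ⟨i, hi : a i ≠ 0⟩ := Function.ne_iff.mp ha
    -- A product with only one index is a power of `x_i`. Two distinct indices produce factors
    -- `x_{ij}` and `x_{ji}`, which reduces to the preceding lemma.
    by_cases hs : ∀ k, k ≠ i → a k = 0
    · refine Submodule.subset_span ⟨.xPow i (a i) (Nat.pos_of_ne_zero hi), ?_⟩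
      refine (Finset.prod_eq_single (f := fun k => f (.x k) ^ a k) i (fun k _ hk => ?_)
        (fun h => ?_)).symm
      · rw [hs k hk, pow_zero]
      · exact absurd (Finset.mem_univ i) h
    · push Not at hs
      obtain ⟨k, hki, hk⟩ := hs
      rw [prod_pow_eq_mul (fun k => f (.x k)) hi, prod_pow_eq_mul (fun k => f (.x k)) (k := k),
        ← mul_assoc, hf.x_mul_x hki.symm, add_mul]
      · exact add_mem (hf.xx_mul_prod_mem_span _ _ _ _) (hf.xx_mul_prod_mem_span _ _ _ _)
      · simpa [Pi.single_eq_of_ne hki] using hk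

theorem u_mul_prod_y_mem (ξ : ℂˣ) (a : ZMod p → ℕ) :
    f (.u ξ) * ∏ k, f (.y k) ^ a k ∈ Submodule.span ℂ (Set.range (normalMonomial f)) := by
  by_cases ha : a = 0
  · subst ha
    exact Submodule.subset_span ⟨.u ξ, by simp [normalMonomial]⟩
  · exact Submodule.subset_span ⟨.uy ξ a ha, rfl⟩

theorem u_mul_prod_yStar_mem (ξ : ℂˣ) (a : ZMod p → ℕ) :
    f (.u ξ) * ∏ k, f (.yStar k) ^ a k ∈ Submodule.span ℂ (Set.range (normalMonomial f)) := by
  by_cases ha : a = 0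
  · subst ha
    exact Submodule.subset_span ⟨.u ξ, by simp [normalMonomial]⟩
  · exact Submodule.subset_span ⟨.uyStar ξ a ha, rfl⟩

/-- If the `f g` generate the algebra, then the monomials containing some `x_i` or `x_{ij}` span
an ideal. -/
theorem mul_mem_xSpan (hf : SatisfiesRel f)
    (hsurj : Function.Surjective (MvPolynomial.aeval (R := ℂ) f))
    (c : A) {m : A} (hm : m ∈ xSpan f) : c * m ∈ xSpan f := by
  obtain ⟨P, rfl⟩ := hsurj c
  induction P using MvPolynomial.induction_on generalizing m with
  | C z =>
    rw [MvPolynomial.aeval_C, ← Algebra.smul_def]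
    exact Submodule.smul_mem _ _ hm
  | add P Q hP hQ =>
    rw [map_add, add_mul]
    exact add_mem (hP hm) (hQ hm)
  | mul_X P g hP =>
    rw [map_mul, MvPolynomial.aeval_X, mul_assoc]
    exact hP (hf.gen_mul_mem_xSpan g hm)

theorem x_mem_xSpan (i : ZMod p) : f (.x i) ∈ xSpan f := by
  have h := prod_mem_xSpan (f := f) (a := Pi.single i 1) (fun h => by
    have := congrFun h i
    simp at this)
  rwa [show (Pi.single i 1 : ZMod p → ℕ) = 0 + Pi.single i 1 from (zero_add _).symm,
    ← mul_prod_pow (fun k => f (.x k)), Finset.prod_eq_one, mul_one] at h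
  exact fun k _ => pow_zero _

theorem xx_mem_xSpan (i j : ZMod p) (h : i ≠ j) : f (.xx i j h) ∈ xSpan f := by
  have h := xx_mul_prod_mem_xSpan (f := f) i j h 0
  rwa [Finset.prod_eq_one, mul_one] at h
  exact fun k _ => pow_zero _

/-- If a generator `x_i` or `x_{ij}` appears on either side, the product lies in the ideal `xSpan`.
Otherwise the families `u y` and `u y^*` are closed under multiplication, except that a `y` meeting
a `y^*` produces a product of two `x`. -/
theorem gen_mul_normalMonomial_mem (hf : SatisfiesRel f)
    (hsurj : Function.Surjective (MvPolynomial.aeval (R := ℂ) f)) (g : Gen p) (n : NormalForm p) :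
    f g * normalMonomial f n ∈ Submodule.span ℂ (Set.range (normalMonomial f)) := by
  have hx : ∀ i c, f (.x i) * c ∈ Submodule.span ℂ (Set.range (normalMonomial f)) := fun i c => by
    rw [mul_comm]
    exact hf.xSpan_le (hf.mul_mem_xSpan hsurj c (x_mem_xSpan i))
  have hxx : ∀ i j h c, f (.xx i j h) * c ∈ Submodule.span ℂ (Set.range (normalMonomial f)) :=
    fun i j h c => by
      rw [mul_comm]
      exact hf.xSpan_le (hf.mul_mem_xSpan hsurj c (xx_mem_xSpan i j h))
  cases n with
  | xx i j h a ha =>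
    rw [normalMonomial, mul_left_comm]
    exact hxx i j h _
  | xPow i a ha =>
    rw [normalMonomial, ← Nat.sub_add_cancel ha, pow_succ', mul_left_comm]
    exact hx i _
  | u ξ =>
    rw [normalMonomial]
    cases g with
    | x k => exact hx k _
    | xx i j h => exact hxx i j h _
    | u ξ' =>
      rw [hf.u_mul_u]
      exact Submodule.subset_span ⟨.u _, rfl⟩
    | y k =>
      have h := u_mul_prod_y_mem (f := f) ξ (0 + Pi.single k 1)
      rw [← mul_prod_pow (fun k => f (.y k)), Finset.prod_eq_one, mul_one, mul_comm] at h
      · exact h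
      · exact fun k _ => pow_zero _
    | yStar k =>
      have h := u_mul_prod_yStar_mem (f := f) ξ (0 + Pi.single k 1)
      rw [← mul_prod_pow (fun k => f (.yStar k)), Finset.prod_eq_one, mul_one, mul_comm] at h
      · exact h
      · exact fun k _ => pow_zero _
  | uy ξ a ha =>
    rw [normalMonomial]
    cases g with
    | x k => exact hx k _
    | xx i j h => exact hxx i j h _
    | u ξ' =>
      rw [← mul_assoc, hf.u_mul_u]
      exact u_mul_prod_y_mem _ a
    | y k =>
      rw [mul_left_comm, mul_prod_pow (fun k => f (.y k))]
      exact u_mul_prod_y_mem _ _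
    | yStar k =>
      obtain ⟨i, hi⟩ := Function.ne_iff.mp ha
      rw [prod_pow_eq_mul (fun k => f (.y k)) hi]
      convert hx i (f (.x k) * f (.u ξ) *
        ∏ l, f (.y l) ^ (a - Pi.single i 1 : ZMod p → ℕ) l) using 1
      linear_combination (f (.u ξ) * ∏ l, f (.y l) ^ (a - Pi.single i 1 : ZMod p → ℕ) l) *
        hf.y_mul_yStar i k
  | uyStar ξ a ha =>
    rw [normalMonomial]
    cases g with
    | x k => exact hx k _
    | xx i j h => exact hxx i j h _
    | u ξ' =>
      rw [← mul_assoc, hf.u_mul_u]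
      exact u_mul_prod_yStar_mem _ a
    | yStar k =>
      rw [mul_left_comm, mul_prod_pow (fun k => f (.yStar k))]
      exact u_mul_prod_yStar_mem _ _
    | y k =>
      obtain ⟨i, hi⟩ := Function.ne_iff.mp ha
      rw [prod_pow_eq_mul (fun k => f (.yStar k)) hi]
      convert hx k (f (.x i) * f (.u ξ) *
        ∏ l, f (.yStar l) ^ (a - Pi.single i 1 : ZMod p → ℕ) l) using 1
      linear_combination (f (.u ξ) * ∏ l, f (.yStar l) ^ (a - Pi.single i 1 : ZMod p → ℕ) l) *
        hf.y_mul_yStar k i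

/-- If the `f g` generate the algebra, then the normal form monomials span it. -/
theorem span_normalMonomial (hf : SatisfiesRel f)
    (hsurj : Function.Surjective (MvPolynomial.aeval (R := ℂ) f)) :
    Submodule.span ℂ (Set.range (normalMonomial f)) = ⊤ := by
  have key : ∀ (P : MvPolynomial (Gen p) ℂ) {m : A},
      m ∈ Submodule.span ℂ (Set.range (normalMonomial f)) →
      MvPolynomial.aeval f P * m ∈ Submodule.span ℂ (Set.range (normalMonomial f)) := by
    intro P
    induction P using MvPolynomial.induction_on with
    | C z =>
      intro m hm
      rw [MvPolynomial.aeval_C, ← Algebra.smul_def]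
      exact Submodule.smul_mem _ _ hm
    | add P Q hP hQ =>
      intro m hm
      rw [map_add, add_mul]
      exact add_mem (hP hm) (hQ hm)
    | mul_X P g hP =>
      intro m hm
      rw [map_mul, MvPolynomial.aeval_X, mul_assoc]
      refine hP (mul_mem_of_mem_span ?_ hm)
      rintro _ ⟨n, rfl⟩
      exact hf.gen_mul_normalMonomial_mem hsurj g n
  refine top_le_iff.mp fun c _ => ?_
  obtain ⟨P, rfl⟩ := hsurj c
  have h1 : (1 : A) ∈ Submodule.span ℂ (Set.range (normalMonomial f)) :=
    Submodule.subset_span ⟨.u 1, hf.u_one⟩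
  simpa using key P h1

end SatisfiesRel

end Reduction

/-! ### The isomorphism and the basis -/

section Main

variable {p : ℕ} [NeZero p] {q : ℂˣ} {hq : IsPrimitiveRoot q p}

open GrothendieckRing

/-- Stated for any family with the characters of the normal forms, because both the basic classes
and the monomials are such families. It is enough that the combination is invisible to the
characters; this stronger form is what proves their injectivity. -/
theorem sum_smul_eq_zero (hq : IsPrimitiveRoot q p)
    {v : NormalForm p → GrothendieckRing (unitOrbit hq) (breakMonoid p q)}
    (hv : ∀ χ n, charHom hq χ (v n) = MonoidAlgebra.single (degProd q n.deg) (n.val q χ))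
    {s : Finset (NormalForm p)} {g : NormalForm p → ℂ}
    (h : ∀ χ, charHom hq χ (∑ n ∈ s, g n • v n) = 0) : ∀ n ∈ s, g n = 0 := by
  refine eq_zero_of_sum_single hq fun χ => ?_
  rw [← h χ, map_sum]
  exact Finset.sum_congr rfl fun n _ => by rw [map_smul, hv]

/-- The classes of modules are separated by the characters. -/
theorem eq_of_charHom_eq {x y : GrothendieckRing (unitOrbit hq) (breakMonoid p q)}
    (h : ∀ χ, charHom hq χ x = charHom hq χ y) : x = y := by
  rw [← sub_eq_zero]
  have hmem : x - y ∈ Submodule.span ℂ (Set.range (basicClass hq)) := by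
    rw [span_range_basicClass]
    exact Submodule.mem_top
  obtain ⟨c, hc⟩ := Finsupp.mem_span_range_iff_exists_finsupp.mp hmem
  -- The difference is a combination of basic classes on which all characters vanish, so its
  -- coefficients are zero.
  have h0 := sum_smul_eq_zero hq charHom_basicClass (s := c.support) (g := c) fun χ => by
    have h1 := congrArg (charHom hq χ) hc
    rw [map_sub, h χ, sub_self] at h1
    exact h1
  rw [← hc]
  exact Finset.sum_eq_zero fun n hn => by simp only [h0 n hn, zero_smul]

/-- The modules behind the two sides need not be compared: their characters agree, and characters
determine classes. -/
theorem basicClass_eq (n : NormalForm p) : basicClass hq n = normalFormElement hq n :=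
  eq_of_charHom_eq fun χ => by rw [charHom_basicClass, charHom_normalFormElement]

theorem linearIndependent_normalFormElement (hq : IsPrimitiveRoot q p) :
    LinearIndependent ℂ (normalFormElement hq) :=
  linearIndependent_iff'.mpr fun s g hg =>
    sum_smul_eq_zero hq charHom_normalFormElement fun χ => by rw [hg, map_zero]

theorem span_normalFormElement (hq : IsPrimitiveRoot q p) :
    Submodule.span ℂ (Set.range (normalFormElement hq)) = ⊤ := by
  rw [← funext (basicClass_eq (hq := hq)), span_range_basicClass]

/-- Characters are algebra homomorphisms and separate points, so a relation holds as soon as it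
holds for their values on the generators. -/
theorem satisfiesRel_genClass (hq : IsPrimitiveRoot q p) : SatisfiesRel (genClass hq) :=
  fun a b h => eq_of_charHom_eq fun χ => by
    have key : ∀ P : MvPolynomial (Gen p) ℂ, charHom hq χ (MvPolynomial.aeval (genClass hq) P) =
        MvPolynomial.aeval (fun g => genVal q χ g • genMon q g) P := fun P => by
      rw [← AlgHom.comp_apply, MvPolynomial.comp_aeval]
      simp only [charHom_genClass]
    rw [key, key]
    exact aeval_genVal_eq h χ

/-- The homomorphism from the presented algebra. -/
def presentedHom (hq : IsPrimitiveRoot q p) :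
    PresentedAlgebra p →ₐ[ℂ] GrothendieckRing (unitOrbit hq) (breakMonoid p q) :=
  Ideal.Quotient.liftₐ (relationIdeal p) (MvPolynomial.aeval (genClass hq)) fun P hP => by
    have hle : relationIdeal p ≤ RingHom.ker (MvPolynomial.aeval (R := ℂ) (genClass hq)) := by
      refine Ideal.span_le.mpr ?_
      rintro _ ⟨a, b, h, rfl⟩
      rw [SetLike.mem_coe, RingHom.mem_ker, map_sub, satisfiesRel_genClass hq a b h, sub_self]
    exact hle hP

/-- The generators of the presented algebra. -/
def presentedGen (g : Gen p) : PresentedAlgebra p :=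
  Ideal.Quotient.mk (relationIdeal p) (MvPolynomial.X g)

theorem presentedHom_gen (g : Gen p) : presentedHom hq (presentedGen g) = genClass hq g :=
  MvPolynomial.aeval_X _ g

theorem aeval_presentedGen (P : MvPolynomial (Gen p) ℂ) :
    MvPolynomial.aeval (presentedGen (p := p)) P = Ideal.Quotient.mk (relationIdeal p) P := by
  have h : MvPolynomial.aeval (presentedGen (p := p)) = Ideal.Quotient.mkₐ ℂ (relationIdeal p) :=
    MvPolynomial.algHom_ext fun g => MvPolynomial.aeval_X _ g
  exact DFunLike.congr_fun h P

theorem satisfiesRel_presentedGen : SatisfiesRel (presentedGen (p := p)) := fun a b h => by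
  rw [aeval_presentedGen, aeval_presentedGen]
  exact Ideal.Quotient.eq.mpr (Ideal.subset_span ⟨a, b, h, rfl⟩)

theorem presentedHom_normalMonomial (n : NormalForm p) :
    presentedHom hq (normalMonomial presentedGen n) = normalFormElement hq n := by
  cases n <;> simp only [normalMonomial, normalFormElement, map_mul, map_prod, map_pow,
    presentedHom_gen, genClass]

/-- The normal form monomials span the source and their images are a basis of the target. A
combination in the kernel therefore has zero coefficients. -/
theorem presentedHom_bijective (hq : IsPrimitiveRoot q p) :
    Function.Bijective (presentedHom hq) := by
  constructor
  · refine (injective_iff_map_eq_zero _).mpr fun x hx => ?_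
    have hmem : x ∈ Submodule.span ℂ (Set.range (normalMonomial (presentedGen (p := p)))) := by
      rw [satisfiesRel_presentedGen.span_normalMonomial]
      · exact Submodule.mem_top
      · intro y
        obtain ⟨P, rfl⟩ := Ideal.Quotient.mk_surjective y
        exact ⟨P, aeval_presentedGen P⟩
    obtain ⟨c, hc⟩ := Finsupp.mem_span_range_iff_exists_finsupp.mp hmem
    have h1 : ∑ n ∈ c.support, c n • normalFormElement hq n = 0 := by
      rw [← hx, ← hc, Finsupp.sum, map_sum]
      exact Finset.sum_congr rfl fun n _ => by rw [map_smul, presentedHom_normalMonomial]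
    have h2 := linearIndependent_iff'.mp (linearIndependent_normalFormElement hq) _ _ h1
    rw [← hc]
    exact Finset.sum_eq_zero fun n hn => by simp only [h2 n hn, zero_smul]
  · have h : Submodule.span ℂ (Set.range (normalFormElement hq)) ≤
        LinearMap.range (presentedHom hq).toLinearMap := by
      refine Submodule.span_le.mpr ?_
      rintro _ ⟨n, rfl⟩
      exact ⟨_, presentedHom_normalMonomial n⟩
    rw [span_normalFormElement] at h
    exact fun y => h Submodule.mem_top

end Main

end

theorem theorem4p3 (p : ℕ) [NeZero p] (q : ℂˣ) (hq : IsPrimitiveRoot q p) :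
    (∃ e : PresentedAlgebra p ≃ₐ[ℂ] GrothendieckRing (unitOrbit hq) (breakMonoid p q),
      ∀ g : Gen p, e (Ideal.Quotient.mk (relationIdeal p) (MvPolynomial.X g)) = genClass hq g) ∧
    (∃ b : Module.Basis (NormalForm p) ℂ (GrothendieckRing (unitOrbit hq) (breakMonoid p q)),
      ∀ n : NormalForm p, b n = normalFormElement hq n) :=
  ⟨⟨AlgEquiv.ofBijective (presentedHom hq) (presentedHom_bijective hq), presentedHom_gen⟩,
    ⟨Module.Basis.mk (linearIndependent_normalFormElement hq) (span_normalFormElement hq).ge,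
      Module.Basis.mk_apply _ _⟩⟩
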